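/- Let $(X,Y)$ be a random pair with $X\in\mathbb{R}^p$ and $Y$ in a metric space $(\mathcal{Y},d)$, let $(X',Y')$ be an independent copy, and let $(X_1,Y_1),(X_2,Y_2),\dots$ be i.i.d. copies of $(X,Y)$. Let $\mathcal{H}$ be a reproducing kernel Hilbert space of real functions on $\mathbb{R}^p$ with kernel $\kappa$ (with measurable feature map $x\mapsto\kappa(\cdot,x)\in\mathcal{H}$), write $(f\otimes g)h=\langle g,h\rangle f$, and put $\mu=E\,\kappa(\cdot,X)$, $$\Sigma=E\{\kappa(\cdot,X)\otimes\kappa(\cdot,X)\}-\mu\otimes\mu,\qquad \Lambda=-E\{(\kappa(\cdot,X)-\mu)\otimes(\kappa(\cdot,X')-\mu)\,d(Y,Y')\}.$$ With $\hat\mu=n^{-1}\sum_{i\le n}\kappa(\cdot,X_i)$ and $\hat\eta_i=\kappa(\cdot,X_i)-\hat\mu$ let $$\hat\Sigma=\frac1n\sum_{i=1}^n\hat\eta_i\otimes\hat\eta_i,\qquad \hat\Lambda=-\frac1{n(n-1)}\sum_{1\le i\ne j\le n}d(Y_i,Y_j)\,\hat\eta_i\otimes\hat\eta_j .$$ Assume: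 1. $E\,\kappa(X,X)<\infty$ and $E\,d^2(Y,Y')<\infty$. 2. $\Lambda=\Sigma S$ for some bounded operator $S$ on $\mathcal{H}$ with $S=QSQ$, where $Q$ is the orthogonal projection onto $\overline{\mathrm{ran}}(\Sigma)$ (such an $S$ is unique). 3. There is a measurable $f:\mathbb{R}^p\to\mathbb{R}^m$ such that $Y$ and $X$ are conditionally independent given $f(X)$ and, with $\mathcal{M}=\sigma(f)$, the set of those functions in $\mathcal{H}$ that are $\mathcal{M}$-measurable (up to $P_X$-null sets) is dense, modulo constants, in the space of $\mathcal{M}$-measurable functions in $L_2(P_X)$. 4. $\varepsilon_n>0$, $\varepsilon_n\to0$ and $n^{-1/2}/\varepsilon_n^{3/2}\to0$. Let $V=\Sigma^{-1/2}\Lambda\Lambda^*\Sigma^{-1/2}$, where $\Sigma^{-1/2}$ is the Moore–Penrose inverse of $\Sigma^{1/2}$; that is, $V$ is the bounded operator that equals this composition on $\mathrm{ran}(\Sigma^{1/2})$ and vanishes on $\mathrm{ran}(\Sigma^{1/2})^{\perp}$. Let $\hat V_n=(\hat\Sigma+\varepsilon_nI)^{-1/2}\hat\Lambda\hat\Lambda^*(\hat\Sigma+\varepsilon_nI)^{-1/2}$.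 Then $V$ exists and is unique, and, as $n\to\infty$, $$\|\hat V_n-V\|_{\mathrm{HS}}\to0\quad\text{in probability},$$ where $\|\cdot\|_{\mathrm{HS}}$ is the Hilbert–Schmidt norm. Suppose moreover that a maximizer $\psi_1$ of $\langle g,Vg\rangle$ over $\|g\|=1$ exists and is unique up to sign, and that $\psi_1\in\mathrm{ran}(\Sigma)$. Put $f_1=\Sigma^{-1/2}\psi_1$, let $\hat\psi_1=\hat\psi_{1,n}$ be any maximizer of $\langle g,\hat V_ng\rangle$ over $\|g\|=1$, and put $\hat f_1=(\hat\Sigma+\varepsilon_nI)^{-1/2}\hat\psi_1$. Then $$|\langle\hat\psi_1,\psi_1\rangle|\to1\quad\text{in probability},$$ and, when the sign of $\hat\psi_1$ is chosen so that $\langle\hat\psi_1,\psi_1\rangle\ge0$, $$\big\|\{\hat f_1-E\hat f_1(X)\}-\{f_1-Ef_1(X)\}\big\|_{L_2(P_X)}\to0\quad\text{in probability},$$ where $E\hat f_1(X)$ is taken over $X$ independent of the sample, with $\hat f_1$ held fixed. -/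

import Mathlib

open MeasureTheory ProbabilityTheory Filter Topology InnerProductSpace
open scoped ENNReal RealInnerProductSpace

noncomputable section

namespace FrechetSDR

/-! ## Operators on a real Hilbert space -/

section Operators

variable {H : Type*} [NormedAddCommGroup H] [InnerProductSpace ℝ H] [CompleteSpace H]

/-- The positive square root `A^{1/2}` of a positive bounded operator `A`, that is, the (unique)
positive `R` with `R ∘ R = A` (and `0` if `A` has no such root). -/
def opSqrt (A : H →L[ℝ] H) : H →L[ℝ] H :=
  open Classical in
  if h : ∃ R : H →L[ℝ] H, R.IsPositive ∧ R ∘L R = A then h.choose else 0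

/-- `x = T⁻¹ y` for the Moore-Penrose inverse `T⁻¹` of a bounded operator `T`: `x` is the (unique)
preimage of `y` under `T` that is orthogonal to the kernel of `T`. -/
def IsInverseImage (T : H →L[ℝ] H) (y x : H) : Prop :=
  T x = y ∧ x ∈ (LinearMap.ker (T : H →ₗ[ℝ] H))ᗮ

/-- `V = R⁻¹ B R⁻¹` for bounded `B` and positive `R`, where `R⁻¹` is the (possibly unbounded)
Moore-Penrose inverse: on the range of `R` the composition `R⁻¹ B R⁻¹` is defined and agrees with
the bounded operator `V`, and `V` vanishes on the orthogonal complement of that range. -/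
def IsSandwich (R B V : H →L[ℝ] H) : Prop :=
  (∀ g ∈ LinearMap.range (R : H →ₗ[ℝ] H),
    ∃ u w : H, IsInverseImage R g u ∧ IsInverseImage R (B u) w ∧ V g = w) ∧
  ∀ g ∈ (LinearMap.range (R : H →ₗ[ℝ] H))ᗮ, V g = 0

/-- `∑ᵢ ‖T eᵢ‖²` for a Hilbert basis `(eᵢ)`. -/
def hsSq {ι : Type*} (b : HilbertBasis ι ℝ H) (T : H →L[ℝ] H) : ℝ≥0∞ :=
  ∑' i, ‖T (b i)‖ₑ ^ 2

/-- A Hilbert basis of `H`. -/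
def someBasis (H : Type*) [NormedAddCommGroup H] [InnerProductSpace ℝ H] [CompleteSpace H] :
    HilbertBasis (exists_hilbertBasis ℝ H).choose ℝ H :=
  (exists_hilbertBasis ℝ H).choose_spec.choose

/-- The Hilbert-Schmidt norm `(∑ᵢ ‖T eᵢ‖²)^{1/2} ∈ [0, ∞]`. -/
def hsNorm (T : H →L[ℝ] H) : ℝ≥0∞ := hsSq (someBasis H) T ^ (1 / 2 : ℝ)

theorem enorm_sq_eq_ofReal {G : Type*} [NormedAddCommGroup G] (z : G) :
    ‖z‖ₑ ^ 2 = ENNReal.ofReal (‖z‖ ^ 2) := by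
  rw [ENNReal.ofReal_pow (norm_nonneg _), ofReal_norm]

theorem enorm_sq_eq_tsum {ι : Type*} (b : HilbertBasis ι ℝ H) (x : H) :
    ‖x‖ₑ ^ 2 = ∑' i, ‖⟪b i, x⟫‖ₑ ^ 2 := by
  have h := b.hasSum_inner_mul_inner x x
  have h2 : HasSum (fun i => ‖⟪b i, x⟫‖ ^ 2) (‖x‖ ^ 2) := by
    rw [real_inner_self_eq_norm_sq] at h
    have e : (fun i => ‖⟪b i, x⟫‖ ^ 2) = fun i => ⟪x, b i⟫ * ⟪b i, x⟫ := by
      funext i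
      rw [real_inner_comm x (b i), Real.norm_eq_abs, sq_abs, sq]
    rw [e]
    exact h
  rw [enorm_sq_eq_ofReal, ← h2.tsum_eq, ENNReal.ofReal_tsum_of_nonneg (fun _ => by positivity) h2.summable]
  exact tsum_congr fun i => (enorm_sq_eq_ofReal _).symm

theorem hsSq_adjoint {ι κ : Type*} (b : HilbertBasis ι ℝ H) (c : HilbertBasis κ ℝ H)
    (T : H →L[ℝ] H) : hsSq b T = hsSq c (ContinuousLinearMap.adjoint T) := by
  unfold hsSq
  simp_rw [enorm_sq_eq_tsum c (T _), enorm_sq_eq_tsum b (ContinuousLinearMap.adjoint T _)]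
  rw [ENNReal.tsum_comm]
  refine tsum_congr fun j => tsum_congr fun i => ?_
  rw [ContinuousLinearMap.adjoint_inner_right, real_inner_comm]

/-- The Hilbert-Schmidt norm does not depend on the Hilbert basis. -/
theorem hsNorm_eq {ι : Type*} (b : HilbertBasis ι ℝ H) (T : H →L[ℝ] H) :
    hsNorm T = (∑' i, ‖T (b i)‖ₑ ^ 2) ^ (1 / 2 : ℝ) := by
  have h := (hsSq_adjoint (someBasis H) b T).trans
    ((hsSq_adjoint b b T).symm)
  rw [hsNorm, h, hsSq]

/-- `ψ` maximizes `g ↦ ⟨g, V g⟩` over the unit sphere. -/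
def IsLeading (V : H →L[ℝ] H) (ψ : H) : Prop :=
  ‖ψ‖ = 1 ∧ ∀ g : H, ‖g‖ = 1 → ⟪g, V g⟫ ≤ ⟪ψ, V ψ⟫

end Operators

/-! ## Convergence in probability and conditional independence -/

/-- The `[0, ∞]`-valued random variables `Z n` converge to `0` in probability. -/
def TendstoZeroInProb {Ω : Type*} [MeasurableSpace Ω] (P : Measure Ω) (Z : ℕ → Ω → ℝ≥0∞) : Prop :=
  ∀ δ : ℝ≥0∞, 0 < δ → Tendsto (fun n => P {ω | δ ≤ Z n ω}) atTop (𝓝 0)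

/-- `U` and `W` are conditionally independent given the sub-σ-algebra `m`. -/
def CondIndepGiven {Ω α β : Type*} [MeasurableSpace Ω] [MeasurableSpace α] [MeasurableSpace β]
    (μ : Measure Ω) (m : MeasurableSpace Ω) (U : Ω → α) (W : Ω → β) : Prop :=
  ∀ (A : Set α) (B : Set β), MeasurableSet A → MeasurableSet B →
    μ⟦U ⁻¹' A ∩ W ⁻¹' B | m⟧ =ᵐ[μ] μ⟦U ⁻¹' A | m⟧ * μ⟦W ⁻¹' B | m⟧

/-! ## Measurable functions in a reproducing kernel Hilbert space -/

section CentralClass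

variable {E : Type*} (H : Type*) [NormedAddCommGroup H] [InnerProductSpace ℝ H] [RKHS ℝ H E ℝ]

/-- The functions in `H` that are measurable (up to `π`-null sets) with respect to `m`. -/
def measClass (m : MeasurableSpace E) {m₀ : MeasurableSpace E} (π : Measure E) : Set H :=
  {h | AEStronglyMeasurable[m] (fun x => h x) π}

/-- The `m`-measurable functions in `H` are dense, modulo constants, in the space of all
`m`-measurable functions in `L₂(π)`. -/
def DenseModConst (m : MeasurableSpace E) {m₀ : MeasurableSpace E} (π : Measure E) : Prop :=
  ∀ φ : E → ℝ, MemLp φ 2 π → AEStronglyMeasurable[m] φ π →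
    ∀ δ : ℝ≥0∞, 0 < δ → ∃ h ∈ measClass H m π, ∃ c : ℝ,
      eLpNorm (fun x => h x + c - φ x) 2 π < δ

end CentralClass

/-! ## Population and sample operators

`E` is the predictor space, `𝓨` the metric response space, `ν` the law of `(X, Y)`, and `H` a
reproducing kernel Hilbert space of real functions on `E`. `rankOne ℝ f g` is `f ⊗ g`, that is,
`h ↦ ⟨g, h⟩ f`. -/

section RKHSOperators

variable {E 𝓨 : Type*} [MeasurableSpace E] [MetricSpace 𝓨] [MeasurableSpace 𝓨]
variable (H : Type*) [NormedAddCommGroup H] [InnerProductSpace ℝ H] [CompleteSpace H]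
  [RKHS ℝ H E ℝ]

/-- The kernel function `κ(·, x)`. -/
def feat (x : E) : H := RKHS.kerFun H x (1 : ℝ)

/-- The kernel `κ(x, y)`. -/
def kerVal (x y : E) : ℝ := RKHS.kernel H x y (1 : ℝ)

/-- `μ_X = E κ(·, X)`. -/
def meanEmb (ν : Measure (E × 𝓨)) : H := ∫ z, feat H z.1 ∂ν

/-- The covariance operator `Σ_XX = E{κ(·, X) ⊗ κ(·, X)} - μ_X ⊗ μ_X`. -/
def covOp (ν : Measure (E × 𝓨)) : H →L[ℝ] H :=
  (∫ z, rankOne ℝ (feat H z.1) (feat H z.1) ∂ν) - rankOne ℝ (meanEmb H ν) (meanEmb H ν)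

/-- The weighted inverse regression ensemble operator
`Λ = -E{(κ(·, X) - μ_X) ⊗ (κ(·, X') - μ_X) d(Y, Y')}`. -/
def wireOp (ν : Measure (E × 𝓨)) : H →L[ℝ] H :=
  -∫ q : (E × 𝓨) × (E × 𝓨), dist q.1.2 q.2.2 •
    rankOne ℝ (feat H q.1.1 - meanEmb H ν) (feat H q.2.1 - meanEmb H ν) ∂(ν.prod ν)

/-- `Λ = Σ S` for some bounded operator `S` with `S = Q S Q`, where `Q` is the orthogonal
projection onto the closure of the range of `Σ` (such an `S` is unique). -/
def HasCorrelationOp (ν : Measure (E × 𝓨)) : Prop :=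
  ∃ S : H →L[ℝ] H, wireOp H ν = covOp H ν ∘L S ∧
    S = (LinearMap.range (covOp H ν : H →ₗ[ℝ] H)).topologicalClosure.starProjection ∘L S ∘L
      (LinearMap.range (covOp H ν : H →ₗ[ℝ] H)).topologicalClosure.starProjection

/-- `V` is the operator `Σ^{-1/2} Λ Λ* Σ^{-1/2}`. -/
def IsTargetOp (ν : Measure (E × 𝓨)) (V : H →L[ℝ] H) : Prop :=
  IsSandwich (opSqrt (covOp H ν))
    (wireOp H ν ∘L ContinuousLinearMap.adjoint (wireOp H ν)) V

/-- `μ̂` from the first `n` observations in `z`. -/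
def meanHat (n : ℕ) (z : ℕ → E × 𝓨) : H := (n : ℝ)⁻¹ • ∑ i ∈ Finset.range n, feat H (z i).1

/-- The sample covariance operator `Σ̂`. -/
def covHat (n : ℕ) (z : ℕ → E × 𝓨) : H →L[ℝ] H :=
  (n : ℝ)⁻¹ • ∑ i ∈ Finset.range n,
    rankOne ℝ (feat H (z i).1 - meanHat H n z) (feat H (z i).1 - meanHat H n z)

/-- The sample operator `Λ̂`. -/
def wireHat (n : ℕ) (z : ℕ → E × 𝓨) : H →L[ℝ] H :=
  -(((n : ℝ) * ((n : ℝ) - 1))⁻¹ • ∑ i ∈ Finset.range n, ∑ j ∈ (Finset.range n).erase i,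
    dist (z i).2 (z j).2 •
      rankOne ℝ (feat H (z i).1 - meanHat H n z) (feat H (z j).1 - meanHat H n z))

/-- `(Σ̂ + ε I)^{-1/2}`. -/
def invSqrtHat (n : ℕ) (ε : ℝ) (z : ℕ → E × 𝓨) : H →L[ℝ] H :=
  Ring.inverse (opSqrt (covHat H n z + ε • ContinuousLinearMap.id ℝ H))

/-- `V̂ = (Σ̂ + ε I)^{-1/2} Λ̂ Λ̂* (Σ̂ + ε I)^{-1/2}`. -/
def targetHat (n : ℕ) (ε : ℝ) (z : ℕ → E × 𝓨) : H →L[ℝ] H :=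
  invSqrtHat H n ε z ∘L wireHat H n z ∘L ContinuousLinearMap.adjoint (wireHat H n z) ∘L
    invSqrtHat H n ε z

variable {H}

/-- The centered function `h(X) - E h(X)`, `X ∼ π`. -/
def centered (π : Measure E) (h : H) : E → ℝ := fun x => h x - ∫ x', h x' ∂π

end RKHSOperators

end FrechetSDR

end

/-! Write η = κ(·, X) − μ and fix a base point y₀. Since η has mean zero, Λ = E{η ⊗ m(Y)} with m(y)
= −E[{d(y, Y′) − d(y₀, Y′)} η′], and the triangle inequality bounds ‖m‖ by a constant
(`norm_regVec_le`). The equation Λ = ΣS says that the residual ζ = m(Y) − S*η is uncorrelated with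
η. Conditional independence makes E{⟨m(Y), h⟩ | X} a function of f(X), and density makes that
function an L₂ limit of elements of H plus constants. The normal equations then identify it, up to a
constant, with ⟨η, Sh⟩. Hence S*η, and with it ζ, is almost surely bounded (`ae_norm_resid_le`).

In the sample, Λ̂ = Σ̂S + N + E (`wireHat_eq_add`), where N averages η̂ᵢ ⊗ ζᵢ and E averages η̂ᵢ ⊗
{m̂ᵢ − m(Yᵢ)}. As ζ is bounded, second moments of η suffice for ‖N‖ = O_P(n^{-1/2}), and the rate
condition turns this into o(εₙ). Put K = (Σ̂ + εₙI)^{-1/2}. By Bessel's inequality, K applied to the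
average of η̂ᵢ ⊗ cᵢ has squared Hilbert–Schmidt norm at most the average of ‖cᵢ‖²
(`hsSq_invSqrtHat_comp_le`), with no loss in ε. So KE = O_P(n^{-1/2}), and KΛ̂ is bounded in
Hilbert–Schmidt norm.

The square root is continuous in operator norm, so KΣ̂ → Σ^{1/2} and KΛ̂ → A = Σ^{1/2}S in operator
norm, while V = AA* (`isSandwich_iff`). In DD* − AA* = D(D − A)* + (D − A)A* with D = KΛ̂, each
product has one factor small in operator norm and one bounded in Hilbert–Schmidt norm; this gives
the first claim (`tendsto_hsSq`).

V is a norm limit of compact operators, hence compact, and almost maximizers of its quadratic form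
approach ±ψ₁ (`tendsto_abs_inner_leading`). The L₂ norm of a centered function h is ‖Σ^{1/2}h‖, so
the last claim reads Σ^{1/2}Kψ̂ → ψ₁. The eigenvalue equation gives Σ^{1/2}Kψ̂ = λ̂⁻¹
Σ^{1/2}K·KΛ̂·(KΛ̂)*ψ̂. The two factors K cost ε⁻¹, which ‖N‖ = o(ε) absorbs, and the bias εΣ^{1/2}K²
tends to zero (`tendsto_bias`). These limits are deterministic arguments along the filter `inProb`,
which encodes convergence in probability. -/

set_option linter.unusedSectionVars false

noncomputable section

namespace FrechetSDR

/-! ### Positive operators: square roots, leading vectors, regularized inverses. -/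

section OperatorTheory

variable {H : Type*} [NormedAddCommGroup H] [InnerProductSpace ℝ H] [CompleteSpace H]

theorem isPositive_of_inner_nonneg {T : H →L[ℝ] H} (hT : IsSelfAdjoint T)
    (h : ∀ x, 0 ≤ ⟪T x, x⟫) : T.IsPositive :=
  (ContinuousLinearMap.isPositive_iff' T).2 ⟨hT, h⟩

theorem inner_map_comm {T : H →L[ℝ] H} (hT : IsSelfAdjoint T) (x y : H) :
    ⟪T x, y⟫ = ⟪x, T y⟫ := hT.isSymmetric x y

theorem norm_le_of_abs_inner_le {T : H →L[ℝ] H} (hT : IsSelfAdjoint T) {c : ℝ} (hc : 0 ≤ c)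
    (h : ∀ x, |⟪T x, x⟫| ≤ c * ‖x‖ ^ 2) : ‖T‖ ≤ c := by
  rw [ContinuousLinearMap.norm_eq_iSup_rayleighQuotient T hT.isSymmetric]
  refine ciSup_le fun x => ?_
  by_cases hx : x = 0
  · simpa [hx] using hc
  have hx' : 0 < ‖x‖ ^ 2 := by positivity
  rw [ContinuousLinearMap.rayleighQuotient, abs_div, abs_sq, div_le_iff₀ hx']
  exact h x

/-- `‖P - Q‖² ≤ ‖P² - Q²‖` for positive operators. -/
theorem norm_sub_sq_le {P Q : H →L[ℝ] H} (hP : P.IsPositive) (hQ : Q.IsPositive) :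
    ‖P - Q‖ ^ 2 ≤ ‖P ∘L P - Q ∘L Q‖ := by
  have hX : IsSelfAdjoint (P - Q) := hP.isSelfAdjoint.sub hQ.isSelfAdjoint
  set X := P - Q with hXdef
  set C := P + Q
  -- With s = ⟨Xx, x⟩, the vector x is an eigenvector of X up to √(‖X‖² − s²). So ⟨(P² − Q²)x, x⟩ =
  -- ⟨Xx, Cx⟩ is close to s⟨x, Cx⟩, and |s| ≤ ⟨x, Cx⟩ because P and Q are positive.
  have key : ∀ x : H, ‖x‖ = 1 →
      ⟪X x, x⟫ ^ 2 - √(‖X‖ ^ 2 - ⟪X x, x⟫ ^ 2) * ‖C‖ ≤ ‖P ∘L P - Q ∘L Q‖ := by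
    intro x hx
    set s := ⟪X x, x⟫ with hs
    have e1 : ⟪(P ∘L P - Q ∘L Q) x, x⟫ = ⟪X x, C x⟫ := by
      simp only [X, C, sub_apply, add_apply,
        ContinuousLinearMap.comp_apply, inner_sub_left, inner_add_right]
      rw [inner_map_comm hP.isSelfAdjoint (P x) x, inner_map_comm hQ.isSelfAdjoint (Q x) x,
        real_inner_comm (P x) (Q x)]
      ring
    have e2 : ⟪X x, C x⟫ = s * ⟪x, C x⟫ + ⟪X x - s • x, C x⟫ := by
      rw [inner_sub_left, real_inner_smul_left]; ring
    have e3 : ‖X x - s • x‖ ^ 2 = ‖X x‖ ^ 2 - s ^ 2 := by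
      rw [norm_sub_sq_real, real_inner_smul_right, ← hs, norm_smul, hx]
      simp; ring
    have e4 : ‖X x - s • x‖ ≤ √(‖X‖ ^ 2 - s ^ 2) := by
      apply Real.le_sqrt_of_sq_le
      rw [e3]
      have : ‖X x‖ ≤ ‖X‖ := by simpa [hx] using X.le_opNorm x
      gcongr
    have e5 : |⟪X x - s • x, C x⟫| ≤ √(‖X‖ ^ 2 - s ^ 2) * ‖C‖ := by
      refine (abs_real_inner_le_norm _ _).trans ?_
      gcongr
      simpa [hx] using C.le_opNorm x
    have p := hP.inner_nonneg_left x
    have q := hQ.inner_nonneg_left x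
    have hsX : s = ⟪P x, x⟫ - ⟪Q x, x⟫ := by simp [hs, X, inner_sub_left]
    have hC : ⟪x, C x⟫ = ⟪P x, x⟫ + ⟪Q x, x⟫ := by
      rw [real_inner_comm]; simp [C, inner_add_left]
    have e7 : ⟪(P ∘L P - Q ∘L Q) x, x⟫ ≤ ‖P ∘L P - Q ∘L Q‖ := by
      refine (real_inner_le_norm _ _).trans ?_
      simpa [hx] using (P ∘L P - Q ∘L Q).le_opNorm x
    have e7' : -⟪(P ∘L P - Q ∘L Q) x, x⟫ ≤ ‖P ∘L P - Q ∘L Q‖ := by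
      refine (neg_le_abs _).trans ((abs_real_inner_le_norm _ _).trans ?_)
      simpa [hx] using (P ∘L P - Q ∘L Q).le_opNorm x
    rw [e1, e2] at e7 e7'
    have e8 := abs_le.1 e5
    rcases le_total 0 s with h0 | h0
    · have : s ^ 2 ≤ s * ⟪x, C x⟫ := by rw [sq]; gcongr; linarith
      linarith [e8.1]
    · have : s ^ 2 ≤ -(s * ⟪x, C x⟫) := by nlinarith
      linarith [e8.2]
  -- The supremum of the Rayleigh quotient need not be attained, so the bound `key` is pushed to |s|
  -- → ‖X‖ by continuity.
  by_contra! hlt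
  have hcont : Continuous fun t : ℝ => t ^ 2 - √(‖X‖ ^ 2 - t ^ 2) * ‖C‖ := by fun_prop
  have hev : ∀ᶠ t in 𝓝 ‖X‖, ‖P ∘L P - Q ∘L Q‖ < t ^ 2 - √(‖X‖ ^ 2 - t ^ 2) * ‖C‖ :=
    hcont.continuousAt.eventually_const_lt (by simpa using hlt)
  have hXpos : 0 < ‖X‖ := by
    rw [norm_pos_iff]; rintro h0; rw [h0] at hlt; simp at hlt
    exact absurd hlt (not_lt.2 (norm_nonneg _))
  obtain ⟨a, ha, haX⟩ := (mem_nhdsLE_iff_exists_Ioc_subset' hXpos).1 (mem_nhdsWithin_of_mem_nhds hev)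
  have hlt2 : max a 0 < ⨆ x, |X.rayleighQuotient x| := by
    rw [← ContinuousLinearMap.norm_eq_iSup_rayleighQuotient X hX.isSymmetric]
    exact max_lt ha hXpos
  obtain ⟨x, hx⟩ := exists_lt_of_lt_ciSup hlt2
  have hx0 : x ≠ 0 := by
    rintro rfl
    simp at hx
  have hxn : ‖x‖ ≠ 0 := norm_ne_zero_iff.2 hx0
  have hu : ‖(‖x‖⁻¹ : ℝ) • x‖ = 1 := by simp [norm_smul, hxn]
  have hq : ⟪X ((‖x‖⁻¹ : ℝ) • x), (‖x‖⁻¹ : ℝ) • x⟫ = X.rayleighQuotient x := by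
    rw [map_smul, real_inner_smul_left, real_inner_smul_right,
      ContinuousLinearMap.rayleighQuotient]
    simp only [ContinuousLinearMap.reApplyInnerSelf_apply]
    simp
    field_simp
  have := key _ hu
  rw [hq, ← sq_abs] at this
  refine absurd this (not_le.2 (haX ⟨(le_max_left _ _).trans_lt hx, X.rayleighQuotient_le_norm x⟩))

/-- The root is 1 − Z with Z = (X + Z²)/2. The fixed-point iteration from 0 is dominated, increments
included, by the scalar iteration with X replaced by 1; the latter is bounded by 1, so its
increments are summable. -/
theorem exists_sqrt_one_sub {X : H →L[ℝ] H} (hX : IsSelfAdjoint X) (h1 : ‖X‖ ≤ 1) :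
    ∃ R : H →L[ℝ] H, R.IsPositive ∧ R ∘L R = 1 - X := by
  obtain ⟨y, y0, ys⟩ : ∃ y : ℕ → ℝ, y 0 = 0 ∧ ∀ n, y (n + 1) = (1 / 2) * (1 + y n ^ 2) :=
    ⟨fun n => Nat.rec 0 (fun _ a => (1 / 2) * (1 + a ^ 2)) n, rfl, fun _ => rfl⟩
  obtain ⟨Y, Y0, Ys⟩ : ∃ Y : ℕ → H →L[ℝ] H, Y 0 = 0 ∧
      ∀ n, Y (n + 1) = (1 / 2 : ℝ) • (X + Y n * Y n) :=
    ⟨fun n => Nat.rec 0 (fun _ a => (1 / 2 : ℝ) • (X + a * a)) n, rfl, fun _ => rfl⟩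
  have ynn : ∀ n, 0 ≤ y n ∧ y n ≤ 1 := by
    intro n
    induction n with
    | zero => simp [y0]
    | succ n ih => rw [ys]; constructor <;> nlinarith [ih.1, ih.2]
  have hY : ∀ n, ‖Y n‖ ≤ y n := by
    intro n
    induction n with
    | zero => simp [y0, Y0]
    | succ n ih =>
      rw [ys, Ys, norm_smul]
      have : ‖X + Y n * Y n‖ ≤ 1 + y n ^ 2 := by
        refine (norm_add_le _ _).trans (add_le_add h1 ((norm_mul_le _ _).trans ?_))
        rw [sq]; gcongr; exact (ynn n).1
      simpa using this
  have hD : ∀ n, ‖Y (n + 1) - Y n‖ ≤ y (n + 1) - y n := by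
    intro n
    induction n with
    | zero => simpa [y0, Y0] using hY 1
    | succ n ih =>
      have e : Y (n + 2) - Y (n + 1) =
          (1 / 2 : ℝ) • ((Y (n + 1) - Y n) * Y (n + 1) + Y n * (Y (n + 1) - Y n)) := by
        rw [Ys (n + 1)]
        nth_rw 3 [Ys n]
        rw [← smul_sub]
        congr 1
        noncomm_ring
      rw [e, norm_smul, ys (n + 1)]
      have : ‖(Y (n + 1) - Y n) * Y (n + 1) + Y n * (Y (n + 1) - Y n)‖ ≤
          (y (n + 1) - y n) * y (n + 1) + y n * (y (n + 1) - y n) := by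
        refine (norm_add_le _ _).trans (add_le_add ((norm_mul_le _ _).trans ?_)
          ((norm_mul_le _ _).trans ?_))
        · gcongr
          · exact (norm_nonneg _).trans ih
          · exact hY _
        · gcongr
          · exact (ynn n).1
          · exact hY _
      simp only [norm_div, norm_one, Real.norm_ofNat]
      nlinarith [ys n]
  have hsum : Summable fun n => y (n + 1) - y n := by
    refine summable_of_sum_range_le (c := 1) (fun n => (norm_nonneg _).trans (hD n)) fun n => ?_
    rw [Finset.sum_range_sub, y0]
    linarith [(ynn n).2]
  have hcau : CauchySeq Y := by
    refine cauchySeq_of_dist_le_of_summable _ (fun n => ?_) hsum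
    rw [dist_comm, dist_eq_norm]; exact hD n
  obtain ⟨Z, hZ⟩ := cauchySeq_tendsto_of_complete hcau
  have hZeq : Z = (1 / 2 : ℝ) • (X + Z * Z) :=
    tendsto_nhds_unique ((tendsto_add_atTop_iff_nat 1).2 hZ) (by
      simp only [Ys]
      exact (tendsto_const_nhds.add (hZ.mul hZ)).const_smul _)
  have hYsa : ∀ n, IsSelfAdjoint (Y n) := by
    intro n
    induction n with
    | zero => rw [Y0]; exact .zero _
    | succ n ih =>
      rw [Ys]
      refine IsSelfAdjoint.smul (by simp [IsSelfAdjoint]) (hX.add ?_)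
      rw [← sq]; exact ih.pow 2
  have hZsa : IsSelfAdjoint Z := by
    have h : Tendsto (fun n => star (Y n)) atTop (𝓝 (star Z)) := (continuous_star.tendsto Z).comp hZ
    have h' : (fun n => star (Y n)) = Y := funext fun n => hYsa n
    rw [h'] at h
    exact tendsto_nhds_unique h hZ
  have hZ1 : ‖Z‖ ≤ 1 :=
    le_of_tendsto hZ.norm (Eventually.of_forall fun n => (hY n).trans (ynn n).2)
  refine ⟨1 - Z, isPositive_of_inner_nonneg ((IsSelfAdjoint.one _).sub hZsa) fun x => ?_, ?_⟩
  · rw [sub_apply, inner_sub_left, one_apply_eq_self,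
      real_inner_self_eq_norm_sq]
    have := real_inner_le_norm (Z x) x
    have h2 : ‖Z x‖ ≤ ‖x‖ := (Z.le_opNorm x).trans (by nlinarith [norm_nonneg x])
    nlinarith [norm_nonneg x]
  · change (1 - Z) * (1 - Z) = 1 - X
    have h2 : (2 : ℝ) • Z = X + Z * Z := by
      nth_rw 1 [hZeq]; rw [smul_smul]; norm_num
    have h3 : Z + Z = X + Z * Z := by rw [← h2, two_smul]
    calc (1 - Z) * (1 - Z) = 1 - (Z + Z) + Z * Z := by noncomm_ring
      _ = 1 - X := by rw [h3]; abel

/-- Rescaling by M gives 0 ≤ A/M ≤ 1, so 1 − A/M is self-adjoint of norm at most 1; the summand 1 in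
M covers A = 0. -/
theorem exists_sqrt {A : H →L[ℝ] H} (hA : A.IsPositive) :
    ∃ R : H →L[ℝ] H, R.IsPositive ∧ R ∘L R = A := by
  set M := ‖A‖ + 1 with hM
  have hMpos : 0 < M := by positivity
  have hsa : IsSelfAdjoint (1 - M⁻¹ • A) :=
    (IsSelfAdjoint.one _).sub (IsSelfAdjoint.smul (by simp [IsSelfAdjoint]) hA.isSelfAdjoint)
  obtain ⟨R, hR, hRR⟩ := exists_sqrt_one_sub hsa (norm_le_of_abs_inner_le hsa zero_le_one (by
    intro x
    rw [sub_apply, inner_sub_left, one_apply_eq_self,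
      real_inner_self_eq_norm_sq, smul_apply, real_inner_smul_left]
    have h1 : ⟪A x, x⟫ ≤ M * ‖x‖ ^ 2 := by
      refine (real_inner_le_norm _ _).trans ?_
      nlinarith [A.le_opNorm x, norm_nonneg x]
    have h2 := hA.inner_nonneg_left x
    have h3 : M⁻¹ * ⟪A x, x⟫ ≤ ‖x‖ ^ 2 := by
      rw [inv_mul_le_iff₀ hMpos]; exact h1
    have h4 : 0 ≤ M⁻¹ * ⟪A x, x⟫ := mul_nonneg (by positivity) h2
    rw [abs_le]; constructor <;> nlinarith [sq_nonneg ‖x‖]))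
  refine ⟨√M • R, hR.smul_of_nonneg (Real.sqrt_nonneg _), ?_⟩
  rw [ContinuousLinearMap.smul_comp, ContinuousLinearMap.comp_smul, hRR, smul_smul,
    Real.mul_self_sqrt hMpos.le, sub_sub_cancel, smul_smul, mul_inv_cancel₀ hMpos.ne', one_smul]

theorem opSqrt_spec {A : H →L[ℝ] H} (hA : A.IsPositive) :
    (opSqrt A).IsPositive ∧ opSqrt A ∘L opSqrt A = A := by
  classical
  have h := exists_sqrt hA
  rw [opSqrt, dif_pos h]
  exact h.choose_spec

theorem norm_opSqrt_apply_sq {A : H →L[ℝ] H} (hA : A.IsPositive) (x : H) :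
    ‖opSqrt A x‖ ^ 2 = ⟪A x, x⟫ := by
  obtain ⟨h1, h2⟩ := opSqrt_spec hA
  rw [← real_inner_self_eq_norm_sq, inner_map_comm h1.isSelfAdjoint, real_inner_comm]
  conv_rhs => rw [← h2]
  rfl

/-- A vector annihilated by the quadratic form of a positive operator is in its kernel. -/
theorem map_eq_zero_of_inner_eq_zero {T : H →L[ℝ] H} (hT : T.IsPositive) {x : H}
    (h : ⟪T x, x⟫ = 0) : T x = 0 := by
  have h1 : opSqrt T x = 0 := by
    rw [← norm_eq_zero, ← sq_eq_zero_iff, norm_opSqrt_apply_sq hT, h]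
  rw [← (opSqrt_spec hT).2, ContinuousLinearMap.comp_apply, h1, map_zero]

theorem inner_map_sub_nonneg {V : H →L[ℝ] H} {lam : ℝ}
    (h : ∀ g : H, ‖g‖ = 1 → ⟪g, V g⟫ ≤ lam) (x : H) : ⟪x, V x⟫ ≤ lam * ‖x‖ ^ 2 := by
  by_cases hx : x = 0
  · simp [hx]
  have hxn : ‖x‖ ≠ 0 := norm_ne_zero_iff.2 hx
  have := h ((‖x‖⁻¹ : ℝ) • x) (by simp [norm_smul, hxn])
  rw [map_smul, real_inner_smul_left, real_inner_smul_right, ← mul_assoc, ← sq, inv_pow,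
    inv_mul_le_iff₀ (by positivity)] at this
  linarith

/-- A leading vector is an eigenvector. -/
theorem IsLeading.map_eq {V : H →L[ℝ] H} (hV : IsSelfAdjoint V) {ψ : H} (h : IsLeading V ψ) :
    V ψ = ⟪ψ, V ψ⟫ • ψ := by
  set lam := ⟪ψ, V ψ⟫ with hlam
  -- The operator λ − V is positive and its quadratic form vanishes at ψ, hence it annihilates ψ.
  have hpos : (lam • (1 : H →L[ℝ] H) - V).IsPositive := by
    refine isPositive_of_inner_nonneg
      ((IsSelfAdjoint.smul (by simp [IsSelfAdjoint]) (IsSelfAdjoint.one _)).sub hV) fun x => ?_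
    have := inner_map_sub_nonneg h.2 x
    rw [sub_apply, inner_sub_left, smul_apply,
      one_apply_eq_self, real_inner_smul_left, real_inner_self_eq_norm_sq,
      real_inner_comm]
    linarith
  have := map_eq_zero_of_inner_eq_zero hpos (x := ψ) (by
    rw [sub_apply, inner_sub_left, smul_apply,
      one_apply_eq_self, real_inner_smul_left, real_inner_self_eq_norm_sq,
      real_inner_comm, h.1, ← hlam]
    ring)
  rw [sub_apply, sub_eq_zero] at this
  exact this.symm

/-- The inverse of the square root of `A + ε I`. -/
theorem inverse_opSqrt_add {A : H →L[ℝ] H} (hA : A.IsPositive) {ε : ℝ} (hε : 0 < ε) :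
    let B := opSqrt (A + ε • ContinuousLinearMap.id ℝ H)
    let K := Ring.inverse B
    B.IsPositive ∧ B ∘L B = A + ε • ContinuousLinearMap.id ℝ H ∧ K ∘L B = 1 ∧ B ∘L K = 1 ∧
      IsSelfAdjoint K ∧ ‖K‖ ≤ (√ε)⁻¹ := by
  intro B K
  have hpos : (A + ε • ContinuousLinearMap.id ℝ H).IsPositive :=
    hA.add (ContinuousLinearMap.isPositive_id.smul_of_nonneg hε.le)
  obtain ⟨hB, hBB⟩ := opSqrt_spec hpos
  have hsq : ∀ x, ⟪(A + ε • ContinuousLinearMap.id ℝ H) x, x⟫ = ⟪A x, x⟫ + ε * ‖x‖ ^ 2 := by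
    intro x
    simp [inner_add_left, real_inner_smul_left]
  have hlow : ∀ x, ε * ‖x‖ ^ 2 ≤ ‖B x‖ ^ 2 := by
    intro x
    rw [norm_opSqrt_apply_sq hpos, hsq]
    linarith [hA.inner_nonneg_left x]
  -- B² is bounded below by ε as a quadratic form, hence invertible; an element whose square is a
  -- unit is a unit.
  have hu2 : IsUnit (B * B) := by
    change IsUnit (B ∘L B)
    rw [hBB]
    refine ContinuousLinearMap.isUnit_of_forall_le_norm_inner_map _ (c := ⟨ε, hε.le⟩) hε fun x => ?_
    rw [hsq, Real.norm_eq_abs]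
    refine le_trans ?_ (le_abs_self _)
    have := hA.inner_nonneg_left x
    change ‖x‖ ^ 2 * ε ≤ _
    linarith
  have hu : IsUnit B := by
    rw [← sq] at hu2
    exact (isUnit_pow_iff two_ne_zero).1 hu2
  have hKB : K * B = 1 := Ring.inverse_mul_cancel B hu
  have hBK : B * K = 1 := Ring.mul_inverse_cancel B hu
  refine ⟨hB, hBB, hKB, hBK, ?_, ?_⟩
  · have h1 : star K * B = 1 := by
      have := congrArg star hBK
      rwa [star_mul, star_one, hB.isSelfAdjoint.star_eq] at this
    calc star K = star K * (B * K) := by rw [hBK, mul_one]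
      _ = K := by rw [← mul_assoc, h1, one_mul]
  · refine ContinuousLinearMap.opNorm_le_bound _ (by positivity) fun x => ?_
    have h1 := hlow (K x)
    have h2 : B (K x) = x := by
      have := congrArg (fun T : H →L[ℝ] H => T x) hBK
      simpa using this
    rw [h2] at h1
    have h3 : √ε * ‖K x‖ ≤ ‖x‖ := by
      refine abs_le_of_sq_le_sq' ?_ (norm_nonneg _) |>.2
      rw [mul_pow, Real.sq_sqrt hε.le]; exact h1
    rw [inv_mul_eq_div, le_div_iff₀ (by positivity)]
    linarith

end OperatorTheory

/-! ### Hilbert–Schmidt estimates. -/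

section HilbertSchmidt

variable {H : Type*} [NormedAddCommGroup H] [InnerProductSpace ℝ H] [CompleteSpace H]

theorem hsSq_comp_le {ι : Type*} (b : HilbertBasis ι ℝ H) (A T : H →L[ℝ] H) :
    hsSq b (A ∘L T) ≤ ‖A‖ₑ ^ 2 * hsSq b T := by
  rw [hsSq, hsSq, ← ENNReal.tsum_mul_left]
  refine ENNReal.tsum_le_tsum fun i => ?_
  rw [← mul_pow]
  gcongr
  exact A.le_opENorm (T (b i))

theorem hsSq_comp_le' {ι : Type*} (b : HilbertBasis ι ℝ H) (T A : H →L[ℝ] H) :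
    hsSq b (T ∘L A) ≤ ‖A‖ₑ ^ 2 * hsSq b T := by
  rw [hsSq_adjoint b b, hsSq_adjoint b b T, ContinuousLinearMap.adjoint_comp]
  refine (hsSq_comp_le b _ _).trans_eq ?_
  congr 2
  rw [← ofReal_norm, ← ofReal_norm, LinearIsometryEquiv.norm_map]

theorem hsSq_add_le {ι : Type*} (b : HilbertBasis ι ℝ H) (S T : H →L[ℝ] H) :
    hsSq b (S + T) ≤ 2 * hsSq b S + 2 * hsSq b T := by
  rw [hsSq, hsSq, hsSq, ← ENNReal.tsum_mul_left, ← ENNReal.tsum_mul_left, ← ENNReal.tsum_add]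
  refine ENNReal.tsum_le_tsum fun i => ?_
  rw [enorm_sq_eq_ofReal, enorm_sq_eq_ofReal, enorm_sq_eq_ofReal]
  rw [← ENNReal.ofReal_ofNat, ← ENNReal.ofReal_mul (by positivity),
    ← ENNReal.ofReal_mul (by positivity), ← ENNReal.ofReal_add (by positivity) (by positivity)]
  apply ENNReal.ofReal_le_ofReal
  have h := norm_add_le (S (b i)) (T (b i))
  rw [add_apply]
  nlinarith [sq_nonneg (‖S (b i)‖ - ‖T (b i)‖), norm_nonneg (S (b i) + T (b i))]

/-- Parseval gives ‖T*x‖² = ∑ ⟨T bᵢ, x⟩², and Cauchy–Schwarz bounds it termwise. -/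
theorem enorm_sq_le_hsSq {ι : Type*} (b : HilbertBasis ι ℝ H) (T : H →L[ℝ] H) :
    ‖T‖ₑ ^ 2 ≤ hsSq b T := by
  by_cases htop : hsSq b T = ⊤
  · simp [htop]
  have hx : ∀ x, ‖ContinuousLinearMap.adjoint T x‖ₑ ^ 2 ≤ hsSq b T * ‖x‖ₑ ^ 2 := by
    intro x
    rw [enorm_sq_eq_tsum b, hsSq, ← ENNReal.tsum_mul_right]
    refine ENNReal.tsum_le_tsum fun i => ?_
    rw [ContinuousLinearMap.adjoint_inner_right, ← mul_pow]
    gcongr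
    rw [← ofReal_norm, ← ofReal_norm, ← ofReal_norm, ← ENNReal.ofReal_mul (norm_nonneg _)]
    exact ENNReal.ofReal_le_ofReal (norm_inner_le_norm _ _)
  set c := (hsSq b T).toReal with hc
  have hn : ‖T‖ ≤ √c := by
    rw [← LinearIsometryEquiv.norm_map ContinuousLinearMap.adjoint T]
    refine ContinuousLinearMap.opNorm_le_bound _ (Real.sqrt_nonneg _) fun x => ?_
    have h := hx x
    rw [← ENNReal.ofReal_toReal htop, enorm_sq_eq_ofReal, enorm_sq_eq_ofReal,
      ← ENNReal.ofReal_mul ENNReal.toReal_nonneg,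
      ENNReal.ofReal_le_ofReal_iff (by positivity)] at h
    refine abs_le_of_sq_le_sq' ?_ (by positivity) |>.2
    rw [mul_pow, Real.sq_sqrt ENNReal.toReal_nonneg]
    exact h
  rw [enorm_sq_eq_ofReal, ← ENNReal.ofReal_toReal htop]
  apply ENNReal.ofReal_le_ofReal
  rw [← Real.sq_sqrt (ENNReal.toReal_nonneg (a := hsSq b T))]
  gcongr

/-- The Hilbert-Schmidt norm of `∑ aᵢ ⊗ cᵢ` when `(aᵢ)` satisfies a Bessel-type bound. -/
theorem hsSq_sum_rankOne_le {ι : Type*} (b : HilbertBasis ι ℝ H) {J : Type*} (s : Finset J)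
    (a c : J → H) {w : ℝ} (hw : 0 ≤ w) (ha : ∀ x, ∑ i ∈ s, ⟪a i, x⟫ ^ 2 ≤ w * ‖x‖ ^ 2) :
    hsSq b (∑ i ∈ s, rankOne ℝ (a i) (c i)) ≤ ENNReal.ofReal (w * ∑ i ∈ s, ‖c i‖ ^ 2) := by
  -- Dual form of the Bessel bound: the synthesis map t ↦ ∑ tᵢ aᵢ has the norm of its adjoint, the
  -- analysis map. It is applied below with tⱼ = ⟨bᵢ, cⱼ⟩.
  have key : ∀ t : J → ℝ, ‖∑ i ∈ s, t i • a i‖ ^ 2 ≤ w * ∑ i ∈ s, t i ^ 2 := by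
    intro t
    set v := ∑ i ∈ s, t i • a i with hv
    have h1 : ‖v‖ ^ 2 = ∑ i ∈ s, t i * ⟪a i, v⟫ := by
      rw [← real_inner_self_eq_norm_sq]
      nth_rw 1 [hv]
      rw [sum_inner]
      exact Finset.sum_congr rfl fun i _ => real_inner_smul_left _ _ _
    have h2 := Finset.sum_mul_sq_le_sq_mul_sq s t (fun i => ⟪a i, v⟫)
    rw [← h1] at h2
    have h3 : (‖v‖ ^ 2) ^ 2 ≤ (w * ∑ i ∈ s, t i ^ 2) * ‖v‖ ^ 2 := by
      refine h2.trans ?_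
      have := mul_le_mul_of_nonneg_left (ha v) (Finset.sum_nonneg fun i (_ : i ∈ s) => sq_nonneg (t i))
      linarith
    by_cases h0 : ‖v‖ ^ 2 = 0
    · rw [h0]; exact mul_nonneg hw (Finset.sum_nonneg fun i _ => sq_nonneg _)
    · have hp : 0 < ‖v‖ ^ 2 := lt_of_le_of_ne (sq_nonneg _) (Ne.symm h0)
      rw [sq (‖v‖ ^ 2)] at h3
      exact le_of_mul_le_mul_right h3 hp
  have h1 : ∀ i, ‖(∑ j ∈ s, rankOne ℝ (a j) (c j)) (b i)‖ₑ ^ 2 ≤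
      ENNReal.ofReal w * ∑ j ∈ s, ‖⟪b i, c j⟫‖ₑ ^ 2 := by
    intro i
    have e : (∑ j ∈ s, rankOne ℝ (a j) (c j)) (b i) = ∑ j ∈ s, ⟪b i, c j⟫ • a j := by
      rw [sum_apply]
      exact Finset.sum_congr rfl fun j _ => by rw [rankOne_apply, real_inner_comm]
    rw [e, enorm_sq_eq_ofReal]
    refine (ENNReal.ofReal_le_ofReal (key _)).trans_eq ?_
    rw [ENNReal.ofReal_mul hw, ENNReal.ofReal_sum_of_nonneg (fun _ _ => sq_nonneg _)]
    congr 1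
    refine Finset.sum_congr rfl fun j _ => ?_
    rw [enorm_sq_eq_ofReal, Real.norm_eq_abs, sq_abs]
  rw [hsSq]
  refine (ENNReal.tsum_le_tsum h1).trans_eq ?_
  rw [ENNReal.tsum_mul_left, Summable.tsum_finsetSum (fun _ _ => ENNReal.summable),
    ENNReal.ofReal_mul hw, ENNReal.ofReal_sum_of_nonneg (fun _ _ => sq_nonneg _)]
  congr 1
  refine Finset.sum_congr rfl fun j _ => ?_
  rw [← enorm_sq_eq_tsum b, enorm_sq_eq_ofReal]

end HilbertSchmidt

/-! ### Convergence in probability as convergence along a filter. -/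

section InProbability

variable {Ω : Type*} [MeasurableSpace Ω]

/-- The filter of convergence in probability on `ℕ × Ω`: a set belongs to it if the probability of
the complements of its sections tends to `0`. -/
def inProb (P : Measure Ω) : Filter (ℕ × Ω) where
  sets := {U | Tendsto (fun n => P {ω | (n, ω) ∉ U}) atTop (𝓝 0)}
  univ_sets := by simp
  sets_of_superset := by
    intro U V hU hUV
    refine tendsto_of_tendsto_of_tendsto_of_le_of_le tendsto_const_nhds hU (fun _ => zero_le)
      fun n => measure_mono fun ω hω hU' => hω (hUV hU')
  inter_sets := by
    intro U V hU hV
    have h := hU.add hV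
    rw [add_zero] at h
    refine tendsto_of_tendsto_of_tendsto_of_le_of_le tendsto_const_nhds h (fun _ => zero_le)
      fun n => (measure_mono fun ω hω => ?_).trans (measure_union_le _ _)
    by_contra hc
    simp only [Set.mem_union, Set.mem_ofPred_eq, not_or, not_not] at hc
    exact hω hc

theorem eventually_inProb {P : Measure Ω} {p : ℕ × Ω → Prop} :
    (∀ᶠ q in inProb P, p q) ↔ Tendsto (fun n => P {ω | ¬ p (n, ω)}) atTop (𝓝 0) := Iff.rfl

theorem eventually_inProb_of_ae {P : Measure Ω} {p : ℕ × Ω → Prop}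
    (h : ∀ n, ∀ᵐ ω ∂P, p (n, ω)) : ∀ᶠ q in inProb P, p q := by
  rw [eventually_inProb]
  exact tendsto_const_nhds.congr fun n => (ae_iff.1 (h n)).symm

theorem tendsto_fst_inProb (P : Measure Ω) : Tendsto Prod.fst (inProb P) atTop := by
  intro U hU
  obtain ⟨N, hN⟩ := mem_atTop_sets.1 hU
  refine tendsto_const_nhds.congr' ?_
  filter_upwards [eventually_ge_atTop N] with n hn
  have : {ω : Ω | (n, ω) ∉ Prod.fst ⁻¹' U} = ∅ := by
    ext ω; simpa using hN n hn
  rw [this, measure_empty]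

/-- Properness allows deterministic facts about a limit, such as finiteness of its Hilbert–Schmidt
norm, to be read off from events of probability tending to 1. -/
instance inProb_neBot (P : Measure Ω) [IsProbabilityMeasure P] : (inProb P).NeBot := by
  refine ⟨fun h => ?_⟩
  have h0 : Tendsto (fun n => P {ω | (n, ω) ∉ (∅ : Set (ℕ × Ω))}) atTop (𝓝 0) :=
    empty_mem_iff_bot.2 h
  have h1 : (fun n : ℕ => P {ω | (n, ω) ∉ (∅ : Set (ℕ × Ω))}) = fun _ => 1 := by
    funext n
    simp
  rw [h1] at h0
  exact one_ne_zero (tendsto_nhds_unique tendsto_const_nhds h0)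

theorem tendstoZeroInProb_iff {P : Measure Ω} {Z : ℕ → Ω → ℝ≥0∞} :
    TendstoZeroInProb P Z ↔ Tendsto (fun q : ℕ × Ω => Z q.1 q.2) (inProb P) (𝓝 0) := by
  rw [ENNReal.nhds_zero]
  simp only [tendsto_iInf, tendsto_principal, eventually_inProb, Set.mem_Iio, not_lt]
  simp only [TendstoZeroInProb, pos_iff_ne_zero]

theorem tendstoInMeasure_iff_inProb {E : Type*} [PseudoEMetricSpace E] {P : Measure Ω}
    {Z : ℕ → Ω → E} {a : E} :
    TendstoInMeasure P Z atTop (fun _ => a) ↔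
      Tendsto (fun q : ℕ × Ω => Z q.1 q.2) (inProb P) (𝓝 a) := by
  rw [Metric.nhds_basis_eball.tendsto_right_iff]
  simp only [eventually_inProb, Metric.mem_eball, not_lt, TendstoInMeasure]

/-- Markov's inequality. -/
theorem tendsto_inProb_of_lintegral {P : Measure Ω} {Z : ℕ → Ω → ℝ≥0∞}
    (hZ : ∀ n, AEMeasurable (Z n) P) (h : Tendsto (fun n => ∫⁻ ω, Z n ω ∂P) atTop (𝓝 0)) :
    Tendsto (fun q : ℕ × Ω => Z q.1 q.2) (inProb P) (𝓝 0) := by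
  rw [← tendstoZeroInProb_iff]
  intro δ hδ
  -- Dividing by δ in Markov's inequality needs δ finite; for δ = ∞ the level 1 serves instead.
  by_cases htop : δ = ⊤
  · subst htop
    refine tendsto_of_tendsto_of_tendsto_of_le_of_le tendsto_const_nhds h (fun _ => zero_le) ?_
    intro n
    have := mul_meas_ge_le_lintegral₀ (hZ n) 1
    rw [one_mul] at this
    refine le_trans (measure_mono fun ω (hω : ⊤ ≤ Z n ω) => ?_) this
    exact le_top.trans hω
  have h2 := ENNReal.Tendsto.div_const h (Or.inr hδ.ne')
  rw [ENNReal.zero_div] at h2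
  refine tendsto_of_tendsto_of_tendsto_of_le_of_le tendsto_const_nhds h2 (fun _ => zero_le) ?_
  exact fun n => meas_ge_le_lintegral_div (hZ n) hδ.ne' htop

end InProbability

/-! ### Stability of the leading eigenvector of a compact positive operator. -/

section Perturbation

variable {H : Type*} [NormedAddCommGroup H] [InnerProductSpace ℝ H] [CompleteSpace H]

theorem isCompactOperator_rankOne (x y : H) : IsCompactOperator (rankOne ℝ x y) := by
  rw [rankOne_def']
  exact (isCompactOperator_of_locallyCompactSpace_rng
    (ContinuousLinearMap.toSpanSingleton ℝ x)).comp_clm (innerSL ℝ y)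

theorem isCompactOperator_sum {J : Type*} (s : Finset J) {T : J → H →L[ℝ] H}
    (h : ∀ j ∈ s, IsCompactOperator (T j)) : IsCompactOperator (∑ j ∈ s, T j : H →L[ℝ] H) := by
  classical
  induction s using Finset.induction_on with
  | empty => simpa using isCompactOperator_zero
  | insert a s ha ih =>
    rw [Finset.sum_insert ha]
    exact (h a (Finset.mem_insert_self a s)).add
      (ih fun j hj => h j (Finset.mem_insert_of_mem hj))

theorem IsLeading.norm_le {V : H →L[ℝ] H} (hV : V.IsPositive) {ψ : H} (h : IsLeading V ψ) :
    ‖V‖ ≤ ⟪ψ, V ψ⟫ := by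
  refine norm_le_of_abs_inner_le hV.isSelfAdjoint (hV.inner_nonneg_right ψ) fun x => ?_
  rw [abs_of_nonneg (hV.inner_nonneg_left x), real_inner_comm]
  exact inner_map_sub_nonneg h.2 x

/-- Almost maximizers of the quadratic form of a compact positive operator are close to the leading
eigenvector, when the latter is unique up to sign. -/
theorem tendsto_abs_inner_leading {ι : Type*} {l : Filter ι} {V : H →L[ℝ] H} (hV : V.IsPositive)
    (hVc : IsCompactOperator V) {ψ : H} (hψ : IsLeading V ψ)
    (huniq : ∀ g, IsLeading V g → g = ψ ∨ g = -ψ) {g : ι → H} (hg : ∀ᶠ i in l, ‖g i‖ = 1)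
    (hlim : Tendsto (fun i => ⟪g i, V (g i)⟫) l (𝓝 ⟪ψ, V ψ⟫)) :
    Tendsto (fun i => |⟪g i, ψ⟫|) l (𝓝 1) := by
  have habs : ∀ g, IsLeading V g → |⟪g, ψ⟫| = 1 := by
    intro g h
    rcases huniq g h with rfl | rfl
    · rw [real_inner_self_eq_norm_sq, hψ.1]; simp
    · rw [inner_neg_left, real_inner_self_eq_norm_sq, hψ.1]; simp
  set lam := ⟪ψ, V ψ⟫ with hlam
  have hnorm := hψ.norm_le hV
  rw [← hlam] at hnorm
  have hlam0 : 0 ≤ lam := hV.inner_nonneg_right ψ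
  -- If λ = 0 then V = 0 and every unit vector is leading, so uniqueness up to sign already forces
  -- |⟨g, ψ⟩| = 1.
  rcases hlam0.eq_or_lt with h0 | hpos
  · have hV0 : V = 0 := by
      rw [← norm_le_zero_iff, h0]; exact hnorm
    refine tendsto_const_nhds.congr' ?_
    filter_upwards [hg] with i hi
    refine (habs _ ⟨hi, fun x _ => ?_⟩).symm
    simp [hV0]
  -- Ultrafilters play the role of subsequences for an arbitrary filter: along each of them V(g)
  -- converges by compactness.
  rw [tendsto_iff_ultrafilter]
  intro u hu
  obtain ⟨C, hC, hsub⟩ := hVc.image_closedBall_subset_compact (f := (V : H →ₗ[ℝ] H)) 1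
  have hg' : ∀ᶠ i in (u : Filter ι), ‖g i‖ = 1 := hu hg
  obtain ⟨w, -, hw⟩ := hC.ultrafilter_le_nhds (u.map fun i => V (g i)) (by
    rw [le_principal_iff]
    change ∀ᶠ i in (u : Filter ι), V (g i) ∈ C
    filter_upwards [hg'] with i hi
    exact hsub ⟨g i, by simp [hi], rfl⟩)
  have hw' : Tendsto (fun i => V (g i)) u (𝓝 w) := hw
  -- Because ‖V‖ ≤ λ, ‖Vg − λg‖² ≤ 2λ² − 2λ⟨g, Vg⟩ → 0. So g itself converges, after division by λ >
  -- 0, and its limit is a maximizer.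
  have hdiff : Tendsto (fun i => V (g i) - lam • g i) u (𝓝 0) := by
    have h1 : Tendsto (fun i => √(2 * lam ^ 2 - 2 * lam * ⟪g i, V (g i)⟫)) u (𝓝 0) := by
      have := (((hlim.mono_left hu).const_mul (2 * lam)).const_sub (2 * lam ^ 2)).sqrt
      rwa [show 2 * lam ^ 2 - 2 * lam * lam = 0 by ring, Real.sqrt_zero] at this
    refine squeeze_zero_norm' ?_ h1
    filter_upwards [hg'] with i hi
    apply Real.le_sqrt_of_sq_le
    have h2 : ‖V (g i)‖ ≤ lam := by
      have := V.le_opNorm (g i)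
      rw [hi, mul_one] at this
      exact this.trans hnorm
    rw [norm_sub_sq_real, real_inner_smul_right, real_inner_comm, norm_smul, hi,
      Real.norm_of_nonneg hlam0]
    nlinarith [norm_nonneg (V (g i))]
  have hlg : Tendsto (fun i => lam • g i) u (𝓝 w) := by
    simpa using hw'.sub hdiff
  have hg0 : Tendsto g u (𝓝 (lam⁻¹ • w)) := by
    have := hlg.const_smul lam⁻¹
    simpa [smul_smul, inv_mul_cancel₀ hpos.ne'] using this
  set g0 := lam⁻¹ • w with hg0def
  have hg0n : ‖g0‖ = 1 :=
    tendsto_nhds_unique hg0.norm (tendsto_const_nhds.congr' (hg'.mono fun i hi => hi.symm))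
  have hval : ⟪g0, V g0⟫ = lam :=
    tendsto_nhds_unique (hg0.inner ((V.continuous.tendsto g0).comp hg0)) (hlim.mono_left hu)
  rw [← habs g0 ⟨hg0n, fun x hx => by rw [hval]; exact hψ.2 x hx⟩]
  exact (hg0.inner tendsto_const_nhds).abs

end Perturbation

/-! ### Limits of regularized operators along an arbitrary filter. -/

section RegularizedLimit

variable {H : Type*} [NormedAddCommGroup H] [InnerProductSpace ℝ H] [CompleteSpace H]
variable {ι : Type*} {l : Filter ι} {ε : ι → ℝ} {T S : H →L[ℝ] H} {That L N E : ι → H →L[ℝ] H}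

theorem tendsto_clm_apply {F : ι → H →L[ℝ] H} {g : ι → H} {x : H} (hF : Tendsto F l (𝓝 T))
    (hg : Tendsto g l (𝓝 x)) : Tendsto (fun i => F i (g i)) l (𝓝 (T x)) :=
  (isBoundedBilinearMap_apply.continuous.tendsto (T, x)).comp (hF.prodMk_nhds hg)

theorem tendsto_opSqrt_add (hε : ∀ i, 0 < ε i) (hε0 : Tendsto ε l (𝓝 0)) (hT : T.IsPositive)
    (hThat : ∀ i, (That i).IsPositive) (hlim : Tendsto That l (𝓝 T)) :
    Tendsto (fun i => opSqrt (That i + ε i • ContinuousLinearMap.id ℝ H)) l (𝓝 (opSqrt T)) := by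
  have hsum : Tendsto (fun i => That i + ε i • ContinuousLinearMap.id ℝ H) l (𝓝 T) := by
    have := hlim.add (hε0.smul_const (ContinuousLinearMap.id ℝ H))
    rwa [zero_smul, add_zero] at this
  rw [tendsto_iff_norm_sub_tendsto_zero] at hsum ⊢
  have hs := hsum.sqrt
  rw [Real.sqrt_zero] at hs
  refine squeeze_zero (fun _ => norm_nonneg _) (fun i => ?_) hs
  obtain ⟨h1, h2, -⟩ := inverse_opSqrt_add (hThat i) (hε i)
  apply Real.le_sqrt_of_sq_le
  have := norm_sub_sq_le h1 (opSqrt_spec hT).1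
  rwa [h2, (opSqrt_spec hT).2] at this

/-- The setting of the consistency proof: `That` is a consistent estimator of `T`, and `L` equals
`That ∘ S` up to a term `N` that is `o(ε)` and a term `E` that is small after multiplication with
the inverse square root of `That + ε I`. -/
structure RegularizedApprox (l : Filter ι) (ε : ι → ℝ) (T S : H →L[ℝ] H)
    (That L N E : ι → H →L[ℝ] H) : Prop where
  pos : ∀ i, 0 < ε i
  tendsto_zero : Tendsto ε l (𝓝 0)
  isPositive : T.IsPositive
  isPositive_hat : ∀ i, (That i).IsPositive
  tendsto_hat : Tendsto That l (𝓝 T)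
  eq : ∀ᶠ i in l, L i = That i ∘L S + N i + E i
  noise : Tendsto (fun i => (ε i)⁻¹ * ‖N i‖) l (𝓝 0)
  error : Tendsto (fun i => (√(ε i))⁻¹ *
    ‖Ring.inverse (opSqrt (That i + ε i • ContinuousLinearMap.id ℝ H)) ∘L E i‖) l (𝓝 0)
  hs_bound : ∃ C : ℝ≥0∞, C ≠ ⊤ ∧ ∀ᶠ i in l,
    hsSq (someBasis H) (Ring.inverse (opSqrt (That i + ε i • ContinuousLinearMap.id ℝ H)) ∘L L i) ≤ C

namespace RegularizedApprox

/-- `(That + ε I)^{-1/2}`. -/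
def K (ε : ι → ℝ) (That : ι → H →L[ℝ] H) (i : ι) : H →L[ℝ] H :=
  Ring.inverse (opSqrt (That i + ε i • ContinuousLinearMap.id ℝ H))

variable (h : RegularizedApprox l ε T S That L N E)
include h

theorem tendsto_sqrt_eps : Tendsto (fun i => √(ε i)) l (𝓝 0) := by
  simpa using h.tendsto_zero.sqrt

theorem tendsto_sqrt :
    Tendsto (fun i => opSqrt (That i + ε i • ContinuousLinearMap.id ℝ H)) l (𝓝 (opSqrt T)) :=
  tendsto_opSqrt_add h.pos h.tendsto_zero h.isPositive h.isPositive_hat h.tendsto_hat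

theorem norm_K_le (i : ι) : ‖K ε That i‖ ≤ (√(ε i))⁻¹ :=
  (inverse_opSqrt_add (h.isPositive_hat i) (h.pos i)).2.2.2.2.2

/-- From That = B² − ε and KB = 1. -/
theorem K_mul_hat (i : ι) : K ε That i * That i =
    opSqrt (That i + ε i • ContinuousLinearMap.id ℝ H) - ε i • K ε That i := by
  obtain ⟨-, h2, h3, -⟩ := inverse_opSqrt_add (h.isPositive_hat i) (h.pos i)
  set B := opSqrt (That i + ε i • ContinuousLinearMap.id ℝ H)
  have h3' : K ε That i * B = 1 := h3
  have h2' : That i = B * B - ε i • (1 : H →L[ℝ] H) := by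
    change _ = B ∘L B - ε i • ContinuousLinearMap.id ℝ H
    rw [h2, add_sub_cancel_right]
  rw [h2', mul_sub, ← mul_assoc, h3', one_mul, mul_smul_comm, mul_one]

theorem norm_smul_K_le (i : ι) : ‖ε i • K ε That i‖ ≤ √(ε i) := by
  rw [norm_smul, Real.norm_of_nonneg (h.pos i).le]
  have := mul_le_mul_of_nonneg_left (h.norm_K_le i) (h.pos i).le
  refine this.trans_eq ?_
  rw [← div_eq_mul_inv, Real.div_sqrt]

theorem tendsto_smul_K : Tendsto (fun i => ε i • K ε That i) l (𝓝 0) :=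
  squeeze_zero_norm h.norm_smul_K_le h.tendsto_sqrt_eps

theorem tendsto_K_mul_hat : Tendsto (fun i => K ε That i * That i) l (𝓝 (opSqrt T)) := by
  simp_rw [h.K_mul_hat]
  simpa using h.tendsto_sqrt.sub h.tendsto_smul_K

/-- One factor K costs ε^{-1/2}, half of what the hypothesis on N allows. -/
theorem tendsto_K_mul_noise : Tendsto (fun i => K ε That i * N i) l (𝓝 0) := by
  have h1 := h.tendsto_sqrt_eps.mul h.noise
  rw [zero_mul] at h1
  refine squeeze_zero_norm (fun i => ?_) h1
  refine (norm_mul_le _ _).trans ?_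
  have h2 : √(ε i) * ((ε i)⁻¹ * ‖N i‖) = (√(ε i))⁻¹ * ‖N i‖ := by
    have h3 : √(ε i) ≠ 0 := (Real.sqrt_pos.2 (h.pos i)).ne'
    nth_rw 2 [← Real.mul_self_sqrt (h.pos i).le]
    field_simp
  rw [h2]
  gcongr
  exact h.norm_K_le i

theorem tendsto_K_mul_error : Tendsto (fun i => K ε That i * E i) l (𝓝 0) := by
  have h1 := h.tendsto_sqrt_eps.mul h.error
  rw [zero_mul] at h1
  refine squeeze_zero_norm (fun i => ?_) h1
  have h3 : √(ε i) ≠ 0 := (Real.sqrt_pos.2 (h.pos i)).ne'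
  rw [mul_inv_cancel_left₀ h3]
  exact le_rfl

/-- The estimator `(That + ε I)^{-1/2} L` converges to `T^{1/2} S`. -/
theorem tendsto_K_mul : Tendsto (fun i => K ε That i * L i) l (𝓝 (opSqrt T * S)) := by
  have h1 := ((h.tendsto_K_mul_hat.mul_const S).add h.tendsto_K_mul_noise).add h.tendsto_K_mul_error
  rw [add_zero, add_zero] at h1
  refine h1.congr' ?_
  filter_upwards [h.eq] with i hi
  rw [hi, mul_add, mul_add, ← ContinuousLinearMap.mul_def, mul_assoc]

/-- Lower semicontinuity: every finite partial sum passes to the operator-norm limit under the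
uniform bound. -/
theorem hsSq_limit_ne_top [l.NeBot] : hsSq (someBasis H) (opSqrt T * S) ≠ ⊤ := by
  obtain ⟨C, hC, hb⟩ := h.hs_bound
  refine ne_top_of_le_ne_top hC ?_
  rw [hsSq]
  refine ENNReal.summable.tsum_le_of_sum_le fun s => ?_
  refine le_of_tendsto (f := fun i => ∑ j ∈ s, ‖(K ε That i * L i) (someBasis H j)‖ₑ ^ 2)
    (x := l) ?_ ?_
  · refine tendsto_finsetSum _ fun j _ => ?_
    have := (tendsto_clm_apply h.tendsto_K_mul
      (tendsto_const_nhds (x := someBasis H j))).enorm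
    exact (ENNReal.continuous_pow 2).tendsto _ |>.comp this
  · filter_upwards [hb] with i hi
    exact (ENNReal.sum_le_tsum s).trans hi

/-- The estimator of the target operator. -/
theorem tendsto_hsSq [l.NeBot] :
    Tendsto (fun i => hsSq (someBasis H)
      (K ε That i * L i * star (K ε That i * L i) - opSqrt T * S * star (opSqrt T * S)))
      l (𝓝 0) := by
  obtain ⟨C, hC, hb⟩ := h.hs_bound
  set A := opSqrt T * S
  have hA : hsSq (someBasis H) A ≠ ⊤ := h.hsSq_limit_ne_top
  have h1 : Tendsto (fun i => ‖K ε That i * L i - A‖ₑ ^ 2) l (𝓝 0) := by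
    have h2 := ENNReal.tendsto_ofReal ((tendsto_iff_norm_sub_tendsto_zero.1 h.tendsto_K_mul).pow 2)
    simp only [ne_eq, OfNat.ofNat_ne_zero, not_false_eq_true, zero_pow, ENNReal.ofReal_zero] at h2
    simpa only [enorm_sq_eq_ofReal] using h2
  have h3 : Tendsto (fun i => 2 * (‖K ε That i * L i - A‖ₑ ^ 2 * C) +
      2 * (‖K ε That i * L i - A‖ₑ ^ 2 * hsSq (someBasis H) A)) l (𝓝 0) := by
    have e1 := ENNReal.Tendsto.const_mul (ENNReal.Tendsto.mul_const h1 (Or.inr hC))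
      (Or.inr (ENNReal.ofNat_ne_top (n := 2)))
    have e2 := ENNReal.Tendsto.const_mul (ENNReal.Tendsto.mul_const h1 (Or.inr hA))
      (Or.inr (ENNReal.ofNat_ne_top (n := 2)))
    simpa using e1.add e2
  refine tendsto_of_tendsto_of_tendsto_of_le_of_le' tendsto_const_nhds h3
    (Eventually.of_forall fun _ => zero_le) ?_
  filter_upwards [hb] with i hi
  set D := K ε That i * L i
  -- Each product pairs a factor small in operator norm with one bounded in Hilbert–Schmidt norm.
  have e : D * star D - A * star A = D * star (D - A) + (D - A) * star A := by
    rw [star_sub]; noncomm_ring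
  have hstar : ∀ X : H →L[ℝ] H, hsSq (someBasis H) (star X) = hsSq (someBasis H) X := fun X => by
    rw [hsSq_adjoint (someBasis H) (someBasis H) X]; rfl
  have hn : ‖star (D - A)‖ₑ = ‖D - A‖ₑ := by
    rw [← ofReal_norm, ← ofReal_norm]
    exact congrArg ENNReal.ofReal (ContinuousLinearMap.adjoint.norm_map (D - A))
  rw [e]
  refine (hsSq_add_le _ _ _).trans (add_le_add ?_ ?_)
  · gcongr
    refine (hsSq_comp_le' _ _ _).trans ?_
    rw [hn]
    gcongr
    exact hi
  · gcongr
    refine (hsSq_comp_le _ _ _).trans ?_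
    rw [hstar]

theorem tendsto_mul_star : Tendsto (fun i => K ε That i * L i * star (K ε That i * L i)) l
    (𝓝 (opSqrt T * S * star (opSqrt T * S))) :=
  h.tendsto_K_mul.mul ((continuous_star.tendsto _).comp h.tendsto_K_mul)

/-- The operator εK² is only bounded by 1. Writing T^{1/2} = (T^{1/2} − B) + B, the first part is
small by continuity of the root, and BK = 1 reduces the second to εK, of norm at most √ε. -/
theorem tendsto_bias : Tendsto (fun i => ε i • (opSqrt T * K ε That i * K ε That i)) l (𝓝 0) := by
  have h1 : Tendsto (fun i => ‖opSqrt T - opSqrt (That i + ε i • ContinuousLinearMap.id ℝ H)‖ +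
      √(ε i)) l (𝓝 0) := by
    have h2 := tendsto_iff_norm_sub_tendsto_zero.1 h.tendsto_sqrt
    simp_rw [norm_sub_rev _ (opSqrt T)] at h2
    simpa using h2.add h.tendsto_sqrt_eps
  refine squeeze_zero_norm (fun i => ?_) h1
  obtain ⟨-, -, -, h4, -, -⟩ := inverse_opSqrt_add (h.isPositive_hat i) (h.pos i)
  set B := opSqrt (That i + ε i • ContinuousLinearMap.id ℝ H)
  have h4' : B * K ε That i = 1 := h4
  have e : ε i • (opSqrt T * K ε That i * K ε That i) =
      (opSqrt T - B) * (ε i • (K ε That i * K ε That i)) + ε i • K ε That i := by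
    rw [sub_mul, mul_smul_comm, mul_smul_comm, ← mul_assoc, ← mul_assoc, h4', one_mul,
      sub_add_cancel]
  rw [e]
  refine (norm_add_le _ _).trans (add_le_add ?_ (h.norm_smul_K_le i))
  refine (norm_mul_le _ _).trans (mul_le_of_le_one_right (norm_nonneg _) ?_)
  rw [norm_smul, Real.norm_of_nonneg (h.pos i).le]
  have h5 : ‖K ε That i * K ε That i‖ ≤ (√(ε i))⁻¹ * (√(ε i))⁻¹ :=
    (norm_mul_le _ _).trans (mul_le_mul (h.norm_K_le i) (h.norm_K_le i) (norm_nonneg _)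
      (by positivity))
  rw [← mul_inv, Real.mul_self_sqrt (h.pos i).le] at h5
  rw [← mul_inv_cancel₀ (h.pos i).ne']
  exact mul_le_mul_of_nonneg_left h5 (h.pos i).le

/-- Two factors K cost ε⁻¹; this is where the noise must be o(ε). -/
theorem tendsto_K_mul_K_mul_noise : Tendsto (fun i => K ε That i * (K ε That i * N i)) l (𝓝 0) := by
  refine squeeze_zero_norm (fun i => ?_) h.noise
  refine (norm_mul_le _ _).trans ?_
  have h1 := h.norm_K_le i
  have h2 : (ε i)⁻¹ * ‖N i‖ = (√(ε i))⁻¹ * ((√(ε i))⁻¹ * ‖N i‖) := by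
    rw [← mul_assoc, ← mul_inv, Real.mul_self_sqrt (h.pos i).le]
  rw [h2]
  gcongr
  refine (norm_mul_le _ _).trans ?_
  gcongr

theorem tendsto_K_mul_K_mul_error : Tendsto (fun i => K ε That i * (K ε That i * E i)) l (𝓝 0) := by
  refine squeeze_zero_norm (fun i => ?_) h.error
  refine (norm_mul_le _ _).trans ?_
  gcongr
  · exact h.norm_K_le i
  · exact le_rfl

/-- The regularization gives K²That = 1 − εK², and the bias εK² disappears only after multiplication
by T^{1/2}. -/
theorem tendsto_sqrt_mul_K_mul_K_mul :
    Tendsto (fun i => opSqrt T * (K ε That i * (K ε That i * L i))) l (𝓝 (opSqrt T * S)) := by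
  have h1 := (h.tendsto_bias.mul_const S).const_sub (opSqrt T * S)
  have h2 := ((h.tendsto_K_mul_K_mul_noise.const_mul (opSqrt T)).add
    (h.tendsto_K_mul_K_mul_error.const_mul (opSqrt T)))
  have h3 := h1.add h2
  simp only [zero_mul, mul_zero, sub_zero, add_zero] at h3
  refine h3.congr' ?_
  filter_upwards [h.eq] with i hi
  obtain ⟨-, h5, h6, -⟩ := inverse_opSqrt_add (h.isPositive_hat i) (h.pos i)
  have h6' : K ε That i * opSqrt (That i + ε i • ContinuousLinearMap.id ℝ H) = 1 := h6
  have e1 : K ε That i * (K ε That i * That i) = 1 - ε i • (K ε That i * K ε That i) := by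
    rw [h.K_mul_hat, mul_sub, h6', mul_smul_comm]
  have e2 : K ε That i * (K ε That i * L i) = K ε That i * (K ε That i * That i) * S +
      K ε That i * (K ε That i * N i) + K ε That i * (K ε That i * E i) := by
    rw [hi, ← ContinuousLinearMap.mul_def]; noncomm_ring
  rw [e2, e1]
  simp only [mul_add, mul_sub, sub_mul, one_mul, smul_mul_assoc, mul_smul_comm, mul_assoc]
  abel

/-- Consistency of the leading eigenvector. -/
theorem tendsto_abs_inner [l.NeBot] {ψ : H} (hL : ∀ i, IsCompactOperator (L i))
    (hψ : IsLeading (opSqrt T * S * star (opSqrt T * S)) ψ)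
    (huniq : ∀ g, IsLeading (opSqrt T * S * star (opSqrt T * S)) g → g = ψ ∨ g = -ψ) {g : ι → H}
    (hg : ∀ᶠ i in l, IsLeading (K ε That i * L i * star (K ε That i * L i)) (g i)) :
    Tendsto (fun i => |⟪g i, ψ⟫|) l (𝓝 1) := by
  set V := opSqrt T * S * star (opSqrt T * S)
  have hVpos : V.IsPositive := ContinuousLinearMap.isPositive_self_comp_adjoint _
  have hVc : IsCompactOperator V := by
    refine isCompactOperator_of_tendsto h.tendsto_mul_star (Eventually.of_forall fun i => ?_)
    have h1 := ((hL i).clm_comp (K ε That i)).comp_clm (star (K ε That i * L i))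
    exact h1
  refine tendsto_abs_inner_leading hVpos hVc hψ huniq (hg.mono fun i hi => hi.1) ?_
  have h1 := tendsto_iff_norm_sub_tendsto_zero.1 h.tendsto_mul_star
  -- The factor 2 comes from exchanging V and its estimator twice, once at g and once at ψ.
  have h2 : Tendsto (fun i => ⟪ψ, V ψ⟫ -
      2 * ‖K ε That i * L i * star (K ε That i * L i) - V‖) l (𝓝 ⟪ψ, V ψ⟫) := by
    have := (h1.const_mul 2).const_sub ⟪ψ, V ψ⟫
    rwa [mul_zero, sub_zero] at this
  refine tendsto_of_tendsto_of_tendsto_of_le_of_le' h2 tendsto_const_nhds ?_ ?_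
  · filter_upwards [hg] with i hi
    set W := K ε That i * L i * star (K ε That i * L i)
    have hb : ∀ x : H, ‖x‖ = 1 → |⟪x, (W - V) x⟫| ≤ ‖W - V‖ := by
      intro x hx
      refine (abs_real_inner_le_norm _ _).trans ?_
      simpa [hx] using (W - V).le_opNorm x
    have e1 := abs_le.1 (hb _ hi.1)
    have e2 := abs_le.1 (hb _ hψ.1)
    have e3 := hi.2 ψ hψ.1
    simp only [sub_apply, inner_sub_right] at e1 e2
    linarith [e1.2, e2.1]
  · filter_upwards [hg] with i hi
    exact hψ.2 _ hi.1

-- With the sign adjusted, ‖±g − ψ‖² = 2 − 2|⟨g, ψ⟩|.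
omit h in
theorem tendsto_sign_smul {ψ : H} (hψ : ‖ψ‖ = 1) {g : ι → H} (hg : ∀ᶠ i in l, ‖g i‖ = 1)
    (hlim : Tendsto (fun i => |⟪g i, ψ⟫|) l (𝓝 1)) :
    Tendsto (fun i => (if 0 ≤ ⟪g i, ψ⟫ then (1 : ℝ) else -1) • g i) l (𝓝 ψ) := by
  rw [tendsto_iff_norm_sub_tendsto_zero]
  have h1 : Tendsto (fun i => √(2 - 2 * |⟪g i, ψ⟫|)) l (𝓝 0) := by
    have := ((hlim.const_mul 2).const_sub 2).sqrt
    simpa using this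
  refine h1.congr' ?_
  filter_upwards [hg] with i hi
  rw [Real.sqrt_eq_iff_eq_sq (by
    have := abs_real_inner_le_norm (g i) ψ
    rw [hi, hψ] at this
    linarith) (norm_nonneg _), norm_sub_sq_real, norm_smul, real_inner_smul_left, hi, hψ]
  split_ifs with h0
  · rw [abs_of_nonneg h0]; norm_num; ring
  · rw [abs_of_neg (not_le.1 h0)]; norm_num; ring

/-- Consistency of the leading regularized regression function. -/
theorem tendsto_sqrt_K [l.NeBot] {ψ : H} (hL : ∀ i, IsCompactOperator (L i))
    (hψ : IsLeading (opSqrt T * S * star (opSqrt T * S)) ψ)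
    (huniq : ∀ g, IsLeading (opSqrt T * S * star (opSqrt T * S)) g → g = ψ ∨ g = -ψ)
    (hran : ψ ∈ LinearMap.range (T : H →ₗ[ℝ] H)) {g : ι → H}
    (hg : ∀ᶠ i in l, IsLeading (K ε That i * L i * star (K ε That i * L i)) (g i)) :
    Tendsto (fun i => opSqrt T (K ε That i ((if 0 ≤ ⟪g i, ψ⟫ then (1 : ℝ) else -1) • g i))) l
      (𝓝 ψ) := by
  have hconv := tendsto_sign_smul hψ.1 (hg.mono fun i hi => hi.1)
    (h.tendsto_abs_inner hL hψ huniq hg)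
  set gs : ι → H := fun i => (if 0 ≤ ⟪g i, ψ⟫ then (1 : ℝ) else -1) • g i with hgs
  set R := opSqrt T with hR
  set V := R * S * star (R * S) with hV
  have hVpos : V.IsPositive := ContinuousLinearMap.isPositive_self_comp_adjoint _
  set lam := ⟪ψ, V ψ⟫ with hlam
  have hlam0 : 0 ≤ lam := hVpos.inner_nonneg_right ψ
  -- The main argument divides by λ. If λ = 0, then V = 0, uniqueness makes H the line spanned by ψ,
  -- and ψ ∈ ran T keeps T^{1/2} from vanishing on it; regularization is then harmless.
  rcases hlam0.eq_or_lt with h0 | hpos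
  · have hV0 : V = 0 := by
      rw [← norm_le_zero_iff, h0]; exact hψ.norm_le hVpos
    have hone : ∀ x : H, x = ⟪x, ψ⟫ • ψ := by
      intro x
      by_cases hx : x = 0
      · simp [hx]
      have hxn : ‖x‖ ≠ 0 := norm_ne_zero_iff.2 hx
      have hx1 : x = ‖x‖ • ((‖x‖⁻¹ : ℝ) • x) := by rw [smul_smul, mul_inv_cancel₀ hxn, one_smul]
      have hψψ : ⟪ψ, ψ⟫ = 1 := by rw [real_inner_self_eq_norm_sq, hψ.1]; norm_num
      rcases huniq ((‖x‖⁻¹ : ℝ) • x) ⟨by simp [norm_smul, hxn], by simp [hV0]⟩ with h1 | h1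
      · rw [h1] at hx1
        rw [hx1, real_inner_smul_left, hψψ, mul_one]
      · rw [h1] at hx1
        rw [hx1, real_inner_smul_left, inner_neg_left, hψψ, smul_neg, mul_neg, mul_one, neg_smul]
    set s := ‖R ψ‖ with hs
    have hs0 : 0 < s := by
      rw [hs, norm_pos_iff]
      intro hRψ
      obtain ⟨u, hu⟩ := hran
      have h2 : T u = R (R u) := by rw [← (opSqrt_spec h.isPositive).2]; rfl
      have hu' : T u = ψ := hu
      rw [h2, hone u, map_smul, hRψ, smul_zero, map_zero] at hu'
      have := hψ.1
      rw [← hu', norm_zero] at this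
      exact zero_ne_one this
    have hRn : ∀ x, ‖R x‖ = s * ‖x‖ := by
      intro x
      have h1 : ‖x‖ = |⟪x, ψ⟫| := by
        nth_rw 1 [hone x]; rw [norm_smul, hψ.1, mul_one, Real.norm_eq_abs]
      rw [h1]
      nth_rw 1 [hone x]
      rw [map_smul, norm_smul, Real.norm_eq_abs, mul_comm]
    have hev : ∀ᶠ i in l, ‖opSqrt (That i + ε i • ContinuousLinearMap.id ℝ H) - R‖ < s / 2 :=
      (tendsto_iff_norm_sub_tendsto_zero.1 h.tendsto_sqrt).eventually_lt_const (by positivity)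
    -- For z = K gs one has Rz − gs = (R − B)z. On the line ‖Rz‖ = s‖z‖, and B is within s/2 of R,
    -- whence the bound 2/s for ‖z‖/‖gs‖.
    have hlimK : Tendsto (fun i => R (K ε That i (gs i)) - gs i) l (𝓝 0) := by
      have h1 : Tendsto (fun i => ‖opSqrt (That i + ε i • ContinuousLinearMap.id ℝ H) - R‖ *
          (2 / s * ‖gs i‖)) l (𝓝 0) := by
        have := (tendsto_iff_norm_sub_tendsto_zero.1 h.tendsto_sqrt).mul
          (hconv.norm.const_mul (2 / s))
        rwa [zero_mul] at this
      refine squeeze_zero_norm' ?_ h1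
      filter_upwards [hev] with i hi
      obtain ⟨-, -, -, h4, -, -⟩ := inverse_opSqrt_add (h.isPositive_hat i) (h.pos i)
      set B := opSqrt (That i + ε i • ContinuousLinearMap.id ℝ H)
      have h4' : B (K ε That i (gs i)) = gs i := congrArg (fun X : H →L[ℝ] H => X (gs i)) h4
      set z := K ε That i (gs i)
      have hz : ‖R z - gs i‖ ≤ ‖B - R‖ * ‖z‖ := by
        rw [← h4', ← norm_neg, neg_sub]
        exact (B - R).le_opNorm z
      have hz2 : ‖z‖ ≤ 2 / s * ‖gs i‖ := by
        have h5 : s * ‖z‖ ≤ ‖gs i‖ + s / 2 * ‖z‖ := by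
          rw [← hRn]
          have h6 := norm_sub_norm_le (R z) (gs i)
          have h7 : ‖B - R‖ * ‖z‖ ≤ s / 2 * ‖z‖ := by gcongr
          linarith
        rw [div_mul_eq_mul_div, le_div_iff₀ hs0]
        linarith
      exact hz.trans (by gcongr)
    have := hlimK.add hconv
    simp only [sub_add_cancel, zero_add] at this
    exact this
  · have hlamhat : Tendsto (fun i => ⟪gs i, (K ε That i * L i * star (K ε That i * L i)) (gs i)⟫)
        l (𝓝 lam) := hconv.inner (tendsto_clm_apply h.tendsto_mul_star hconv)
    have hVψ : V ψ = lam • ψ := hψ.map_eq hVpos.isSelfAdjoint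
    -- Through the eigenvalue equation the extra factor K acts on KL, where it is controlled,
    -- instead of on the estimated eigenvector.
    have h1 : Tendsto (fun i => (R * (K ε That i * (K ε That i * L i)))
        (star (K ε That i * L i) (gs i))) l (𝓝 (lam • ψ)) := by
      rw [← hVψ, show V ψ = (R * S) (star (R * S) ψ) from rfl]
      exact tendsto_clm_apply h.tendsto_sqrt_mul_K_mul_K_mul
        (tendsto_clm_apply ((continuous_star.tendsto _).comp h.tendsto_K_mul) hconv)
    have h2 := (hlamhat.inv₀ hpos.ne').smul h1
    rw [smul_smul, inv_mul_cancel₀ hpos.ne', one_smul] at h2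
    refine h2.congr' ?_
    filter_upwards [hg, hlamhat.eventually_const_lt hpos] with i hi hposi
    set W := K ε That i * L i * star (K ε That i * L i) with hW
    have hWpos : W.IsPositive := ContinuousLinearMap.isPositive_self_comp_adjoint _
    set c : ℝ := if 0 ≤ ⟪g i, ψ⟫ then (1 : ℝ) else -1 with hc
    have hcc : c * c = 1 := by rw [hc]; split_ifs <;> norm_num
    have hgsi : gs i = c • g i := rfl
    clear_value c
    have hWg : W (gs i) = ⟪gs i, W (gs i)⟫ • gs i := by
      have := hi.map_eq hWpos.isSelfAdjoint
      rw [hgsi, map_smul, real_inner_smul_left, real_inner_smul_right, ← mul_assoc, hcc, one_mul,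
        smul_comm _ c, ← this]
    have e : (R * (K ε That i * (K ε That i * L i))) (star (K ε That i * L i) (gs i)) =
        R (K ε That i (W (gs i))) := rfl
    have e2 : R (K ε That i (W (gs i))) = ⟪gs i, W (gs i)⟫ • R (K ε That i (gs i)) := by
      rw [← map_smul, ← map_smul, ← hWg]
    rw [e, e2, smul_smul, inv_mul_cancel₀ hposi.ne', one_smul, hgsi]

end RegularizedApprox

end RegularizedLimit

/-! ### Conditional independence and conditional expectations. -/

section ConditionalExpectation

variable {Ω : Type*} {m m₀ : MeasurableSpace Ω} {μ : Measure Ω}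

/-- The conditional expectation of r vanishes, and w can be pulled out of it. Applied below with m
generated by Y and with m generated by X. -/
theorem integral_mul_eq_zero_of_setIntegral_eq_zero [IsFiniteMeasure μ] (hm : m ≤ m₀) {w r : Ω → ℝ}
    (hr : Integrable r μ) (h : ∀ s, MeasurableSet[m] s → ∫ x in s, r x ∂μ = 0)
    (hw : StronglyMeasurable[m] w) (hwr : Integrable (w * r) μ) : ∫ x, w x * r x ∂μ = 0 := by
  have h0 : (fun _ => (0 : ℝ)) =ᵐ[μ] μ[r | m] :=
    ae_eq_condExp_of_forall_setIntegral_eq hm hr (fun _ _ _ => integrableOn_zero)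
      (fun s hs _ => by rw [h s hs]; simp) aestronglyMeasurable_zero
  have h1 := condExp_mul_of_stronglyMeasurable_left hw hwr hr
  have h2 : ∫ x, (μ[w * r | m]) x ∂μ = ∫ x, (w * r) x ∂μ := integral_condExp hm
  rw [show ∫ x, w x * r x ∂μ = ∫ x, (w * r) x ∂μ from rfl, ← h2, integral_congr_ae h1]
  refine integral_eq_zero_of_ae ?_
  filter_upwards [h0] with x hx
  simp [← hx]

/-- Only the projection of a onto m matters; used on both sides, this makes conditional expectation
self-adjoint. -/
theorem integral_mul_condExp [IsFiniteMeasure μ] (hm : m ≤ m₀) {a b : Ω → ℝ}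
    (ha : Integrable a μ) (hab : Integrable (a * μ[b | m]) μ) :
    ∫ x, a x * (μ[b | m]) x ∂μ = ∫ x, (μ[a | m]) x * (μ[b | m]) x ∂μ := by
  have h1 := condExp_mul_of_stronglyMeasurable_right (m := m) stronglyMeasurable_condExp hab ha
  have h2 : ∫ x, (μ[a * μ[b | m] | m]) x ∂μ = ∫ x, (a * μ[b | m]) x ∂μ := integral_condExp hm
  rw [show ∫ x, a x * (μ[b | m]) x ∂μ = ∫ x, (a * μ[b | m]) x ∂μ from rfl, ← h2,
    integral_congr_ae h1]
  rfl

/-- Integrated form of E{g(Y) | X} = E{g(Y) | φ}. -/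
theorem CondIndepGiven.setIntegral_eq {E 𝓨 : Type*} [mE : MeasurableSpace E]
    [mY : MeasurableSpace 𝓨] {ν : Measure (E × 𝓨)} [IsProbabilityMeasure ν]
    {F : Type*} [mF : MeasurableSpace F] {φ : E × 𝓨 → F} (hφ : Measurable φ)
    (h : CondIndepGiven ν (mF.comap φ) Prod.snd Prod.fst) {g : 𝓨 → ℝ} (hg : StronglyMeasurable g) {C : ℝ}
    (hC : ∀ y, |g y| ≤ C) {B : Set E} (hB : MeasurableSet B) :
    ∫ z in Prod.fst ⁻¹' B, g z.2 ∂ν =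
      ∫ z in Prod.fst ⁻¹' B, (ν[fun z => g z.2 | mF.comap φ]) z ∂ν := by
  classical
  have hBm : MeasurableSet (Prod.fst ⁻¹' B : Set (E × 𝓨)) := measurable_fst hB
  set b : E × 𝓨 → ℝ := (Prod.fst ⁻¹' B).indicator fun _ => (1 : ℝ) with hb
  set G : E × 𝓨 → ℝ := fun z => g z.2 with hG
  have hGm : AEStronglyMeasurable G ν := (hg.comp_measurable measurable_snd).aestronglyMeasurable
  have hGi : Integrable G ν := Integrable.of_bound hGm C (Eventually.of_forall fun z => hC z.2)
  have hbi : Integrable b ν := (integrable_const 1).indicator hBm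
  have hb1 : ∀ z, |b z| ≤ (1 : NNReal) := fun z => by
    rw [hb, Set.indicator_apply]; split_ifs <;> simp
  have hEb : ∀ᵐ z ∂ν, |(ν[b | mF.comap φ]) z| ≤ (1 : NNReal) :=
    ae_bdd_abs_condExp_of_ae_bdd_abs (Eventually.of_forall hb1)
  have hmul : ∀ {u : E × 𝓨 → ℝ}, Integrable u ν → Integrable (b * u) ν := fun hu =>
    hu.bdd_mul hbi.aestronglyMeasurable (Eventually.of_forall hb1)
  have hmul' : ∀ {u : E × 𝓨 → ℝ}, Integrable u ν → Integrable (u * ν[b | mF.comap φ]) ν := fun hu =>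
    hu.mul_bdd integrable_condExp.aestronglyMeasurable hEb
  have hset : ∀ u : E × 𝓨 → ℝ, ∫ z in Prod.fst ⁻¹' B, u z ∂ν = ∫ z, b z * u z ∂ν := by
    intro u
    rw [← integral_indicator hBm]
    congr 1
    funext z
    rw [hb, Set.indicator_apply, Set.indicator_apply]
    split_ifs <;> simp
  -- On the events {Y ∈ A} this is the product formula for conditional probabilities; it extends to
  -- g(Y) because g(Y) is measurable with respect to Y.
  have key : ∫ z, G z * (b z - (ν[b | mF.comap φ]) z) ∂ν = 0 := by
    refine integral_mul_eq_zero_of_setIntegral_eq_zero (m := mY.comap Prod.snd)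
      measurable_snd.comap_le (hbi.sub integrable_condExp) ?_
      (hg.comp_measurable (comap_measurable _)) ?_
    · rintro _ ⟨A, hA, rfl⟩
      have hAm : MeasurableSet (Prod.snd ⁻¹' A : Set (E × 𝓨)) := measurable_snd hA
      set a : E × 𝓨 → ℝ := (Prod.snd ⁻¹' A).indicator fun _ => (1 : ℝ) with ha
      have hai : Integrable a ν := (integrable_const 1).indicator hAm
      have hsetA : ∀ u : E × 𝓨 → ℝ, ∫ z in Prod.snd ⁻¹' A, u z ∂ν = ∫ z, a z * u z ∂ν := by
        intro u
        rw [← integral_indicator hAm]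
        congr 1
        funext z
        rw [ha, Set.indicator_apply, Set.indicator_apply]
        split_ifs <;> simp
      have e1 : ∫ z in Prod.snd ⁻¹' A, b z ∂ν = ∫ z, (ν[a | mF.comap φ]) z * (ν[b | mF.comap φ]) z ∂ν := by
        rw [show ∫ z, (ν[a | mF.comap φ]) z * (ν[b | mF.comap φ]) z ∂ν =
            ∫ z, (ν[a | mF.comap φ] * ν[b | mF.comap φ]) z ∂ν from rfl,
          ← integral_congr_ae (h A B hA hB), integral_condExp hφ.comap_le, hsetA]
        congr 1
        funext z
        by_cases h1 : z.2 ∈ A <;> by_cases h2 : z.1 ∈ B <;>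
          simp [ha, hb, h1, h2]
      have e2 : ∫ z in Prod.snd ⁻¹' A, (ν[b | mF.comap φ]) z ∂ν = ∫ z, (ν[a | mF.comap φ]) z * (ν[b | mF.comap φ]) z ∂ν := by
        rw [hsetA, integral_mul_condExp hφ.comap_le hai (hmul' hai)]
      rw [integral_sub hbi.integrableOn integrable_condExp.integrableOn, e1, e2, sub_self]
    · have := (hmul hGi).sub (hmul' hGi)
      refine this.congr (Eventually.of_forall fun z => ?_)
      simp only [Pi.sub_apply, Pi.mul_apply]; ring
  have e3 : ∫ z, G z * (ν[b | mF.comap φ]) z ∂ν = ∫ z, b z * (ν[G | mF.comap φ]) z ∂ν := by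
    rw [integral_mul_condExp hφ.comap_le hGi (hmul' hGi),
      integral_mul_condExp hφ.comap_le hbi (hmul integrable_condExp)]
    exact integral_congr_ae (Eventually.of_forall fun z => mul_comm _ _)
  rw [hset, hset, ← e3, ← sub_eq_zero]
  refine (integral_sub (hmul hGi) (hmul' hGi)).symm.trans ?_
  rw [← key]
  congr 1
  funext z
  simp only [Pi.mul_apply]; ring

/-- Passes from events {X ∈ B} to weights u(X); boundedness of g lets u be merely integrable, as
needed for features. -/
theorem CondIndepGiven.integral_mul_eq {E 𝓨 : Type*} [mE : MeasurableSpace E]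
    [mY : MeasurableSpace 𝓨] {ν : Measure (E × 𝓨)} [IsProbabilityMeasure ν]
    {F : Type*} [mF : MeasurableSpace F] {φ : E × 𝓨 → F} (hφ : Measurable φ)
    (h : CondIndepGiven ν (mF.comap φ) Prod.snd Prod.fst) {g : 𝓨 → ℝ} (hg : StronglyMeasurable g) {C : NNReal}
    (hC : ∀ y, |g y| ≤ C) {u : E → ℝ} (hu : StronglyMeasurable u)
    (hui : Integrable (fun z : E × 𝓨 => u z.1) ν) :
    ∫ z, u z.1 * g z.2 ∂ν = ∫ z, u z.1 * (ν[fun z => g z.2 | mF.comap φ]) z ∂ν := by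
  have hGm : AEStronglyMeasurable (fun z : E × 𝓨 => g z.2) ν :=
    (hg.comp_measurable measurable_snd).aestronglyMeasurable
  have hGi : Integrable (fun z : E × 𝓨 => g z.2) ν :=
    Integrable.of_bound hGm C (Eventually.of_forall fun z => hC z.2)
  have hEb : ∀ᵐ z ∂ν, |(ν[fun z : E × 𝓨 => g z.2 | mF.comap φ]) z| ≤ C :=
    ae_bdd_abs_condExp_of_ae_bdd_abs (Eventually.of_forall fun z => hC z.2)
  have i1 : Integrable (fun z : E × 𝓨 => u z.1 * g z.2) ν :=
    hui.mul_bdd hGm (Eventually.of_forall fun z => hC z.2)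
  have i2 : Integrable (fun z : E × 𝓨 => u z.1 * (ν[fun z => g z.2 | mF.comap φ]) z) ν :=
    hui.mul_bdd integrable_condExp.aestronglyMeasurable hEb
  rw [← sub_eq_zero, ← integral_sub i1 i2]
  have := integral_mul_eq_zero_of_setIntegral_eq_zero (m := mE.comap Prod.fst) (μ := ν)
    measurable_fst.comap_le (w := fun z => u z.1)
    (r := fun z => g z.2 - (ν[fun z => g z.2 | mF.comap φ]) z) (hGi.sub integrable_condExp) ?_
    (hu.comp_measurable (comap_measurable _)) ?_
  · rw [← this]
    congr 1
    funext z
    ring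
  · rintro _ ⟨B, hB, rfl⟩
    rw [integral_sub hGi.integrableOn integrable_condExp.integrableOn, sub_eq_zero]
    exact h.setIntegral_eq hφ hg hC hB
  · refine (i1.sub i2).congr (Eventually.of_forall fun z => ?_)
    simp only [Pi.sub_apply, Pi.mul_apply]; ring

end ConditionalExpectation

/-! ### Separability of the RKHS and the feature map. -/

section Separability

variable {H : Type*} [NormedAddCommGroup H] [InnerProductSpace ℝ H]

theorem countable_of_hilbertBasis [SecondCountableTopology H] {ι : Type*}
    (b : HilbertBasis ι ℝ H) : Countable ι := by
  refine Pairwise.countable_of_isOpen_disjoint (s := fun i => Metric.ball (b i) (1 / 2)) ?_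
    (fun _ => Metric.isOpen_ball) (fun i => ⟨b i, Metric.mem_ball_self (by norm_num)⟩)
  intro i j hij
  refine Metric.ball_disjoint_ball ?_
  have h1 : ‖b i - b j‖ ^ 2 = 2 := by
    rw [norm_sub_sq_real, b.orthonormal.1 i, b.orthonormal.1 j, b.orthonormal.2 hij]; norm_num
  rw [dist_eq_norm]
  nlinarith [norm_nonneg (b i - b j)]

end Separability

section Features

variable {E : Type*} {H : Type*} [NormedAddCommGroup H] [InnerProductSpace ℝ H] [CompleteSpace H]
  [RKHS ℝ H E ℝ]

theorem inner_feat (x : E) (h : H) : ⟪feat H x, h⟫ = h x := by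
  rw [feat, RKHS.kerFun_inner]; simp

theorem norm_feat_sq (x : E) : ‖feat H x‖ ^ 2 = kerVal H x x := by
  rw [← real_inner_self_eq_norm_sq, inner_feat, feat, RKHS.kerFun_apply, kerVal]

/-- The feature map has separable range, and its span is dense since a vector orthogonal to all
features vanishes pointwise. -/
theorem secondCountable_of_stronglyMeasurable_feat [MeasurableSpace E]
    (hfeat : StronglyMeasurable fun x : E => feat H x) : SecondCountableTopology H := by
  have h1 : TopologicalSpace.IsSeparable
      ((Submodule.span ℝ (Set.range fun x : E => feat H x)) : Set H) :=
    hfeat.isSeparable_range.span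
  have h2 : (Submodule.span ℝ (Set.range fun x : E => feat H x)).topologicalClosure = ⊤ := by
    rw [Submodule.topologicalClosure_eq_top_iff, Submodule.eq_bot_iff]
    intro h hh
    refine RKHS.ext fun x => ?_
    rw [← inner_feat, (Submodule.mem_orthogonal _ _).1 hh _ (Submodule.subset_span ⟨x, rfl⟩)]
    simp
  have h3 : TopologicalSpace.IsSeparable (Set.univ : Set H) := by
    have := h1.closure
    rwa [← Submodule.topologicalClosure_coe, h2] at this
  have := TopologicalSpace.isSeparable_univ_iff.1 h3
  exact UniformSpace.secondCountable_of_separable H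

end Features

/-! ### Integrals of rank-one operators. -/

section RankOneIntegrals

variable {α : Type*} [MeasurableSpace α] {μ : Measure α}
variable {H : Type*} [NormedAddCommGroup H] [InnerProductSpace ℝ H] [CompleteSpace H]

theorem continuous_rankOne : Continuous fun p : H × H => rankOne ℝ p.1 p.2 :=
  ((ContinuousLinearMap.smulRightL ℝ H H).continuous.comp
    ((innerSL ℝ).continuous.comp continuous_snd)).clm_apply continuous_fst

theorem aestronglyMeasurable_rankOne {a b : α → H} (ha : AEStronglyMeasurable a μ)
    (hb : AEStronglyMeasurable b μ) : AEStronglyMeasurable (fun x => rankOne ℝ (a x) (b x)) μ :=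
  Continuous.comp_aestronglyMeasurable (g := fun p : H × H => rankOne ℝ p.1 p.2)
    (f := fun x => (a x, b x)) continuous_rankOne (ha.prodMk hb)

theorem integrable_rankOne {a b : α → H} (ha : MemLp a 2 μ) (hb : MemLp b 2 μ) :
    Integrable (fun x => rankOne ℝ (a x) (b x)) μ := by
  refine (ha.norm.integrable_mul hb.norm).mono'
    (aestronglyMeasurable_rankOne ha.aestronglyMeasurable hb.aestronglyMeasurable)
    (Eventually.of_forall fun x => ?_)
  rw [norm_rankOne]; rfl

theorem integrable_inner_mul_inner {a b : α → H} (ha : MemLp a 2 μ) (hb : MemLp b 2 μ) (h k : H) :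
    Integrable (fun x => ⟪b x, h⟫ * ⟪a x, k⟫) μ :=
  (hb.inner_const h).integrable_mul (ha.inner_const k)

theorem inner_integral_clm_apply {T : α → H →L[ℝ] H} (hT : Integrable T μ) (h k : H) :
    ⟪(∫ x, T x ∂μ) h, k⟫ = ∫ x, ⟪T x h, k⟫ ∂μ := by
  rw [ContinuousLinearMap.integral_apply hT, real_inner_comm,
    ← integral_inner (hT.apply_continuousLinearMap h)]
  exact integral_congr_ae (Eventually.of_forall fun x => real_inner_comm _ _)

theorem inner_rankOne_apply (a b h k : H) : ⟪rankOne ℝ a b h, k⟫ = ⟪b, h⟫ * ⟪a, k⟫ := by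
  rw [rankOne_apply, real_inner_smul_left]

theorem integral_inner_left {a : α → H} (ha : Integrable a μ) (h : H) :
    ∫ x, ⟪a x, h⟫ ∂μ = ⟪∫ x, a x ∂μ, h⟫ := by
  rw [real_inner_comm, ← integral_inner ha]
  exact integral_congr_ae (Eventually.of_forall fun x => real_inner_comm _ _)

end RankOneIntegrals

/-! ### Population operators as second moments of centered vectors. -/

section Population

variable {E 𝓨 : Type*} [MeasurableSpace E] [MetricSpace 𝓨] [MeasurableSpace 𝓨]
variable {H : Type*} [NormedAddCommGroup H] [InnerProductSpace ℝ H] [CompleteSpace H]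
  [RKHS ℝ H E ℝ]

variable (H) in
/-- The centered feature `κ(·, X) - μ_X`. -/
def cfeat (ν : Measure (E × 𝓨)) (z : E × 𝓨) : H := feat H z.1 - meanEmb H ν

/-- The distance, centered in its second argument. -/
def cdist (y₀ y y' : 𝓨) : ℝ := dist y y' - dist y₀ y'

variable (H) in
/-- `y ↦ -E{(d(y, Y') - d(y₀, Y')) (κ(·, X') - μ_X)}`. -/
def regVec (ν : Measure (E × 𝓨)) (y₀ y : 𝓨) : H := -∫ z, cdist y₀ y z.2 • cfeat H ν z ∂ν

/-- The residual of the regression of `regVec` on the centered feature. -/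
def resid (ν : Measure (E × 𝓨)) (y₀ : 𝓨) (S : H →L[ℝ] H) (z : E × 𝓨) : H :=
  regVec H ν y₀ z.2 - ContinuousLinearMap.adjoint S (cfeat H ν z)

theorem abs_cdist_le (y₀ y y' : 𝓨) : |cdist y₀ y y'| ≤ dist y₀ y := by
  rw [cdist, dist_comm y₀ y]
  exact abs_dist_sub_le y y₀ y'

variable {ν : Measure (E × 𝓨)} [IsProbabilityMeasure ν]

theorem memLp_feat (hfeat : StronglyMeasurable fun x : E => feat H x)
    (hκ : Integrable (fun z => kerVal H z.1 z.1) ν) : MemLp (fun z => feat H z.1) 2 ν := by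
  refine (memLp_two_iff_integrable_sq_norm
    (hfeat.comp_measurable measurable_fst).aestronglyMeasurable).2 ?_
  exact hκ.congr (Eventually.of_forall fun z => (norm_feat_sq z.1).symm)

theorem stronglyMeasurable_cfeat (hfeat : StronglyMeasurable fun x : E => feat H x) :
    StronglyMeasurable (cfeat H ν) :=
  (hfeat.comp_measurable measurable_fst).sub stronglyMeasurable_const

theorem memLp_cfeat (hφ : MemLp (fun z => feat H z.1) 2 ν) : MemLp (cfeat H ν) 2 ν :=
  hφ.sub (memLp_const _)

theorem integral_cfeat (hφ : MemLp (fun z => feat H z.1) 2 ν) : ∫ z, cfeat H ν z ∂ν = 0 := by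
  unfold cfeat
  rw [integral_sub (hφ.integrable one_le_two) (integrable_const _)]
  simp [meanEmb]

theorem integral_inner_cfeat (hφ : MemLp (fun z => feat H z.1) 2 ν) (h : H) :
    ∫ z, ⟪cfeat H ν z, h⟫ ∂ν = 0 := by
  rw [integral_inner_left ((memLp_cfeat hφ).integrable one_le_two), integral_cfeat hφ,
    inner_zero_left]

theorem inner_covOp (hφ : MemLp (fun z => feat H z.1) 2 ν) (h k : H) :
    ⟪covOp H ν h, k⟫ = ∫ z, ⟪cfeat H ν z, h⟫ * ⟪cfeat H ν z, k⟫ ∂ν := by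
  have i1 := integrable_inner_mul_inner hφ hφ h k
  have ih : ∀ h : H, Integrable (fun z : E × 𝓨 => ⟪feat H z.1, h⟫) ν := fun h =>
    (hφ.integrable one_le_two).inner_const h
  have e : ∀ z : E × 𝓨, ⟪cfeat H ν z, h⟫ * ⟪cfeat H ν z, k⟫ = ⟪feat H z.1, h⟫ * ⟪feat H z.1, k⟫ -
      ⟪meanEmb H ν, k⟫ * ⟪feat H z.1, h⟫ - ⟪meanEmb H ν, h⟫ * ⟪feat H z.1, k⟫ +
      ⟪meanEmb H ν, h⟫ * ⟪meanEmb H ν, k⟫ := by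
    intro z
    simp only [cfeat, inner_sub_left]; ring
  have em : ∀ h : H, ∫ z : E × 𝓨, ⟪feat H z.1, h⟫ ∂ν = ⟪meanEmb H ν, h⟫ := fun h =>
    integral_inner_left (hφ.integrable one_le_two) h
  rw [integral_congr_ae (Eventually.of_forall e), integral_add, integral_sub, integral_sub,
    integral_const_mul, integral_const_mul, em, em, covOp, sub_apply, inner_sub_left,
    inner_integral_clm_apply (integrable_rankOne hφ hφ)]
  · simp only [inner_rankOne_apply, integral_const, probReal_univ, one_smul]
    ring
  · exact i1
  · exact (ih h).const_mul _
  · exact i1.sub ((ih h).const_mul _)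
  · exact (ih k).const_mul _
  · exact (i1.sub ((ih h).const_mul _)).sub ((ih k).const_mul _)
  · exact integrable_const _

theorem covOp_eq (hφ : MemLp (fun z => feat H z.1) 2 ν) :
    covOp H ν = ∫ z, rankOne ℝ (cfeat H ν z) (cfeat H ν z) ∂ν := by
  refine ContinuousLinearMap.ext fun h => ext_inner_right ℝ fun k => ?_
  rw [inner_covOp hφ, inner_integral_clm_apply (integrable_rankOne (memLp_cfeat hφ)
    (memLp_cfeat hφ))]
  simp only [inner_rankOne_apply]

theorem isPositive_covOp (hφ : MemLp (fun z => feat H z.1) 2 ν) : (covOp H ν).IsPositive := by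
  refine isPositive_of_inner_nonneg ?_ fun h => ?_
  · rw [ContinuousLinearMap.isSelfAdjoint_iff_isSymmetric]
    intro h k
    change ⟪covOp H ν h, k⟫ = ⟪h, covOp H ν k⟫
    rw [real_inner_comm _ h, inner_covOp hφ, inner_covOp hφ]
    exact integral_congr_ae (Eventually.of_forall fun z => mul_comm _ _)
  · rw [inner_covOp hφ]
    exact integral_nonneg fun z => mul_self_nonneg _

/-- By Fubini almost every section of d² is integrable, so some point can serve as base point. -/
theorem exists_memLp_dist (hdist : Measurable fun q : 𝓨 × 𝓨 => dist q.1 q.2)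
    (hd2 : Integrable (fun q : (E × 𝓨) × (E × 𝓨) => dist q.1.2 q.2.2 ^ 2) (ν.prod ν)) :
    ∃ y₀ : 𝓨, MemLp (fun z : E × 𝓨 => dist y₀ z.2) 2 ν := by
  obtain ⟨z, hz⟩ := hd2.prod_right_ae.exists
  refine ⟨z.2, ?_⟩
  rw [memLp_two_iff_integrable_sq]
  · exact hz
  · exact (hdist.comp (measurable_const.prodMk measurable_snd)).aestronglyMeasurable

/-- Dominated by d² + ‖η‖²‖η′‖², where the second term is integrable because the copies are
independent. -/
theorem integrable_wire (hdist : Measurable fun q : 𝓨 × 𝓨 => dist q.1 q.2)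
    (hd2 : Integrable (fun q : (E × 𝓨) × (E × 𝓨) => dist q.1.2 q.2.2 ^ 2) (ν.prod ν))
    (hφ : MemLp (fun z => feat H z.1) 2 ν) :
    Integrable (fun q : (E × 𝓨) × (E × 𝓨) => dist q.1.2 q.2.2 •
      rankOne ℝ (cfeat H ν q.1) (cfeat H ν q.2)) (ν.prod ν) := by
  have hη := memLp_cfeat hφ
  have hm1 : AEStronglyMeasurable (fun q : (E × 𝓨) × (E × 𝓨) => cfeat H ν q.1) (ν.prod ν) :=
    hη.aestronglyMeasurable.comp_fst
  have hm2 : AEStronglyMeasurable (fun q : (E × 𝓨) × (E × 𝓨) => cfeat H ν q.2) (ν.prod ν) :=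
    hη.aestronglyMeasurable.comp_snd
  have hdm : AEStronglyMeasurable (fun q : (E × 𝓨) × (E × 𝓨) => dist q.1.2 q.2.2) (ν.prod ν) :=
    (hdist.comp ((measurable_snd.comp measurable_fst).prodMk
      (measurable_snd.comp measurable_snd))).aestronglyMeasurable
  have hsq := (memLp_two_iff_integrable_sq_norm hη.aestronglyMeasurable).1 hη
  have hprod : Integrable (fun q : (E × 𝓨) × (E × 𝓨) => ‖cfeat H ν q.1‖ ^ 2 * ‖cfeat H ν q.2‖ ^ 2)
      (ν.prod ν) := hsq.mul_prod hsq
  refine (hd2.add hprod).mono' (hdm.smul (aestronglyMeasurable_rankOne hm1 hm2))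
    (Eventually.of_forall fun q => ?_)
  rw [norm_smul, norm_rankOne, Real.norm_of_nonneg dist_nonneg]
  simp only [Pi.add_apply]
  nlinarith [sq_nonneg (dist q.1.2 q.2.2 - ‖cfeat H ν q.1‖ * ‖cfeat H ν q.2‖),
    sq_nonneg (dist q.1.2 q.2.2), sq_nonneg (‖cfeat H ν q.1‖ * ‖cfeat H ν q.2‖)]

theorem inner_wireOp (hdist : Measurable fun q : 𝓨 × 𝓨 => dist q.1 q.2)
    (hd2 : Integrable (fun q : (E × 𝓨) × (E × 𝓨) => dist q.1.2 q.2.2 ^ 2) (ν.prod ν))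
    (hφ : MemLp (fun z => feat H z.1) 2 ν) (h k : H) :
    ⟪wireOp H ν h, k⟫ = -∫ q : (E × 𝓨) × (E × 𝓨), dist q.1.2 q.2.2 *
      (⟪cfeat H ν q.2, h⟫ * ⟪cfeat H ν q.1, k⟫) ∂(ν.prod ν) := by
  have e : wireOp H ν = -∫ q : (E × 𝓨) × (E × 𝓨), dist q.1.2 q.2.2 •
      rankOne ℝ (cfeat H ν q.1) (cfeat H ν q.2) ∂(ν.prod ν) := rfl
  rw [e, neg_apply, inner_neg_left, inner_integral_clm_apply (integrable_wire hdist hd2 hφ)]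
  simp only [smul_apply, real_inner_smul_left, inner_rankOne_apply]

theorem measurable_cdist (hdist : Measurable fun q : 𝓨 × 𝓨 => dist q.1 q.2) (y₀ : 𝓨) :
    Measurable fun q : 𝓨 × 𝓨 => cdist y₀ q.1 q.2 :=
  hdist.sub (hdist.comp (measurable_const.prodMk measurable_snd))

theorem integrable_cdist_smul (hdist : Measurable fun q : 𝓨 × 𝓨 => dist q.1 q.2)
    (hφ : MemLp (fun z => feat H z.1) 2 ν) (y₀ y : 𝓨) :
    Integrable (fun z => cdist y₀ y z.2 • cfeat H ν z) ν := by
  refine ((memLp_cfeat hφ).integrable one_le_two).bdd_smul (dist y₀ y) ?_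
    (Eventually.of_forall fun z => abs_cdist_le y₀ y z.2)
  exact ((measurable_cdist hdist y₀).comp
    (measurable_const.prodMk measurable_snd)).aestronglyMeasurable

theorem stronglyMeasurable_regVec (hdist : Measurable fun q : 𝓨 × 𝓨 => dist q.1 q.2)
    (hfeat : StronglyMeasurable fun x : E => feat H x) (y₀ : 𝓨) :
    StronglyMeasurable (regVec H ν y₀) := by
  unfold regVec
  refine StronglyMeasurable.neg (StronglyMeasurable.integral_prod_right' (ν := ν)
    (f := fun q : 𝓨 × (E × 𝓨) => cdist y₀ q.1 q.2.2 • cfeat H ν q.2) ?_)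
  refine StronglyMeasurable.smul ?_ ((stronglyMeasurable_cfeat hfeat).comp_measurable measurable_snd)
  exact ((measurable_cdist hdist y₀).comp
    (measurable_fst.prodMk (measurable_snd.comp measurable_snd))).stronglyMeasurable

variable (H) in
/-- A bound for `regVec`. -/
def regBound (ν : Measure (E × 𝓨)) (y₀ : 𝓨) : NNReal :=
  Real.toNNReal (∫ z, 2 * (dist y₀ z.2 * ‖cfeat H ν z‖) ∂ν)

/-- The regression vector is bounded, by the triangle inequality. -/
theorem norm_regVec_le (hdist : Measurable fun q : 𝓨 × 𝓨 => dist q.1 q.2)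
    (hφ : MemLp (fun z => feat H z.1) 2 ν) {y₀ : 𝓨}
    (hρ : MemLp (fun z : E × 𝓨 => dist y₀ z.2) 2 ν) (y : 𝓨) :
    ‖regVec H ν y₀ y‖ ≤ regBound H ν y₀ := by
  have hη := memLp_cfeat hφ
  have i1 := integrable_cdist_smul hdist hφ y₀ y
  have i2 : Integrable (fun z => dist y₀ y • cfeat H ν z) ν :=
    (hη.integrable one_le_two).smul _
  -- Since η has mean zero, the constant d(y₀, y) may be subtracted; what remains is at most 2 d(y₀,
  -- Y′), uniformly in y.
  have e : regVec H ν y₀ y = -∫ z, (cdist y₀ y z.2 - dist y₀ y) • cfeat H ν z ∂ν := by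
    simp_rw [sub_smul]
    rw [integral_sub i1 i2, integral_smul, integral_cfeat hφ, smul_zero, sub_zero]
    rfl
  have ib : Integrable (fun z : E × 𝓨 => 2 * (dist y₀ z.2 * ‖cfeat H ν z‖)) ν :=
    (hρ.integrable_mul hη.norm).const_mul 2
  rw [e, norm_neg, regBound, Real.coe_toNNReal _ (integral_nonneg fun z => by positivity)]
  refine norm_integral_le_of_norm_le ib (Eventually.of_forall fun z => ?_)
  rw [norm_smul, ← mul_assoc]
  gcongr
  rw [cdist, Real.norm_eq_abs, abs_le]
  have h1 := dist_triangle y y₀ z.2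
  have h2 := dist_triangle y₀ z.2 y
  have h3 := dist_triangle y₀ y z.2
  rw [dist_comm y y₀] at h1
  rw [dist_comm z.2 y] at h2
  constructor <;> linarith

theorem memLp_regVec (hdist : Measurable fun q : 𝓨 × 𝓨 => dist q.1 q.2)
    (hfeat : StronglyMeasurable fun x : E => feat H x)
    (hφ : MemLp (fun z => feat H z.1) 2 ν) {y₀ : 𝓨}
    (hρ : MemLp (fun z : E × 𝓨 => dist y₀ z.2) 2 ν) :
    MemLp (fun z : E × 𝓨 => regVec H ν y₀ z.2) 2 ν :=
  MemLp.of_bound ((stronglyMeasurable_regVec hdist hfeat y₀).comp_measurable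
    measurable_snd).aestronglyMeasurable _
    (Eventually.of_forall fun z => norm_regVec_le hdist hφ hρ z.2)

/-- Subtracting d(y₀, Y′) costs nothing: that term involves only the second copy, and the centered
feature of the first copy integrates to zero. -/
theorem inner_wireOp_eq (hdist : Measurable fun q : 𝓨 × 𝓨 => dist q.1 q.2)
    (hd2 : Integrable (fun q : (E × 𝓨) × (E × 𝓨) => dist q.1.2 q.2.2 ^ 2) (ν.prod ν))
    (hφ : MemLp (fun z => feat H z.1) 2 ν) {y₀ : 𝓨}
    (hρ : MemLp (fun z : E × 𝓨 => dist y₀ z.2) 2 ν) (h k : H) :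
    ⟪wireOp H ν h, k⟫ = ∫ z, ⟪regVec H ν y₀ z.2, h⟫ * ⟪cfeat H ν z, k⟫ ∂ν := by
  have hη := memLp_cfeat hφ
  have i0 : Integrable (fun q : (E × 𝓨) × (E × 𝓨) => dist q.1.2 q.2.2 *
      (⟪cfeat H ν q.2, h⟫ * ⟪cfeat H ν q.1, k⟫)) (ν.prod ν) := by
    have := ((integrable_wire hdist hd2 hφ).apply_continuousLinearMap h).inner_const (𝕜 := ℝ) k
    simpa only [smul_apply, real_inner_smul_left, inner_rankOne_apply] using this
  have i1 : Integrable (fun q : (E × 𝓨) × (E × 𝓨) => ⟪cfeat H ν q.1, k⟫ *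
      (dist y₀ q.2.2 * ⟪cfeat H ν q.2, h⟫)) (ν.prod ν) :=
    ((hη.integrable one_le_two).inner_const k).mul_prod (hρ.integrable_mul (hη.inner_const h))
  have e1 : ∫ q : (E × 𝓨) × (E × 𝓨), ⟪cfeat H ν q.1, k⟫ *
      (dist y₀ q.2.2 * ⟪cfeat H ν q.2, h⟫) ∂(ν.prod ν) = 0 := by
    rw [integral_prod_mul (fun z => ⟪cfeat H ν z, k⟫) (fun z => dist y₀ z.2 * ⟪cfeat H ν z, h⟫),
      integral_inner_cfeat hφ, zero_mul]
  rw [inner_wireOp hdist hd2 hφ, ← sub_zero (∫ q, _ ∂_), ← e1, ← integral_sub i0 i1,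
    integral_prod (fun q : (E × 𝓨) × (E × 𝓨) => dist q.1.2 q.2.2 *
      (⟪cfeat H ν q.2, h⟫ * ⟪cfeat H ν q.1, k⟫) - ⟪cfeat H ν q.1, k⟫ *
      (dist y₀ q.2.2 * ⟪cfeat H ν q.2, h⟫)) (i0.sub i1), ← integral_neg]
  refine integral_congr_ae (Eventually.of_forall fun z => ?_)
  simp only [regVec, inner_neg_left]
  rw [← integral_inner_left (integrable_cdist_smul hdist hφ y₀ z.2), neg_mul, ← integral_mul_const]
  congr 1
  refine integral_congr_ae (Eventually.of_forall fun w => ?_)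
  simp only [real_inner_smul_left, cdist]
  ring

theorem memLp_resid (hdist : Measurable fun q : 𝓨 × 𝓨 => dist q.1 q.2)
    (hfeat : StronglyMeasurable fun x : E => feat H x)
    (hφ : MemLp (fun z => feat H z.1) 2 ν) {y₀ : 𝓨}
    (hρ : MemLp (fun z : E × 𝓨 => dist y₀ z.2) 2 ν) (S : H →L[ℝ] H) :
    MemLp (resid ν y₀ S) 2 ν :=
  (memLp_regVec hdist hfeat hφ hρ).sub
    ((ContinuousLinearMap.adjoint S).comp_memLp' (memLp_cfeat hφ))

/-- If `Λ = Σ S`, then the residual is uncorrelated with the centered feature. -/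
theorem integral_resid_smul (hdist : Measurable fun q : 𝓨 × 𝓨 => dist q.1 q.2)
    (hd2 : Integrable (fun q : (E × 𝓨) × (E × 𝓨) => dist q.1.2 q.2.2 ^ 2) (ν.prod ν))
    (hfeat : StronglyMeasurable fun x : E => feat H x)
    (hφ : MemLp (fun z => feat H z.1) 2 ν) {y₀ : 𝓨}
    (hρ : MemLp (fun z : E × 𝓨 => dist y₀ z.2) 2 ν) {S : H →L[ℝ] H}
    (hS : wireOp H ν = covOp H ν ∘L S) (h k : H) :
    ∫ z, ⟪resid ν y₀ S z, h⟫ * ⟪cfeat H ν z, k⟫ ∂ν = 0 := by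
  have hη := memLp_cfeat hφ
  have e : ∀ z, ⟪resid ν y₀ S z, h⟫ * ⟪cfeat H ν z, k⟫ =
      ⟪regVec H ν y₀ z.2, h⟫ * ⟪cfeat H ν z, k⟫ - ⟪cfeat H ν z, S h⟫ * ⟪cfeat H ν z, k⟫ := by
    intro z
    rw [resid, inner_sub_left, ContinuousLinearMap.adjoint_inner_left, sub_mul]
  rw [integral_congr_ae (Eventually.of_forall e), integral_sub
    (integrable_inner_mul_inner hη (memLp_regVec hdist hfeat hφ hρ) h k)
    (integrable_inner_mul_inner hη hη (S h) k), ← inner_wireOp_eq hdist hd2 hφ hρ,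
    ← inner_covOp hφ, hS, ContinuousLinearMap.comp_apply, sub_self]

end Population

theorem eLpNorm_two_sq {α : Type*} [MeasurableSpace α] {μ : Measure α} {w : α → ℝ}
    (hw : MemLp w 2 μ) : eLpNorm w 2 μ ^ 2 = ENNReal.ofReal (∫ x, w x ^ 2 ∂μ) := by
  have h1 := eLpNorm_nnreal_pow_eq_lintegral (p := 2) (f := w) (μ := μ) two_ne_zero
  simp only [NNReal.coe_ofNat, ENNReal.rpow_ofNat, ENNReal.coe_ofNat] at h1
  rw [h1, ofReal_integral_eq_lintegral_ofReal hw.integrable_sq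
    (Eventually.of_forall fun _ => sq_nonneg _)]
  refine lintegral_congr fun x => ?_
  rw [enorm_sq_eq_ofReal, Real.norm_eq_abs, sq_abs]

/-! ### Almost sure boundedness of the residual. -/

section Boundedness

variable {E 𝓨 : Type*} [MeasurableSpace E] [MetricSpace 𝓨] [MeasurableSpace 𝓨]
variable {H : Type*} [NormedAddCommGroup H] [InnerProductSpace ℝ H] [CompleteSpace H]
  [RKHS ℝ H E ℝ]
variable {ν : Measure (E × 𝓨)} [IsProbabilityMeasure ν]

theorem inner_cfeat (z : E × 𝓨) (h : H) : ⟪cfeat H ν z, h⟫ = h z.1 - ⟪meanEmb H ν, h⟫ := by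
  rw [cfeat, inner_sub_left, inner_feat]

/-- By sufficiency of `f` and density of the central class, the regression of the bounded vector
`regVec` on the predictor is linear in the feature, and hence the regression function is bounded. -/
theorem ae_abs_inner_cfeat_le (hdist : Measurable fun q : 𝓨 × 𝓨 => dist q.1 q.2)
    (hd2 : Integrable (fun q : (E × 𝓨) × (E × 𝓨) => dist q.1.2 q.2.2 ^ 2) (ν.prod ν))
    (hfeat : StronglyMeasurable fun x : E => feat H x)
    (hφ : MemLp (fun z => feat H z.1) 2 ν) {y₀ : 𝓨}
    (hρ : MemLp (fun z : E × 𝓨 => dist y₀ z.2) 2 ν) {S : H →L[ℝ] H}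
    (hS : wireOp H ν = covOp H ν ∘L S) {F : Type*} [mF : MeasurableSpace F] {f : E → F}
    (hf : Measurable f)
    (hsuff : CondIndepGiven ν (mF.comap fun z : E × 𝓨 => f z.1) Prod.snd Prod.fst)
    (hdense : DenseModConst H (mF.comap f) (ν.map Prod.fst)) (h : H) :
    ∀ᵐ z ∂ν, |⟪cfeat H ν z, S h⟫| ≤ 2 * (regBound H ν y₀ * ‖h‖₊ : NNReal) := by
  set C : NNReal := regBound H ν y₀ * ‖h‖₊ with hC
  set g : 𝓨 → ℝ := fun y => ⟪regVec H ν y₀ y, h⟫ with hg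
  have hη := memLp_cfeat hφ
  have hgm : StronglyMeasurable g := (stronglyMeasurable_regVec hdist hfeat y₀).inner stronglyMeasurable_const
  have hgC : ∀ y, |g y| ≤ C := fun y => by
    refine (abs_real_inner_le_norm _ _).trans ?_
    rw [hC, NNReal.coe_mul, coe_nnnorm]
    gcongr
    exact norm_regVec_le hdist hφ hρ y
  have hφm : Measurable fun z : E × 𝓨 => f z.1 := hf.comp measurable_fst
  -- Factor the conditional expectation through f, so that it becomes a function φ of x to which
  -- density applies.
  obtain ⟨k, hk, hEk⟩ := (stronglyMeasurable_condExp (m := mF.comap fun z : E × 𝓨 => f z.1)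
    (μ := ν) (f := fun z => g z.2)).exists_eq_measurable_comp
  set φ : E → ℝ := fun x => k (f x) with hφdef
  have hEφ : ∀ z, (ν[fun z => g z.2 | mF.comap fun z : E × 𝓨 => f z.1]) z = φ z.1 := fun z =>
    congrFun hEk z
  have hφC : ∀ᵐ z ∂ν, |φ z.1| ≤ C := by
    have := ae_bdd_abs_condExp_of_ae_bdd_abs (m := mF.comap fun z : E × 𝓨 => f z.1) (μ := ν)
      (f := fun z => g z.2) (R := (C : ℝ)) (Eventually.of_forall fun z => hgC z.2)
    filter_upwards [this] with z hz
    rwa [hEφ] at hz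
  have hφsm : StronglyMeasurable φ := hk.comp_measurable hf
  have hφν : MemLp (fun z : E × 𝓨 => φ z.1) 2 ν :=
    MemLp.of_bound (hφsm.comp_measurable measurable_fst).aestronglyMeasurable C hφC
  have hφπ : MemLp φ 2 (ν.map Prod.fst) :=
    (memLp_map_measure_iff hφsm.aestronglyMeasurable measurable_fst.aemeasurable).2 hφν
  set c := ∫ z, g z.2 ∂ν with hc
  have hgi : Integrable (fun z : E × 𝓨 => g z.2) ν :=
    Integrable.of_bound (hgm.comp_measurable measurable_snd).aestronglyMeasurable C
      (Eventually.of_forall fun z => hgC z.2)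
  have hcC : |c| ≤ C := by
    have := norm_integral_le_of_norm_le_const (μ := ν) (f := fun z : E × 𝓨 => g z.2) (C := (C : ℝ))
      (Eventually.of_forall fun z => hgC z.2)
    simpa using this
  have hφint : ∫ z, φ z.1 ∂ν = c := by
    refine (integral_congr_ae (Eventually.of_forall fun z => (hEφ z).symm)).trans ?_
    exact integral_condExp hφm.comap_le
  have hin : ∀ v : H, MemLp (fun z => ⟪cfeat H ν z, v⟫) 2 ν := fun v => hη.inner_const v
  set e : E × 𝓨 → ℝ := fun z => φ z.1 - c - ⟪cfeat H ν z, S h⟫ with he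
  have hem : MemLp e 2 ν := (hφν.sub (memLp_const c)).sub (hin (S h))
  have hei : Integrable e ν := hem.integrable one_le_two
  have hφi := hφν.integrable one_le_two
  have e0 : ∫ z, e z ∂ν = 0 := by
    have i1 : Integrable (fun z : E × 𝓨 => φ z.1 - c) ν := hφi.sub (integrable_const c)
    simp only [he]
    rw [integral_sub i1 ((hin _).integrable one_le_two), integral_sub hφi (integrable_const c), hφint, integral_inner_cfeat hφ]
    simp
  -- Normal equations: sufficiency replaces g(Y) by φ(X) against functions of X, and Λ = ΣS cancels
  -- the two terms.
  have e1 : ∀ v : H, ∫ z, e z * ⟪cfeat H ν z, v⟫ ∂ν = 0 := by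
    intro v
    have i1 : Integrable (fun z : E × 𝓨 => φ z.1 * ⟪cfeat H ν z, v⟫) ν := hφν.integrable_mul (hin v)
    have i2 : Integrable (fun z : E × 𝓨 => c * ⟪cfeat H ν z, v⟫) ν :=
      ((hin v).integrable one_le_two).const_mul c
    have i3 : Integrable (fun z : E × 𝓨 => ⟪cfeat H ν z, S h⟫ * ⟪cfeat H ν z, v⟫) ν :=
      (hin _).integrable_mul (hin v)
    have hci : ∫ z, φ z.1 * ⟪cfeat H ν z, v⟫ ∂ν = ⟪wireOp H ν h, v⟫ := by
      rw [inner_wireOp_eq hdist hd2 hφ hρ]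
      have hu : StronglyMeasurable fun x : E => ⟪feat H x - meanEmb H ν, v⟫ :=
        (hfeat.sub stronglyMeasurable_const).inner stronglyMeasurable_const
      have := hsuff.integral_mul_eq hφm hgm hgC hu ((hin v).integrable one_le_two)
      simp only [hEφ] at this
      refine (integral_congr_ae (Eventually.of_forall fun z => mul_comm _ _)).trans
        (this.symm.trans (integral_congr_ae (Eventually.of_forall fun z => mul_comm _ _)))
    have hexp : ∀ z, e z * ⟪cfeat H ν z, v⟫ = φ z.1 * ⟪cfeat H ν z, v⟫ - c * ⟪cfeat H ν z, v⟫ -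
        ⟪cfeat H ν z, S h⟫ * ⟪cfeat H ν z, v⟫ := fun z => by
      simp only [he]; ring
    have i4 : Integrable (fun z : E × 𝓨 => φ z.1 * ⟪cfeat H ν z, v⟫ - c * ⟪cfeat H ν z, v⟫) ν :=
      i1.sub i2
    rw [integral_congr_ae (Eventually.of_forall hexp), integral_sub i4 i3,
      integral_sub i1 i2, hci, integral_const_mul, integral_inner_cfeat hφ, ← inner_covOp hφ, hS]
    simp
  -- As e is orthogonal to constants and to all centered elements of H, replacing φ by v + t leaves
  -- ∫ e² = −∫ e w ≤ ½∫ e² + ½∫ w², so ∫ e² ≤ δ.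
  have e2 : ∫ z, e z ^ 2 ∂ν = 0 := by
    refine le_antisymm (le_of_forall_pos_le_add fun δ hδ => ?_)
      (integral_nonneg fun _ => sq_nonneg _)
    have hφae : AEStronglyMeasurable[mF.comap f] φ (ν.map Prod.fst) :=
      (hk.comp_measurable (comap_measurable f)).aestronglyMeasurable
    obtain ⟨v, -, t, hvt⟩ := hdense φ hφπ hφae (ENNReal.ofReal (√δ)) (by simpa using hδ)
    have hvm : MemLp (fun z : E × 𝓨 => v z.1) 2 ν := by
      refine ((hin v).add (memLp_const ⟪meanEmb H ν, v⟫)).ae_eq (Eventually.of_forall fun z => ?_)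
      simp [inner_cfeat]
    set w : E × 𝓨 → ℝ := fun z => v z.1 + t - φ z.1 with hw
    have hwm : MemLp w 2 ν := (hvm.add (memLp_const t)).sub hφν
    have hvfun : AEStronglyMeasurable (fun x : E => v x) (ν.map Prod.fst) := by
      have : (fun x : E => v x) = fun x => ⟪feat H x, v⟫ := funext fun x => (inner_feat x v).symm
      rw [this]
      exact (hfeat.inner stronglyMeasurable_const).aestronglyMeasurable
    have hwsq : ∫ z, w z ^ 2 ∂ν ≤ δ := by
      have hae : AEStronglyMeasurable (fun x => v x + t - φ x) (ν.map Prod.fst) :=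
        (hvfun.add aestronglyMeasurable_const).sub hφsm.aestronglyMeasurable
      rw [eLpNorm_map_measure hae measurable_fst.aemeasurable] at hvt
      have h1 : eLpNorm w 2 ν ^ 2 ≤ ENNReal.ofReal (√δ) ^ 2 := by gcongr; exact hvt.le
      rw [eLpNorm_two_sq hwm, ← ENNReal.ofReal_pow (Real.sqrt_nonneg _), Real.sq_sqrt hδ.le,
        ENNReal.ofReal_le_ofReal_iff hδ.le] at h1
      exact h1
    have hsplit : ∀ z, e z ^ 2 = -(e z * w z) + e z * ⟪cfeat H ν z, v⟫ -
        e z * ⟪cfeat H ν z, S h⟫ + (t + ⟪meanEmb H ν, v⟫ - c) * e z := fun z => by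
      simp only [he, hw, inner_cfeat]; ring
    have hint : ∀ v : H, Integrable (fun z => e z * ⟪cfeat H ν z, v⟫) ν := fun v =>
      hem.integrable_mul (hin v)
    have hew : Integrable (fun z => e z * w z) ν := hem.integrable_mul hwm
    have h1 : ∫ z, e z ^ 2 ∂ν = -∫ z, e z * w z ∂ν := by
      have j0 : Integrable (fun z => -(e z * w z)) ν := hew.neg
      have j1 : Integrable (fun z => -(e z * w z) + e z * ⟪cfeat H ν z, v⟫) ν := j0.add (hint v)
      have j2 : Integrable (fun z => -(e z * w z) + e z * ⟪cfeat H ν z, v⟫ -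
          e z * ⟪cfeat H ν z, S h⟫) ν := j1.sub (hint (S h))
      rw [integral_congr_ae (Eventually.of_forall hsplit), integral_add j2 (hei.const_mul _),
        integral_sub j1 (hint (S h)), integral_add j0 (hint v), integral_const_mul, e0, e1, e1, integral_neg]
      simp
    have h2 : -∫ z, e z * w z ∂ν ≤ ∫ z, (1 / 2 * e z ^ 2 + 1 / 2 * w z ^ 2) ∂ν := by
      rw [← integral_neg]
      refine integral_mono hew.neg
        ((hem.integrable_sq.const_mul _).add (hwm.integrable_sq.const_mul _)) fun z => ?_
      change -(e z * w z) ≤ 1 / 2 * e z ^ 2 + 1 / 2 * w z ^ 2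
      nlinarith [sq_nonneg (e z + w z)]
    rw [integral_add (hem.integrable_sq.const_mul _) (hwm.integrable_sq.const_mul _),
      integral_const_mul, integral_const_mul] at h2
    linarith
  have e3 := (integral_eq_zero_iff_of_nonneg (fun z => sq_nonneg (e z)) hem.integrable_sq).1 e2
  filter_upwards [e3, hφC] with z hz hzC
  have hz0 : e z = 0 := by simpa using hz
  have : ⟪cfeat H ν z, S h⟫ = φ z.1 - c := by
    simp only [he] at hz0; linarith
  rw [this]
  calc |φ z.1 - c| ≤ |φ z.1| + |c| := abs_sub _ _
    _ ≤ 2 * C := by linarith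

/-- The exceptional null set depends on h; a countable dense set of h and continuity give a single
one, and then h = S*η yields the norm. -/
theorem ae_norm_adjoint_cfeat_le (hdist : Measurable fun q : 𝓨 × 𝓨 => dist q.1 q.2)
    (hd2 : Integrable (fun q : (E × 𝓨) × (E × 𝓨) => dist q.1.2 q.2.2 ^ 2) (ν.prod ν))
    (hfeat : StronglyMeasurable fun x : E => feat H x)
    (hφ : MemLp (fun z => feat H z.1) 2 ν) {y₀ : 𝓨}
    (hρ : MemLp (fun z : E × 𝓨 => dist y₀ z.2) 2 ν) {S : H →L[ℝ] H}
    (hS : wireOp H ν = covOp H ν ∘L S) {F : Type*} [mF : MeasurableSpace F] {f : E → F}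
    (hf : Measurable f)
    (hsuff : CondIndepGiven ν (mF.comap fun z : E × 𝓨 => f z.1) Prod.snd Prod.fst)
    (hdense : DenseModConst H (mF.comap f) (ν.map Prod.fst)) :
    ∀ᵐ z ∂ν, ‖ContinuousLinearMap.adjoint S (cfeat H ν z)‖ ≤ 2 * (regBound H ν y₀ : ℝ) := by
  have := secondCountable_of_stronglyMeasurable_feat hfeat
  obtain ⟨D, hDc, hDd⟩ := TopologicalSpace.exists_countable_dense H
  have h1 : ∀ᵐ z ∂ν, ∀ h ∈ D, |⟪cfeat H ν z, S h⟫| ≤ 2 * (regBound H ν y₀ * ‖h‖₊ : NNReal) :=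
    (ae_ball_iff hDc).2 fun h _ =>
      ae_abs_inner_cfeat_le hdist hd2 hfeat hφ hρ hS hf hsuff hdense h
  filter_upwards [h1] with z hz
  set v := ContinuousLinearMap.adjoint S (cfeat H ν z) with hv
  have h2 : ∀ h : H, |⟪v, h⟫| ≤ 2 * (regBound H ν y₀ * ‖h‖) := by
    intro h
    have hcl : IsClosed {h : H | |⟪v, h⟫| ≤ 2 * (regBound H ν y₀ * ‖h‖)} :=
      isClosed_le (by fun_prop) (by fun_prop)
    have hsub : D ⊆ {h : H | |⟪v, h⟫| ≤ 2 * (regBound H ν y₀ * ‖h‖)} := fun h hh => by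
      have := hz h hh
      rw [← ContinuousLinearMap.adjoint_inner_left] at this
      simpa using this
    exact hcl.closure_subset_iff.2 hsub (hDd h)
  have h3 := h2 v
  rw [real_inner_self_eq_norm_sq, abs_of_nonneg (sq_nonneg _)] at h3
  by_contra! hlt
  have hpos : 0 < ‖v‖ := lt_of_le_of_lt (by positivity) hlt
  nlinarith

theorem ae_norm_resid_le (hdist : Measurable fun q : 𝓨 × 𝓨 => dist q.1 q.2)
    (hd2 : Integrable (fun q : (E × 𝓨) × (E × 𝓨) => dist q.1.2 q.2.2 ^ 2) (ν.prod ν))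
    (hfeat : StronglyMeasurable fun x : E => feat H x)
    (hφ : MemLp (fun z => feat H z.1) 2 ν) {y₀ : 𝓨}
    (hρ : MemLp (fun z : E × 𝓨 => dist y₀ z.2) 2 ν) {S : H →L[ℝ] H}
    (hS : wireOp H ν = covOp H ν ∘L S) {F : Type*} [mF : MeasurableSpace F] {f : E → F}
    (hf : Measurable f)
    (hsuff : CondIndepGiven ν (mF.comap fun z : E × 𝓨 => f z.1) Prod.snd Prod.fst)
    (hdense : DenseModConst H (mF.comap f) (ν.map Prod.fst)) :
    ∀ᵐ z ∂ν, ‖resid ν y₀ S z‖ ≤ 3 * (regBound H ν y₀ : ℝ) := by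
  filter_upwards [ae_norm_adjoint_cfeat_le hdist hd2 hfeat hφ hρ hS hf hsuff hdense] with z hz
  refine (norm_sub_le _ _).trans ?_
  linarith [norm_regVec_le hdist hφ hρ z.2]

end Boundedness

/-! ### The L₂ norm of centered functions. -/

section CenteredNorm

variable {E 𝓨 : Type*} [MeasurableSpace E] [MetricSpace 𝓨] [MeasurableSpace 𝓨]
variable {H : Type*} [NormedAddCommGroup H] [InnerProductSpace ℝ H] [CompleteSpace H]
  [RKHS ℝ H E ℝ]
variable {ν : Measure (E × 𝓨)} [IsProbabilityMeasure ν]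

/-- The `L₂` distance of centered functions is the seminorm of the covariance operator. -/
theorem eLpNorm_centered_sub (hfeat : StronglyMeasurable fun x : E => feat H x)
    (hφ : MemLp (fun z => feat H z.1) 2 ν) (u v : H) :
    eLpNorm (centered (ν.map Prod.fst) u - centered (ν.map Prod.fst) v) 2 (ν.map Prod.fst) =
      ‖opSqrt (covOp H ν) (u - v)‖ₑ := by
  have hsm : ∀ h : H, StronglyMeasurable fun x : E => h x := fun h => by
    simp_rw [← inner_feat]
    exact hfeat.inner stronglyMeasurable_const
  have hmean : ∀ h : H, ∫ x, h x ∂(ν.map Prod.fst) = ⟪meanEmb H ν, h⟫ := fun h => by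
    rw [integral_map measurable_fst.aemeasurable (hsm h).aestronglyMeasurable, meanEmb,
      ← integral_inner_left (hφ.integrable one_le_two)]
    simp_rw [inner_feat]
  have hcs : StronglyMeasurable (centered (ν.map Prod.fst) u - centered (ν.map Prod.fst) v) :=
    ((hsm u).sub stronglyMeasurable_const).sub ((hsm v).sub stronglyMeasurable_const)
  rw [eLpNorm_map_measure hcs.aestronglyMeasurable measurable_fst.aemeasurable]
  have heq : (centered (ν.map Prod.fst) u - centered (ν.map Prod.fst) v) ∘ Prod.fst =
      fun z : E × 𝓨 => ⟪cfeat H ν z, u - v⟫ := by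
    funext z
    simp only [Function.comp_apply, Pi.sub_apply, centered, hmean, inner_sub_right, inner_cfeat]
  rw [heq]
  have h1 := eLpNorm_two_sq (w := fun z : E × 𝓨 => ⟪cfeat H ν z, u - v⟫)
    ((memLp_cfeat hφ).inner_const (u - v))
  have h2 : ∫ z, ⟪cfeat H ν z, u - v⟫ ^ 2 ∂ν = ‖opSqrt (covOp H ν) (u - v)‖ ^ 2 := by
    rw [norm_opSqrt_apply_sq (isPositive_covOp hφ), inner_covOp hφ]
    simp_rw [sq]
  rw [h2, ← enorm_sq_eq_ofReal] at h1
  exact (ENNReal.pow_right_strictMono two_ne_zero).injective h1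

end CenteredNorm

/-! ### Second moments of sums of orthogonal vectors. -/

section Orthogonality

variable {H : Type*} [NormedAddCommGroup H] [InnerProductSpace ℝ H] [CompleteSpace H]

theorem lintegral_enorm_sq {α : Type*} [MeasurableSpace α] {μ : Measure α} {w : α → H}
    (hw : MemLp w 2 μ) : ∫⁻ x, ‖w x‖ₑ ^ 2 ∂μ = ENNReal.ofReal (∫ x, ‖w x‖ ^ 2 ∂μ) := by
  rw [ofReal_integral_eq_lintegral_ofReal
    ((memLp_two_iff_integrable_sq_norm hw.aestronglyMeasurable).1 hw)
    (Eventually.of_forall fun _ => sq_nonneg _)]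
  exact lintegral_congr fun x => enorm_sq_eq_ofReal _

theorem integrable_inner {α : Type*} [MeasurableSpace α] {μ : Measure α} {u v : α → H}
    (hu : MemLp u 2 μ) (hv : MemLp v 2 μ) : Integrable (fun x => ⟪u x, v x⟫) μ := by
  refine (hu.norm.integrable_mul hv.norm).mono'
    (hu.aestronglyMeasurable.inner hv.aestronglyMeasurable) (Eventually.of_forall fun x => ?_)
  exact norm_inner_le_norm _ _

/-- Pythagoras in `L₂`. -/
theorem integral_norm_sq_sum {α J : Type*} [MeasurableSpace α] {μ : Measure α} {U : J → α → H}
    (s : Finset J) (hU : ∀ j ∈ s, MemLp (U j) 2 μ)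
    (h0 : ∀ j ∈ s, ∀ k ∈ s, j ≠ k → ∫ x, ⟪U j x, U k x⟫ ∂μ = 0) :
    ∫ x, ‖∑ j ∈ s, U j x‖ ^ 2 ∂μ = ∑ j ∈ s, ∫ x, ‖U j x‖ ^ 2 ∂μ := by
  have e : ∀ x, ‖∑ j ∈ s, U j x‖ ^ 2 = ∑ j ∈ s, ∑ k ∈ s, ⟪U j x, U k x⟫ := fun x => by
    rw [← real_inner_self_eq_norm_sq, sum_inner]
    simp_rw [inner_sum]
  simp_rw [e]
  rw [integral_finsetSum _ fun j hj => integrable_finsetSum _ fun k hk =>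
    integrable_inner (hU j hj) (hU k hk)]
  refine Finset.sum_congr rfl fun j hj => ?_
  rw [integral_finsetSum _ fun k hk => integrable_inner (hU j hj) (hU k hk),
    Finset.sum_eq_single_of_mem j hj fun k hk hkj => h0 j hj k hk hkj.symm]
  simp_rw [real_inner_self_eq_norm_sq]

end Orthogonality

section Sample

variable {H : Type*} [NormedAddCommGroup H] [InnerProductSpace ℝ H] [CompleteSpace H]
variable {𝒵 Ω : Type*} [MeasurableSpace 𝒵] [MeasurableSpace Ω]
variable {ν : Measure 𝒵} [IsProbabilityMeasure ν] {P : Measure Ω} [IsProbabilityMeasure P]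
variable {Z : ℕ → Ω → 𝒵}

theorem map_pair (hZm : ∀ i, Measurable (Z i)) (hZi : iIndepFun Z P) (hZl : ∀ i, P.map (Z i) = ν)
    {i j : ℕ} (hij : i ≠ j) : P.map (fun ω => (Z i ω, Z j ω)) = ν.prod ν := by
  rw [(indepFun_iff_map_prod_eq_prod_map_map (hZm i).aemeasurable (hZm j).aemeasurable).1
    (hZi.indepFun hij), hZl, hZl]

theorem map_triple (hZm : ∀ i, Measurable (Z i)) (hZi : iIndepFun Z P)
    (hZl : ∀ i, P.map (Z i) = ν) {i j k : ℕ} (hij : i ≠ j) (hik : i ≠ k) (hjk : j ≠ k) :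
    P.map (fun ω => (Z i ω, (Z j ω, Z k ω))) = ν.prod (ν.prod ν) := by
  have h := (hZi.indepFun_prodMk hZm j k i hij.symm hik.symm).symm
  rw [(indepFun_iff_map_prod_eq_prod_map_map (hZm i).aemeasurable
    ((hZm j).prodMk (hZm k)).aemeasurable).1 h, hZl, map_pair hZm hZi hZl hjk]

/-- Given Zᵢ, the variables Zⱼ and Zₖ are independent and W(Zᵢ, ·) has mean zero. -/
theorem integral_inner_eq_zero (hZm : ∀ i, Measurable (Z i)) (hZi : iIndepFun Z P)
    (hZl : ∀ i, P.map (Z i) = ν) {W : 𝒵 × 𝒵 → H} (hW : StronglyMeasurable W)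
    (hW2 : MemLp W 2 (ν.prod ν)) (hW0 : ∀ᵐ z ∂ν, ∫ z', W (z, z') ∂ν = 0) {i j k : ℕ} (hij : i ≠ j)
    (hik : i ≠ k) (hjk : j ≠ k) :
    ∫ ω, ⟪W (Z i ω, Z j ω), W (Z i ω, Z k ω)⟫ ∂P = 0 := by
  have hU : ∀ l, i ≠ l → MemLp (fun ω => W (Z i ω, Z l ω)) 2 P := fun l hl => by
    refine MemLp.comp_of_map (g := W) (f := fun ω => (Z i ω, Z l ω)) ?_
      ((hZm i).prodMk (hZm l)).aemeasurable
    rwa [map_pair hZm hZi hZl hl]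
  have hm := map_triple hZm hZi hZl hij hik hjk
  have hmeas : Measurable fun ω => (Z i ω, (Z j ω, Z k ω)) :=
    (hZm i).prodMk ((hZm j).prodMk (hZm k))
  set F : 𝒵 × 𝒵 × 𝒵 → ℝ := fun q => ⟪W (q.1, q.2.1), W (q.1, q.2.2)⟫ with hF
  have hFm : StronglyMeasurable F :=
    (hW.comp_measurable (measurable_fst.prodMk measurable_snd.fst)).inner
      (hW.comp_measurable (measurable_fst.prodMk measurable_snd.snd))
  have hFi : Integrable F (ν.prod (ν.prod ν)) := by
    rw [← hm, integrable_map_measure hFm.aestronglyMeasurable hmeas.aemeasurable]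
    exact integrable_inner (hU j hij) (hU k hik)
  have h1 : ∫ ω, ⟪W (Z i ω, Z j ω), W (Z i ω, Z k ω)⟫ ∂P = ∫ q, F q ∂(ν.prod (ν.prod ν)) := by
    rw [← hm, integral_map hmeas.aemeasurable hFm.aestronglyMeasurable]
  rw [h1, integral_prod F hFi]
  refine integral_eq_zero_of_ae ?_
  filter_upwards [hFi.prod_right_ae, (hW2.integrable one_le_two).prod_right_ae, hW0] with z h2 h3 h4
  rw [integral_prod (fun y => F (z, y)) h2]
  refine integral_eq_zero_of_ae (Eventually.of_forall fun z' => ?_)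
  simp only [hF, Pi.zero_apply]
  rw [integral_inner h3, h4, inner_zero_right]

theorem lintegral_enorm_sum_sq (hZm : ∀ i, Measurable (Z i)) (hZi : iIndepFun Z P)
    (hZl : ∀ i, P.map (Z i) = ν) {W : 𝒵 × 𝒵 → H} (hW : StronglyMeasurable W)
    (hW2 : MemLp W 2 (ν.prod ν)) (hW0 : ∀ᵐ z ∂ν, ∫ z', W (z, z') ∂ν = 0) {i : ℕ} {s : Finset ℕ}
    (hi : i ∉ s) :
    ∫⁻ ω, ‖∑ j ∈ s, W (Z i ω, Z j ω)‖ₑ ^ 2 ∂P = s.card * ∫⁻ q, ‖W q‖ₑ ^ 2 ∂(ν.prod ν) := by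
  have hne : ∀ l ∈ s, i ≠ l := fun l hl h => hi (h ▸ hl)
  have hU : ∀ l ∈ s, MemLp (fun ω => W (Z i ω, Z l ω)) 2 P := fun l hl => by
    refine MemLp.comp_of_map (g := W) (f := fun ω => (Z i ω, Z l ω)) ?_
      ((hZm i).prodMk (hZm l)).aemeasurable
    rwa [map_pair hZm hZi hZl (hne l hl)]
  have h1 : MemLp (fun ω => ∑ j ∈ s, W (Z i ω, Z j ω)) 2 P := memLp_finsetSum s hU
  have h2 : ∀ l ∈ s, ∫ ω, ‖W (Z i ω, Z l ω)‖ ^ 2 ∂P = ∫ q, ‖W q‖ ^ 2 ∂(ν.prod ν) := fun l hl => by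
    have hm : AEStronglyMeasurable (fun q => ‖W q‖ ^ 2) (P.map fun ω => (Z i ω, Z l ω)) :=
      (hW.norm.pow 2).aestronglyMeasurable
    rw [← map_pair hZm hZi hZl (hne l hl), integral_map ((hZm i).prodMk (hZm l)).aemeasurable hm]
  rw [lintegral_enorm_sq h1, integral_norm_sq_sum (U := fun j ω => W (Z i ω, Z j ω)) s hU
    fun j hj k hk hjk => integral_inner_eq_zero hZm hZi hZl hW hW2 hW0 (hne j hj) (hne k hk) hjk,
    Finset.sum_congr rfl h2, Finset.sum_const, nsmul_eq_mul, ENNReal.ofReal_mul (by positivity),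
    ENNReal.ofReal_natCast, lintegral_enorm_sq hW2]

/-- The second moment of a mean of centered i.i.d. vectors. -/
theorem lintegral_enorm_mean_sq_le (hZm : ∀ i, Measurable (Z i)) (hZi : iIndepFun Z P)
    (hZl : ∀ i, P.map (Z i) = ν) {g : 𝒵 → H} (hg : StronglyMeasurable g) (hg2 : MemLp g 2 ν)
    (hg0 : ∫ z, g z ∂ν = 0) (n : ℕ) :
    ∫⁻ ω, ‖(n : ℝ)⁻¹ • ∑ i ∈ Finset.range n, g (Z i ω)‖ₑ ^ 2 ∂P ≤
      (n : ℝ≥0∞)⁻¹ * ∫⁻ z, ‖g z‖ₑ ^ 2 ∂ν := by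
  rcases Nat.eq_zero_or_pos n with rfl | hn
  · simp
  -- W ignores its first argument; the index n is a dummy outside the range of summation.
  have h := lintegral_enorm_sum_sq hZm hZi hZl (W := fun q => g q.2) (i := n)
    (s := Finset.range n) (hg.comp_measurable measurable_snd) (hg2.comp_snd ν)
    (Eventually.of_forall fun _ => hg0) Finset.notMem_range_self
  have hm : AEMeasurable (fun q : 𝒵 × 𝒵 => ‖g q.2‖ₑ ^ 2) (ν.prod ν) :=
    ((hg.comp_measurable measurable_snd).enorm.pow_const 2).aemeasurable
  rw [Finset.card_range, lintegral_prod _ hm] at h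
  simp only [lintegral_const, measure_univ, mul_one] at h
  simp_rw [enorm_smul, mul_pow]
  rw [lintegral_const_mul' _ _ (by finiteness), h]
  have e : ‖(n : ℝ)⁻¹‖ₑ = (n : ℝ≥0∞)⁻¹ := by
    rw [enorm_inv (by positivity)]; simp
  rw [e, ← mul_assoc, sq, mul_assoc (n : ℝ≥0∞)⁻¹, ENNReal.inv_mul_cancel (by positivity) (by simp),
    mul_one]

end Sample

section RankOneSums

variable {H : Type*} [NormedAddCommGroup H] [InnerProductSpace ℝ H] [CompleteSpace H]

theorem rankOne_comp (x y : H) (S : H →L[ℝ] H) :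
    rankOne ℝ x y ∘L S = rankOne ℝ x (ContinuousLinearMap.adjoint S y) := by
  ext h
  simp [ContinuousLinearMap.adjoint_inner_left]

theorem comp_rankOne (x y : H) (S : H →L[ℝ] H) :
    S ∘L rankOne ℝ x y = rankOne ℝ (S x) y := by
  ext h
  simp

theorem sum_rankOne_left {J : Type*} (s : Finset J) (a : J → H) (y : H) :
    ∑ i ∈ s, rankOne ℝ (a i) y = rankOne ℝ (∑ i ∈ s, a i) y := by
  ext h
  simp

theorem sum_rankOne_right {J : Type*} (s : Finset J) (x : H) (a : J → H) :
    ∑ i ∈ s, rankOne ℝ x (a i) = rankOne ℝ x (∑ i ∈ s, a i) := by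
  ext h
  simp

end RankOneSums

/-! ### Algebraic decomposition of the sample operators. -/

section Decomposition

variable {E 𝓨 : Type*} [MeasurableSpace E] [MetricSpace 𝓨] [MeasurableSpace 𝓨]
variable {H : Type*} [NormedAddCommGroup H] [InnerProductSpace ℝ H] [CompleteSpace H]
  [RKHS ℝ H E ℝ]

variable (H) in
/-- The feature of the `i`-th observation, centered at the sample mean. -/
def featHat (n : ℕ) (z : ℕ → E × 𝓨) (i : ℕ) : H := feat H (z i).1 - meanHat H n z

variable (H) in
/-- The sample version of `regVec` at the `i`-th observation. -/
def regHat (y₀ : 𝓨) (n : ℕ) (z : ℕ → E × 𝓨) (i : ℕ) : H :=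
  -(((n : ℝ) - 1)⁻¹ • ∑ j ∈ Finset.range n, cdist y₀ (z i).2 (z j).2 • featHat H n z j)

variable (H) in
/-- The mean of the centered features. -/
def cfeatMean (ν : Measure (E × 𝓨)) (n : ℕ) (z : ℕ → E × 𝓨) : H :=
  (n : ℝ)⁻¹ • ∑ i ∈ Finset.range n, cfeat H ν (z i)

/-- The noise term of the sample operator. -/
def noiseOp (ν : Measure (E × 𝓨)) (y₀ : 𝓨) (S : H →L[ℝ] H) (n : ℕ) (z : ℕ → E × 𝓨) : H →L[ℝ] H :=
  (n : ℝ)⁻¹ • ∑ i ∈ Finset.range n, rankOne ℝ (featHat H n z i) (resid ν y₀ S (z i))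

variable (H) in
/-- The error term of the sample operator. -/
def errorOp (ν : Measure (E × 𝓨)) (y₀ : 𝓨) (n : ℕ) (z : ℕ → E × 𝓨) : H →L[ℝ] H :=
  (n : ℝ)⁻¹ • ∑ i ∈ Finset.range n,
    rankOne ℝ (featHat H n z i) (regHat H y₀ n z i - regVec H ν y₀ (z i).2)

variable {ν : Measure (E × 𝓨)} {n : ℕ} {z : ℕ → E × 𝓨} {y₀ : 𝓨}

theorem sum_featHat : ∑ i ∈ Finset.range n, featHat H n z i = 0 := by
  rcases Nat.eq_zero_or_pos n with rfl | hn
  · simp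
  have h : (n : ℝ) ≠ 0 := by positivity
  simp only [featHat, Finset.sum_sub_distrib, Finset.sum_const, Finset.card_range, meanHat]
  rw [← Nat.cast_smul_eq_nsmul ℝ, smul_inv_smul₀ h, sub_self]

theorem featHat_eq (hn : n ≠ 0) (i : ℕ) : featHat H n z i = cfeat H ν (z i) - cfeatMean H ν n z := by
  have h : (n : ℝ) ≠ 0 := by positivity
  simp only [featHat, cfeat, cfeatMean, meanHat, Finset.sum_sub_distrib, Finset.sum_const,
    Finset.card_range, smul_sub]
  rw [← Nat.cast_smul_eq_nsmul ℝ, inv_smul_smul₀ h]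
  abel

theorem covHat_eq : covHat H n z =
    (n : ℝ)⁻¹ • ∑ i ∈ Finset.range n, rankOne ℝ (featHat H n z i) (featHat H n z i) := rfl

theorem inner_covHat (h k : H) : ⟪covHat H n z h, k⟫ =
    (n : ℝ)⁻¹ * ∑ i ∈ Finset.range n, ⟪featHat H n z i, h⟫ * ⟪featHat H n z i, k⟫ := by
  rw [covHat_eq, smul_apply, sum_apply, real_inner_smul_left, sum_inner]
  simp only [inner_rankOne_apply]

theorem isPositive_covHat : (covHat H n z).IsPositive := by
  refine isPositive_of_inner_nonneg ?_ fun h => ?_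
  · rw [ContinuousLinearMap.isSelfAdjoint_iff_isSymmetric]
    intro h k
    change ⟪covHat H n z h, k⟫ = ⟪h, covHat H n z k⟫
    rw [real_inner_comm _ h, inner_covHat, inner_covHat]
    simp_rw [mul_comm]
  · rw [inner_covHat]
    exact mul_nonneg (by positivity) (Finset.sum_nonneg fun i _ => mul_self_nonneg _)

/-- As ∑ η̂ᵢ = 0, the second factor may be centered at the population mean; this makes Σ̂S combine
exactly with the residuals. -/
theorem covHat_eq_left (hn : n ≠ 0) : covHat H n z =
    (n : ℝ)⁻¹ • ∑ i ∈ Finset.range n, rankOne ℝ (featHat H n z i) (cfeat H ν (z i)) := by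
  rw [covHat_eq]
  congr 1
  rw [← sub_eq_zero, ← Finset.sum_sub_distrib]
  have : ∀ i, rankOne ℝ (featHat H n z i) (featHat H n z i) -
      rankOne ℝ (featHat H n z i) (cfeat H ν (z i)) =
      rankOne ℝ (featHat H n z i) (-cfeatMean H ν n z) := fun i => by
    rw [← map_sub, featHat_eq (ν := ν) hn]; simp
  simp_rw [this]
  rw [sum_rankOne_left, sum_featHat]; simp

theorem covHat_eq_sub (ν : Measure (E × 𝓨)) (hn : n ≠ 0) : covHat H n z =
    (n : ℝ)⁻¹ • ∑ i ∈ Finset.range n, rankOne ℝ (cfeat H ν (z i)) (cfeat H ν (z i)) -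
      rankOne ℝ (cfeatMean H ν n z) (cfeatMean H ν n z) := by
  have e2 : ∀ i, rankOne ℝ (featHat H n z i) (cfeat H ν (z i)) =
      rankOne ℝ (cfeat H ν (z i)) (cfeat H ν (z i)) -
        rankOne ℝ (cfeatMean H ν n z) (cfeat H ν (z i)) := fun i => by
    rw [featHat_eq (ν := ν) hn, map_sub, sub_apply]
  rw [covHat_eq_left (ν := ν) hn]
  simp_rw [e2]
  rw [Finset.sum_sub_distrib, sum_rankOne_right, smul_sub]
  congr 1
  rw [← map_smul]; rfl

/-- Diagonal terms may be added because d(y, y) = 0, and the centering at y₀ drops out because ∑ η̂ᵢ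
= 0. -/
theorem wireHat_eq (y₀ : 𝓨) : wireHat H n z =
    (n : ℝ)⁻¹ • ∑ i ∈ Finset.range n, rankOne ℝ (featHat H n z i) (regHat H y₀ n z i) := by
  have e1 : ∀ i ∈ Finset.range n, ∑ j ∈ (Finset.range n).erase i, dist (z i).2 (z j).2 •
      rankOne ℝ (featHat H n z i) (featHat H n z j) =
      rankOne ℝ (featHat H n z i)
        (∑ j ∈ Finset.range n, dist (z i).2 (z j).2 • featHat H n z j) := fun i hi => by
    rw [← sum_rankOne_right, ← Finset.sum_erase_add _ _ hi]
    simp [map_smul]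
  have e2 : ∑ i ∈ Finset.range n, rankOne ℝ (featHat H n z i)
      (∑ j ∈ Finset.range n, dist y₀ (z j).2 • featHat H n z j) = 0 := by
    rw [sum_rankOne_left, sum_featHat]; simp
  have e3 : wireHat H n z = -(((n : ℝ) * ((n : ℝ) - 1))⁻¹ • ∑ i ∈ Finset.range n,
      ∑ j ∈ (Finset.range n).erase i, dist (z i).2 (z j).2 •
        rankOne ℝ (featHat H n z i) (featHat H n z j)) := rfl
  rw [e3, Finset.sum_congr rfl e1, ← sub_zero (∑ i ∈ _, _), ← e2, ← Finset.sum_sub_distrib, mul_inv,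
    mul_smul, ← smul_neg, Finset.smul_sum, ← Finset.sum_neg_distrib]
  congr 1
  refine Finset.sum_congr rfl fun i _ => ?_
  simp only [regHat, cdist, sub_smul, Finset.sum_sub_distrib, map_neg, map_smul, map_sub]

theorem wireHat_eq_add (hn : n ≠ 0) (S : H →L[ℝ] H) : wireHat H n z =
    covHat H n z ∘L S + noiseOp ν y₀ S n z + errorOp H ν y₀ n z := by
  have e1 : covHat H n z ∘L S = (n : ℝ)⁻¹ • ∑ i ∈ Finset.range n,
      rankOne ℝ (featHat H n z i) (ContinuousLinearMap.adjoint S (cfeat H ν (z i))) := by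
    rw [covHat_eq_left (ν := ν) hn, ContinuousLinearMap.smul_comp, ContinuousLinearMap.finsetSum_comp]
    simp_rw [rankOne_comp]
  rw [wireHat_eq y₀, e1, noiseOp, errorOp, ← smul_add, ← smul_add, ← Finset.sum_add_distrib,
    ← Finset.sum_add_distrib]
  congr 1
  refine Finset.sum_congr rfl fun i _ => ?_
  rw [← map_add, ← map_add, resid]
  congr 1
  abel

theorem isCompactOperator_wireHat : IsCompactOperator (wireHat H n z) := by
  cases isEmpty_or_nonempty 𝓨 with
  | inl h => exact (IsEmpty.false (z 0).2).elim
  | inr h =>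
    rw [wireHat_eq h.some]
    exact (isCompactOperator_sum _ fun i _ => isCompactOperator_rankOne _ _).smul _

/-- Bessel's inequality for the standardized centered features. -/
theorem sum_inner_sq_le {ε : ℝ} (hε : 0 < ε) (x : H) :
    ∑ i ∈ Finset.range n, ⟪invSqrtHat H n ε z (featHat H n z i), x⟫ ^ 2 ≤ n * ‖x‖ ^ 2 := by
  rcases Nat.eq_zero_or_pos n with rfl | hn
  · simp
  obtain ⟨h1, h2, h3, h4, h5, -⟩ := inverse_opSqrt_add (isPositive_covHat (H := H) (n := n) (z := z)) hε
  set B := opSqrt (covHat H n z + ε • ContinuousLinearMap.id ℝ H) with hB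
  have hK : invSqrtHat H n ε z = Ring.inverse B := rfl
  rw [hK]
  set K := Ring.inverse B with hKdef
  set y := K x with hy
  have hBy : B y = x := by
    have := congrArg (fun T : H →L[ℝ] H => T x) h4
    simpa using this
  have hKs : ∀ u v : H, ⟪K u, v⟫ = ⟪u, K v⟫ := fun u v => by
    have : ContinuousLinearMap.adjoint K = K := h5
    rw [← ContinuousLinearMap.adjoint_inner_right, this]
  -- With y = Kx, ‖x‖² = ‖By‖² = ⟨Σ̂y, y⟩ + ε‖y‖².
  have hcov : ⟪covHat H n z y, y⟫ ≤ ‖x‖ ^ 2 := by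
    have e : ⟪B y, B y⟫ = ⟪covHat H n z y, y⟫ + ε * ‖y‖ ^ 2 := by
      rw [inner_map_comm h1.isSelfAdjoint, ← ContinuousLinearMap.comp_apply, h2]
      simp [inner_add_right, real_inner_smul_right, real_inner_comm]
    rw [hBy, real_inner_self_eq_norm_sq] at e
    nlinarith [mul_nonneg hε.le (sq_nonneg ‖y‖)]
  rw [inner_covHat] at hcov
  simp_rw [hKs]
  have hn' : (0 : ℝ) < n := by positivity
  rw [inv_mul_le_iff₀ hn'] at hcov
  simpa only [sq] using hcov

/-- The inverse root is absorbed by the sample features through Bessel's inequality, so no power of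
ε is lost. -/
theorem hsSq_invSqrtHat_comp_le {ι : Type*} (b : HilbertBasis ι ℝ H) {ε : ℝ} (hε : 0 < ε)
    (c : ℕ → H) :
    hsSq b (invSqrtHat H n ε z ∘L
      ((n : ℝ)⁻¹ • ∑ i ∈ Finset.range n, rankOne ℝ (featHat H n z i) (c i))) ≤
      ENNReal.ofReal ((n : ℝ)⁻¹ * ∑ i ∈ Finset.range n, ‖c i‖ ^ 2) := by
  rw [ContinuousLinearMap.comp_smul, ContinuousLinearMap.comp_finsetSum, Finset.smul_sum]
  have e : ∀ i, (n : ℝ)⁻¹ • (invSqrtHat H n ε z ∘L rankOne ℝ (featHat H n z i) (c i)) =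
      rankOne ℝ ((n : ℝ)⁻¹ • invSqrtHat H n ε z (featHat H n z i)) (c i) := fun i => by
    rw [comp_rankOne, map_smul, smul_apply]
  simp_rw [e]
  refine hsSq_sum_rankOne_le b _ _ _ (by positivity) fun x => ?_
  simp_rw [real_inner_smul_left, mul_pow]
  rw [← Finset.mul_sum]
  refine (mul_le_mul_of_nonneg_left (sum_inner_sq_le hε x) (by positivity)).trans_eq ?_
  rcases Nat.eq_zero_or_pos n with rfl | hn
  · simp
  have hn' : (n : ℝ) ≠ 0 := by positivity
  field_simp

variable (H) in
/-- The centered summand of the error term. -/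
def crossVec (ν : Measure (E × 𝓨)) (y₀ : 𝓨) (q : (E × 𝓨) × (E × 𝓨)) : H :=
  cdist y₀ q.1.2 q.2.2 • cfeat H ν q.2 + regVec H ν y₀ q.1.2

theorem regHat_sub_regVec (hn : 2 ≤ n) {i : ℕ} (hi : i ∈ Finset.range n) :
    regHat H y₀ n z i - regVec H ν y₀ (z i).2 = ((n : ℝ) - 1)⁻¹ •
      (dist y₀ (z i).2 • cfeat H ν (z i) +
        (∑ j ∈ Finset.range n, cdist y₀ (z i).2 (z j).2) • cfeatMean H ν n z -
        ∑ j ∈ (Finset.range n).erase i, crossVec H ν y₀ (z i, z j)) := by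
  have hn1 : (n : ℝ) - 1 ≠ 0 := by
    have : (2 : ℝ) ≤ n := by exact_mod_cast hn
    linarith
  -- Removing j = i leaves n − 1 copies of `regVec`, matching the normalization, and returns d(y₀,
  -- yᵢ)ηᵢ, since d(yᵢ, yᵢ) − d(y₀, yᵢ) = −d(y₀, yᵢ).
  have e1 : ∑ j ∈ (Finset.range n).erase i, crossVec H ν y₀ (z i, z j) =
      ∑ j ∈ Finset.range n, cdist y₀ (z i).2 (z j).2 • cfeat H ν (z j) +
        dist y₀ (z i).2 • cfeat H ν (z i) + ((n : ℝ) - 1) • regVec H ν y₀ (z i).2 := by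
    have h1 := Finset.sum_erase_add (Finset.range n) (fun j => crossVec H ν y₀ (z i, z j)) hi
    rw [← eq_sub_iff_add_eq] at h1
    rw [h1]
    simp only [crossVec, Finset.sum_add_distrib, Finset.sum_const, Finset.card_range, sub_smul,
      one_smul, ← Nat.cast_smul_eq_nsmul ℝ]
    simp only [cdist, dist_self, zero_sub, neg_smul]
    abel
  rw [e1, regHat]
  simp_rw [featHat_eq (ν := ν) (show n ≠ 0 by omega), smul_sub, Finset.sum_sub_distrib,
    ← Finset.sum_smul]
  simp only [smul_add, smul_sub, inv_smul_smul₀ hn1]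
  abel

theorem norm_add_add_sq_le (a b c : H) :
    ‖a + b - c‖ ^ 2 ≤ 3 * (‖a‖ ^ 2 + ‖b‖ ^ 2 + ‖c‖ ^ 2) := by
  have h : ‖a + b - c‖ ≤ ‖a‖ + ‖b‖ + ‖c‖ :=
    (norm_sub_le _ _).trans (by gcongr; exact norm_add_le _ _)
  have h2 := pow_le_pow_left₀ (norm_nonneg _) h 2
  nlinarith [sq_nonneg (‖a‖ - ‖b‖), sq_nonneg (‖a‖ - ‖c‖), sq_nonneg (‖b‖ - ‖c‖)]

/-- The constant is 4 · 3: (n − 1)⁻² ≤ 4n⁻² for n ≥ 2, and three squares from `norm_add_add_sq_le`.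
Each of the three terms will be of order 1/n in probability. -/
theorem mean_norm_regHat_sub_sq_le (hn : 2 ≤ n) :
    (n : ℝ)⁻¹ * ∑ i ∈ Finset.range n, ‖regHat H y₀ n z i - regVec H ν y₀ (z i).2‖ ^ 2 ≤
      12 * ((n : ℝ)⁻¹ * (((n : ℝ)⁻¹ * ∑ i ∈ Finset.range n, dist y₀ (z i).2 ^ 2) *
          ((n : ℝ)⁻¹ * ∑ i ∈ Finset.range n, ‖cfeat H ν (z i)‖ ^ 2)) +
        ((n : ℝ)⁻¹ * ∑ i ∈ Finset.range n, dist y₀ (z i).2 ^ 2) * ‖cfeatMean H ν n z‖ ^ 2 +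
        ((n : ℝ) ^ 3)⁻¹ * ∑ i ∈ Finset.range n,
          ‖∑ j ∈ (Finset.range n).erase i, crossVec H ν y₀ (z i, z j)‖ ^ 2) := by
  have hn0 : (2 : ℝ) ≤ n := by exact_mod_cast hn
  have hn1 : (n : ℝ) ≠ 0 := by linarith
  set A := ∑ i ∈ Finset.range n, dist y₀ (z i).2 ^ 2
  set B := ∑ i ∈ Finset.range n, ‖cfeat H ν (z i)‖ ^ 2
  set m := ‖cfeatMean H ν n z‖ ^ 2
  set Q := ∑ i ∈ Finset.range n,
    ‖∑ j ∈ (Finset.range n).erase i, crossVec H ν y₀ (z i, z j)‖ ^ 2 with hQ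
  have hinv : (((n : ℝ) - 1)⁻¹) ^ 2 ≤ 4 * ((n : ℝ)⁻¹) ^ 2 := by
    have h1 : ((n : ℝ) - 1)⁻¹ ≤ 2 * (n : ℝ)⁻¹ := by
      rw [inv_le_comm₀ (by linarith) (by positivity), mul_inv, inv_inv]
      linarith
    have h2 : 0 ≤ ((n : ℝ) - 1)⁻¹ := inv_nonneg.2 (by linarith)
    calc (((n : ℝ) - 1)⁻¹) ^ 2 ≤ (2 * (n : ℝ)⁻¹) ^ 2 := by gcongr
      _ = _ := by ring
  have hterm : ∀ i ∈ Finset.range n, ‖regHat H y₀ n z i - regVec H ν y₀ (z i).2‖ ^ 2 ≤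
      4 * ((n : ℝ)⁻¹) ^ 2 * (3 * (dist y₀ (z i).2 ^ 2 * B + (n : ℝ) ^ 2 * dist y₀ (z i).2 ^ 2 * m +
        ‖∑ j ∈ (Finset.range n).erase i, crossVec H ν y₀ (z i, z j)‖ ^ 2)) := fun i hi => by
    rw [regHat_sub_regVec hn hi, norm_smul, mul_pow, Real.norm_eq_abs, sq_abs]
    refine mul_le_mul hinv ((norm_add_add_sq_le _ _ _).trans ?_) (sq_nonneg _) (by positivity)
    have hB : ‖cfeat H ν (z i)‖ ^ 2 ≤ B :=
      Finset.single_le_sum (f := fun i => ‖cfeat H ν (z i)‖ ^ 2) (fun _ _ => sq_nonneg _) hi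
    have hc : |∑ j ∈ Finset.range n, cdist y₀ (z i).2 (z j).2| ≤ n * dist y₀ (z i).2 := by
      refine (Finset.abs_sum_le_sum_abs _ _).trans ((Finset.sum_le_sum fun j _ =>
        abs_cdist_le y₀ (z i).2 (z j).2).trans_eq ?_)
      simp
    have hc2 : (∑ j ∈ Finset.range n, cdist y₀ (z i).2 (z j).2) ^ 2 ≤
        (n : ℝ) ^ 2 * dist y₀ (z i).2 ^ 2 := by
      rw [← sq_abs, ← mul_pow]
      gcongr
    rw [norm_smul, norm_smul, mul_pow, mul_pow, Real.norm_eq_abs, Real.norm_eq_abs, sq_abs, sq_abs]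
    gcongr
  have hsum : ∑ i ∈ Finset.range n, 4 * ((n : ℝ)⁻¹) ^ 2 * (3 * (dist y₀ (z i).2 ^ 2 * B +
      (n : ℝ) ^ 2 * dist y₀ (z i).2 ^ 2 * m +
        ‖∑ j ∈ (Finset.range n).erase i, crossVec H ν y₀ (z i, z j)‖ ^ 2)) =
      12 * ((n : ℝ)⁻¹) ^ 2 * (A * B + (n : ℝ) ^ 2 * A * m + Q) := by
    rw [← Finset.mul_sum, ← Finset.mul_sum, Finset.sum_add_distrib, Finset.sum_add_distrib,
      ← Finset.sum_mul, ← Finset.sum_mul, ← Finset.mul_sum, ← hQ]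
    ring
  refine (mul_le_mul_of_nonneg_left ((Finset.sum_le_sum hterm).trans_eq hsum)
    (by positivity)).trans_eq ?_
  field_simp

end Decomposition

/-! ### Laws of large numbers and second-moment rates. -/

section Limits

variable {𝒵 Ω : Type*} [MeasurableSpace 𝒵] [MeasurableSpace Ω]
variable {ν : Measure 𝒵} [IsProbabilityMeasure ν] {P : Measure Ω} [IsProbabilityMeasure P]
variable {Z : ℕ → Ω → 𝒵}

/-- The law of large numbers in a Banach space. -/
theorem tendsto_inProb_mean {F : Type*} [NormedAddCommGroup F] [NormedSpace ℝ F] [CompleteSpace F]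
    (hZm : ∀ i, Measurable (Z i)) (hZi : iIndepFun Z P) (hZl : ∀ i, P.map (Z i) = ν) {g : 𝒵 → F}
    (hg : StronglyMeasurable g) (hgi : Integrable g ν) :
    Tendsto (fun q : ℕ × Ω => (q.1 : ℝ)⁻¹ • ∑ i ∈ Finset.range q.1, g (Z i q.2)) (inProb P)
      (𝓝 (∫ z, g z ∂ν)) := by
  borelize F
  have hmean : ∫ ω, g (Z 0 ω) ∂P = ∫ z, g z ∂ν := by
    rw [← hZl 0, integral_map (hZm 0).aemeasurable hg.aestronglyMeasurable]
  have hint : Integrable (g ∘ Z 0) P :=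
    (integrable_map_measure hg.aestronglyMeasurable (hZm 0).aemeasurable).1 (by rwa [hZl 0])
  have hind : Pairwise (Function.onFun (IndepFun · · P) fun i => g ∘ Z i) := fun i j hij =>
    (hZi.indepFun hij).comp hg.measurable hg.measurable
  have hid : ∀ i, IdentDistrib (g ∘ Z i) (g ∘ Z 0) P P := fun i =>
    (IdentDistrib.mk (hZm i).aemeasurable (hZm 0).aemeasurable
      ((hZl i).trans (hZl 0).symm)).comp hg.measurable
  have h := strong_law_ae (μ := P) (fun i => g ∘ Z i) hint hind hid
  simp only [Function.comp_apply] at h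
  rw [hmean] at h
  have hm : ∀ n : ℕ, AEStronglyMeasurable
      (fun ω => (n : ℝ)⁻¹ • ∑ i ∈ Finset.range n, g (Z i ω)) P := fun n =>
    ((Finset.stronglyMeasurable_fun_sum _ fun i _ =>
      hg.comp_measurable (hZm i)).const_smul _).aestronglyMeasurable
  have h1 := tendstoInMeasure_of_tendsto_ae (g := fun _ => ∫ z, g z ∂ν) hm h
  exact (tendstoInMeasure_iff_inProb
    (Z := fun (n : ℕ) ω => (n : ℝ)⁻¹ • ∑ i ∈ Finset.range n, g (Z i ω))).1 h1

/-- Scaled variables with second moments of order `1 / n`. -/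
theorem tendsto_inProb_mul_toReal {X : ℕ → Ω → ℝ≥0∞} (hX : ∀ n, AEMeasurable (X n) P) {C : ℝ≥0∞}
    (hC : C ≠ ⊤) (h : ∀ n, ∫⁻ ω, X n ω ∂P ≤ (n : ℝ≥0∞)⁻¹ * C) {r : ℕ → ℝ} (hr : ∀ n, 0 ≤ r n)
    (hr0 : Tendsto (fun n : ℕ => r n * (n : ℝ)⁻¹) atTop (𝓝 0)) :
    Tendsto (fun q : ℕ × Ω => r q.1 * (X q.1 q.2).toReal) (inProb P) (𝓝 0) := by
  have h1 : Tendsto (fun q : ℕ × Ω => ENNReal.ofReal (r q.1) * X q.1 q.2) (inProb P) (𝓝 0) := by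
    refine tendsto_inProb_of_lintegral (Z := fun n ω => ENNReal.ofReal (r n) * X n ω)
      (fun n => (hX n).const_mul _) ?_
    have h2 : Tendsto (fun n : ℕ => ENNReal.ofReal (r n * (n : ℝ)⁻¹) * C) atTop (𝓝 0) := by
      have := ENNReal.Tendsto.mul_const (ENNReal.tendsto_ofReal hr0) (Or.inr hC)
      simpa using this
    refine tendsto_of_tendsto_of_tendsto_of_le_of_le' tendsto_const_nhds h2
      (Eventually.of_forall fun _ => zero_le) ?_
    filter_upwards [eventually_gt_atTop 0] with n hn
    have hn' : (0 : ℝ) < n := by exact_mod_cast hn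
    rw [lintegral_const_mul' _ _ ENNReal.ofReal_ne_top, ENNReal.ofReal_mul (hr n),
      ENNReal.ofReal_inv_of_pos hn', ENNReal.ofReal_natCast, mul_assoc]
    gcongr
    exact h n
  have h2 := (ENNReal.tendsto_toReal ENNReal.zero_ne_top).comp h1
  refine h2.congr fun q => ?_
  simp only [Function.comp_apply, ENNReal.toReal_mul, ENNReal.toReal_ofReal (hr q.1)]

end Limits

section Sample

variable {E 𝓨 Ω : Type*} [MeasurableSpace E] [MetricSpace 𝓨] [MeasurableSpace 𝓨]
  [MeasurableSpace Ω]
variable {H : Type*} [NormedAddCommGroup H] [InnerProductSpace ℝ H] [CompleteSpace H]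
  [RKHS ℝ H E ℝ]
variable {ν : Measure (E × 𝓨)} [IsProbabilityMeasure ν] {P : Measure Ω} [IsProbabilityMeasure P]
variable {Z : ℕ → Ω → E × 𝓨}

theorem tendsto_cfeatMean (hZm : ∀ i, Measurable (Z i)) (hZi : iIndepFun Z P)
    (hZl : ∀ i, P.map (Z i) = ν) (hfeat : StronglyMeasurable fun x : E => feat H x)
    (hφ : MemLp (fun z => feat H z.1) 2 ν) :
    Tendsto (fun q : ℕ × Ω => cfeatMean H ν q.1 fun i => Z i q.2) (inProb P) (𝓝 0) := by
  have := tendsto_inProb_mean hZm hZi hZl (stronglyMeasurable_cfeat (ν := ν) hfeat)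
    ((memLp_cfeat hφ).integrable one_le_two)
  rwa [integral_cfeat hφ] at this

theorem tendsto_covHat (hZm : ∀ i, Measurable (Z i)) (hZi : iIndepFun Z P)
    (hZl : ∀ i, P.map (Z i) = ν) (hfeat : StronglyMeasurable fun x : E => feat H x)
    (hφ : MemLp (fun z => feat H z.1) 2 ν) :
    Tendsto (fun q : ℕ × Ω => covHat H q.1 fun i => Z i q.2) (inProb P) (𝓝 (covOp H ν)) := by
  have hη := memLp_cfeat hφ
  have hηm := stronglyMeasurable_cfeat (ν := ν) hfeat
  have h1 := tendsto_inProb_mean hZm hZi hZl (g := fun z => rankOne ℝ (cfeat H ν z) (cfeat H ν z))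
    (Continuous.comp_stronglyMeasurable (g := fun p : H × H => rankOne ℝ p.1 p.2)
      continuous_rankOne (hηm.prodMk hηm)) (integrable_rankOne hη hη)
  rw [← covOp_eq hφ] at h1
  have h0 := tendsto_cfeatMean hZm hZi hZl hfeat hφ
  have h2 := (continuous_rankOne.tendsto ((0 : H), (0 : H))).comp (h0.prodMk_nhds h0)
  have h3 := h1.sub h2
  simp only [map_zero, sub_zero] at h3
  refine h3.congr' ?_
  filter_upwards [(tendsto_fst_inProb P).eventually (eventually_ne_atTop 0)] with q hq
  exact (covHat_eq_sub ν hq).symm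

theorem lintegral_cfeatMean_le (hZm : ∀ i, Measurable (Z i)) (hZi : iIndepFun Z P)
    (hZl : ∀ i, P.map (Z i) = ν) (hfeat : StronglyMeasurable fun x : E => feat H x)
    (hφ : MemLp (fun z => feat H z.1) 2 ν) (n : ℕ) :
    ∫⁻ ω, ‖cfeatMean H ν n fun i => Z i ω‖ₑ ^ 2 ∂P ≤
      (n : ℝ≥0∞)⁻¹ * ∫⁻ z, ‖cfeat H ν z‖ₑ ^ 2 ∂ν :=
  lintegral_enorm_mean_sq_le hZm hZi hZl (stronglyMeasurable_cfeat hfeat) (memLp_cfeat hφ)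
    (integral_cfeat hφ) n

theorem tendsto_mul_norm_cfeatMean_sq (hZm : ∀ i, Measurable (Z i)) (hZi : iIndepFun Z P)
    (hZl : ∀ i, P.map (Z i) = ν) (hfeat : StronglyMeasurable fun x : E => feat H x)
    (hφ : MemLp (fun z => feat H z.1) 2 ν) {r : ℕ → ℝ} (hr : ∀ n, 0 ≤ r n)
    (hr0 : Tendsto (fun n : ℕ => r n * (n : ℝ)⁻¹) atTop (𝓝 0)) :
    Tendsto (fun q : ℕ × Ω => r q.1 * ‖cfeatMean H ν q.1 fun i => Z i q.2‖ ^ 2) (inProb P)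
      (𝓝 0) := by
  have hm : ∀ n, AEStronglyMeasurable (fun ω => cfeatMean H ν n fun i => Z i ω) P := fun n =>
    ((Finset.stronglyMeasurable_fun_sum _ fun i _ => (stronglyMeasurable_cfeat
      hfeat).comp_measurable (hZm i)).const_smul _).aestronglyMeasurable
  have h := tendsto_inProb_mul_toReal (X := fun n ω => ‖cfeatMean H ν n fun i => Z i ω‖ₑ ^ 2)
    (fun n => (hm n).enorm.pow_const 2) (lintegral_enorm_sq (memLp_cfeat hφ) ▸ ENNReal.ofReal_ne_top)
    (lintegral_cfeatMean_le hZm hZi hZl hfeat hφ) hr hr0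
  simpa using h

end Sample

/-! ### The noise term is o(ε). -/

section Noise

variable {E 𝓨 Ω : Type*} [MeasurableSpace E] [MetricSpace 𝓨] [MeasurableSpace 𝓨]
  [MeasurableSpace Ω]
variable {H : Type*} [NormedAddCommGroup H] [InnerProductSpace ℝ H] [CompleteSpace H]
  [RKHS ℝ H E ℝ]
variable {ν : Measure (E × 𝓨)} [IsProbabilityMeasure ν] {P : Measure Ω} [IsProbabilityMeasure P]
variable {Z : ℕ → Ω → E × 𝓨}

theorem stronglyMeasurable_resid (hdist : Measurable fun q : 𝓨 × 𝓨 => dist q.1 q.2)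
    (hfeat : StronglyMeasurable fun x : E => feat H x) (y₀ : 𝓨) (S : H →L[ℝ] H) :
    StronglyMeasurable (resid ν y₀ S) :=
  ((stronglyMeasurable_regVec hdist hfeat y₀).comp_measurable measurable_snd).sub
    ((ContinuousLinearMap.adjoint S).continuous.comp_stronglyMeasurable
      (stronglyMeasurable_cfeat hfeat))

theorem stronglyMeasurable_rankOne {α : Type*} [MeasurableSpace α] {a b : α → H}
    (ha : StronglyMeasurable a) (hb : StronglyMeasurable b) :
    StronglyMeasurable fun x => rankOne ℝ (a x) (b x) :=
  Continuous.comp_stronglyMeasurable (g := fun p : H × H => rankOne ℝ p.1 p.2)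
    (f := fun x => (a x, b x)) continuous_rankOne (ha.prodMk hb)

/-- The operator norm is bounded by the Hilbert–Schmidt norm and computed column by column: each
column averages i.i.d. centered vectors ⟨ζ, e⟩η, and Parseval sums ⟨ζ, e⟩² to ‖ζ‖² ≤ C². No fourth
moment of η is needed. -/
theorem lintegral_mean_rankOne_resid_le (hZm : ∀ i, Measurable (Z i)) (hZi : iIndepFun Z P)
    (hZl : ∀ i, P.map (Z i) = ν) (hdist : Measurable fun q : 𝓨 × 𝓨 => dist q.1 q.2)
    (hd2 : Integrable (fun q : (E × 𝓨) × (E × 𝓨) => dist q.1.2 q.2.2 ^ 2) (ν.prod ν))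
    (hfeat : StronglyMeasurable fun x : E => feat H x)
    (hφ : MemLp (fun z => feat H z.1) 2 ν) {y₀ : 𝓨}
    (hρ : MemLp (fun z : E × 𝓨 => dist y₀ z.2) 2 ν) {S : H →L[ℝ] H}
    (hS : wireOp H ν = covOp H ν ∘L S) {C : NNReal} (hζ : ∀ᵐ z ∂ν, ‖resid ν y₀ S z‖ ≤ C) (n : ℕ) :
    ∫⁻ ω, ‖(n : ℝ)⁻¹ • ∑ i ∈ Finset.range n,
        rankOne ℝ (cfeat H ν (Z i ω)) (resid ν y₀ S (Z i ω))‖ₑ ^ 2 ∂P ≤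
      (n : ℝ≥0∞)⁻¹ * (C ^ 2 * ∫⁻ z, ‖cfeat H ν z‖ₑ ^ 2 ∂ν) := by
  have := secondCountable_of_stronglyMeasurable_feat hfeat
  -- Countability of the basis is what allows exchanging sum and integral.
  have hcount := countable_of_hilbertBasis (someBasis H)
  have hηm := stronglyMeasurable_cfeat (ν := ν) hfeat
  have hζm := stronglyMeasurable_resid (ν := ν) hdist hfeat y₀ S
  have hη := memLp_cfeat hφ
  set g : H → E × 𝓨 → H := fun e z => ⟪resid ν y₀ S z, e⟫ • cfeat H ν z with hg
  have hgm : ∀ e, StronglyMeasurable (g e) := fun e =>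
    (hζm.inner stronglyMeasurable_const).smul hηm
  have hg2 : ∀ e, MemLp (g e) 2 ν := fun e => by
    refine hη.of_le_mul (c := C * ‖e‖) (hgm e).aestronglyMeasurable ?_
    filter_upwards [hζ] with z hz
    rw [hg, norm_smul]
    gcongr
    refine (norm_inner_le_norm _ _).trans ?_
    gcongr
  have hg0 : ∀ e, ∫ z, g e z ∂ν = 0 := fun e => by
    refine ext_inner_right ℝ fun k => ?_
    rw [← integral_inner_left ((hg2 e).integrable one_le_two), inner_zero_left]
    simp only [hg, real_inner_smul_left]
    exact integral_resid_smul hdist hd2 hfeat hφ hρ hS e k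
  have happ : ∀ e ω, ((n : ℝ)⁻¹ • ∑ i ∈ Finset.range n,
      rankOne ℝ (cfeat H ν (Z i ω)) (resid ν y₀ S (Z i ω))) e =
      (n : ℝ)⁻¹ • ∑ i ∈ Finset.range n, g e (Z i ω) := fun e ω => by
    simp only [smul_apply, sum_apply, rankOne_apply, hg]
  have hm : ∀ e, Measurable fun ω => ‖(n : ℝ)⁻¹ • ∑ i ∈ Finset.range n, g e (Z i ω)‖ₑ ^ 2 :=
    fun e => ((Finset.stronglyMeasurable_fun_sum _ fun i _ =>
      (hgm e).comp_measurable (hZm i)).const_smul _).enorm.pow_const 2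
  have hmg : ∀ e, Measurable fun z => ‖g e z‖ₑ ^ 2 := fun e => (hgm e).enorm.pow_const 2
  calc ∫⁻ ω, ‖(n : ℝ)⁻¹ • ∑ i ∈ Finset.range n,
        rankOne ℝ (cfeat H ν (Z i ω)) (resid ν y₀ S (Z i ω))‖ₑ ^ 2 ∂P
      ≤ ∫⁻ ω, ∑' e, ‖(n : ℝ)⁻¹ • ∑ i ∈ Finset.range n, g (someBasis H e) (Z i ω)‖ₑ ^ 2 ∂P := by
        refine lintegral_mono fun ω => (enorm_sq_le_hsSq (someBasis H) _).trans_eq ?_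
        rw [hsSq]
        simp_rw [happ]
    _ = ∑' e, ∫⁻ ω, ‖(n : ℝ)⁻¹ • ∑ i ∈ Finset.range n, g (someBasis H e) (Z i ω)‖ₑ ^ 2 ∂P :=
        lintegral_tsum fun e => (hm _).aemeasurable
    _ ≤ ∑' e, (n : ℝ≥0∞)⁻¹ * ∫⁻ z, ‖g (someBasis H e) z‖ₑ ^ 2 ∂ν :=
        ENNReal.tsum_le_tsum fun e =>
          lintegral_enorm_mean_sq_le hZm hZi hZl (hgm _) (hg2 _) (hg0 _) n
    _ = (n : ℝ≥0∞)⁻¹ * ∫⁻ z, ∑' e, ‖g (someBasis H e) z‖ₑ ^ 2 ∂ν := by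
        rw [ENNReal.tsum_mul_left, lintegral_tsum fun e => (hmg _).aemeasurable]
    _ ≤ (n : ℝ≥0∞)⁻¹ * ∫⁻ z, C ^ 2 * ‖cfeat H ν z‖ₑ ^ 2 ∂ν := by
        gcongr 1
        refine lintegral_mono_ae ?_
        filter_upwards [hζ] with z hz
        simp only [hg, enorm_smul, mul_pow]
        rw [ENNReal.tsum_mul_right]
        gcongr
        simp_rw [real_inner_comm (someBasis H _)]
        rw [← enorm_sq_eq_tsum]
        gcongr
        rw [← ENNReal.ofReal_coe_nnreal, ← ofReal_norm]
        exact ENNReal.ofReal_le_ofReal hz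
    _ = _ := by rw [lintegral_const_mul _ (hηm.enorm.pow_const 2)]

theorem noiseOp_eq_sub {n : ℕ} {z : ℕ → E × 𝓨} (hn : n ≠ 0) (y₀ : 𝓨) (S : H →L[ℝ] H) :
    noiseOp ν y₀ S n z =
      (n : ℝ)⁻¹ • ∑ i ∈ Finset.range n, rankOne ℝ (cfeat H ν (z i)) (resid ν y₀ S (z i)) -
        rankOne ℝ (cfeatMean H ν n z) ((n : ℝ)⁻¹ • ∑ i ∈ Finset.range n, resid ν y₀ S (z i)) := by
  rw [noiseOp]
  simp_rw [featHat_eq (ν := ν) hn, map_sub, sub_apply]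
  rw [Finset.sum_sub_distrib, sum_rankOne_right, smul_sub, map_smul]

theorem tendsto_noiseOp (hZm : ∀ i, Measurable (Z i)) (hZi : iIndepFun Z P)
    (hZl : ∀ i, P.map (Z i) = ν) (hdist : Measurable fun q : 𝓨 × 𝓨 => dist q.1 q.2)
    (hd2 : Integrable (fun q : (E × 𝓨) × (E × 𝓨) => dist q.1.2 q.2.2 ^ 2) (ν.prod ν))
    (hfeat : StronglyMeasurable fun x : E => feat H x)
    (hφ : MemLp (fun z => feat H z.1) 2 ν) {y₀ : 𝓨}
    (hρ : MemLp (fun z : E × 𝓨 => dist y₀ z.2) 2 ν) {S : H →L[ℝ] H}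
    (hS : wireOp H ν = covOp H ν ∘L S) {C : NNReal} (hζ : ∀ᵐ z ∂ν, ‖resid ν y₀ S z‖ ≤ C)
    {r : ℕ → ℝ} (hr : ∀ n, 0 ≤ r n)
    (hr0 : Tendsto (fun n : ℕ => r n ^ 2 * (n : ℝ)⁻¹) atTop (𝓝 0)) :
    Tendsto (fun q : ℕ × Ω => r q.1 * ‖noiseOp ν y₀ S q.1 fun i => Z i q.2‖) (inProb P) (𝓝 0) := by
  have hηm := stronglyMeasurable_cfeat (ν := ν) hfeat
  have hζm := stronglyMeasurable_resid (ν := ν) hdist hfeat y₀ S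
  set M : ℕ → Ω → H →L[ℝ] H := fun n ω => (n : ℝ)⁻¹ • ∑ i ∈ Finset.range n,
    rankOne ℝ (cfeat H ν (Z i ω)) (resid ν y₀ S (Z i ω)) with hM
  set R : ℕ → Ω → H := fun n ω => (n : ℝ)⁻¹ • ∑ i ∈ Finset.range n, resid ν y₀ S (Z i ω) with hR
  have hMm : ∀ n, AEStronglyMeasurable (M n) P := fun n => by
    have h : StronglyMeasurable fun ω => ∑ i ∈ Finset.range n,
        rankOne ℝ (cfeat H ν (Z i ω)) (resid ν y₀ S (Z i ω)) :=
      Finset.stronglyMeasurable_fun_sum _ fun i _ =>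
        (stronglyMeasurable_rankOne hηm hζm).comp_measurable (hZm i)
    exact (h.const_smul ((n : ℝ)⁻¹)).aestronglyMeasurable
  have hC : (C ^ 2 * ∫⁻ z, ‖cfeat H ν z‖ₑ ^ 2 ∂ν : ℝ≥0∞) ≠ ⊤ := by
    rw [lintegral_enorm_sq (memLp_cfeat hφ)]
    exact ENNReal.mul_ne_top (by finiteness) ENNReal.ofReal_ne_top
  have h1 := tendsto_inProb_mul_toReal (X := fun n ω => ‖M n ω‖ₑ ^ 2)
    (fun n => (hMm n).enorm.pow_const 2) hC
    (lintegral_mean_rankOne_resid_le hZm hZi hZl hdist hd2 hfeat hφ hρ hS hζ)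
    (r := fun n => r n ^ 2) (fun n => sq_nonneg _) hr0
  have h2 := tendsto_mul_norm_cfeatMean_sq hZm hZi hZl hfeat hφ (r := fun n => r n ^ 2)
    (fun n => sq_nonneg _) hr0
  -- The mean residual need only converge; smallness of the correction comes from the mean of the
  -- centered features.
  have h3 : Tendsto (fun q : ℕ × Ω => ‖R q.1 q.2‖) (inProb P) (𝓝 ‖∫ z, resid ν y₀ S z ∂ν‖) :=
    (tendsto_inProb_mean hZm hZi hZl hζm
      ((memLp_resid hdist hfeat hφ hρ S).integrable one_le_two)).norm
  have h4 := h1.sqrt.add (h2.sqrt.mul h3)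
  simp only [Real.sqrt_zero, zero_mul, add_zero] at h4
  refine squeeze_zero' (Eventually.of_forall fun q => mul_nonneg (hr q.1) (norm_nonneg _)) ?_ h4
  filter_upwards [(tendsto_fst_inProb P).eventually (eventually_ne_atTop 0)] with q hq
  have e1 : √(r q.1 ^ 2 * (‖M q.1 q.2‖ₑ ^ 2).toReal) = r q.1 * ‖M q.1 q.2‖ := by
    rw [ENNReal.toReal_pow, toReal_enorm, ← mul_pow,
      Real.sqrt_sq (mul_nonneg (hr q.1) (norm_nonneg _))]
  have e2 : √(r q.1 ^ 2 * ‖cfeatMean H ν q.1 fun i => Z i q.2‖ ^ 2) =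
      r q.1 * ‖cfeatMean H ν q.1 fun i => Z i q.2‖ := by
    rw [← mul_pow, Real.sqrt_sq (mul_nonneg (hr q.1) (norm_nonneg _))]
  rw [e1, e2, mul_assoc, ← mul_add]
  refine mul_le_mul_of_nonneg_left ?_ (hr q.1)
  rw [noiseOp_eq_sub hq]
  refine (norm_sub_le _ _).trans_eq ?_
  rw [norm_rankOne]

end Noise

/-! ### The estimation error of the regression vectors. -/

section Error

variable {E 𝓨 Ω : Type*} [MeasurableSpace E] [MetricSpace 𝓨] [MeasurableSpace 𝓨]
  [MeasurableSpace Ω]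
variable {H : Type*} [NormedAddCommGroup H] [InnerProductSpace ℝ H] [CompleteSpace H]
  [RKHS ℝ H E ℝ]
variable {ν : Measure (E × 𝓨)} [IsProbabilityMeasure ν] {P : Measure Ω} [IsProbabilityMeasure P]
variable {Z : ℕ → Ω → E × 𝓨}

theorem stronglyMeasurable_crossVec (hdist : Measurable fun q : 𝓨 × 𝓨 => dist q.1 q.2)
    (hfeat : StronglyMeasurable fun x : E => feat H x) (y₀ : 𝓨) :
    StronglyMeasurable (crossVec H ν y₀) := by
  refine StronglyMeasurable.add (StronglyMeasurable.smul ?_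
    ((stronglyMeasurable_cfeat hfeat).comp_measurable measurable_snd))
    ((stronglyMeasurable_regVec hdist hfeat y₀).comp_measurable measurable_fst.snd)
  exact ((measurable_cdist hdist y₀).comp
    (measurable_fst.snd.prodMk measurable_snd.snd)).stronglyMeasurable

theorem memLp_crossVec (hdist : Measurable fun q : 𝓨 × 𝓨 => dist q.1 q.2)
    (hfeat : StronglyMeasurable fun x : E => feat H x)
    (hφ : MemLp (fun z => feat H z.1) 2 ν) {y₀ : 𝓨}
    (hρ : MemLp (fun z : E × 𝓨 => dist y₀ z.2) 2 ν) :
    MemLp (crossVec H ν y₀) 2 (ν.prod ν) := by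
  have hη := memLp_cfeat hφ
  have h1 : MemLp (fun q : (E × 𝓨) × (E × 𝓨) => dist y₀ q.1.2 * ‖cfeat H ν q.2‖) 2
      (ν.prod ν) := by
    refine (memLp_two_iff_integrable_sq
      (hρ.aestronglyMeasurable.comp_fst.mul hη.norm.aestronglyMeasurable.comp_snd)).2 ?_
    exact (hρ.integrable_sq.mul_prod hη.norm.integrable_sq).congr
      (Eventually.of_forall fun q => (mul_pow _ _ 2).symm)
  refine (h1.add (memLp_const (regBound H ν y₀ : ℝ))).mono'
    (stronglyMeasurable_crossVec hdist hfeat y₀).aestronglyMeasurable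
    (Eventually.of_forall fun q => ?_)
  refine (norm_add_le _ _).trans (add_le_add ?_ (norm_regVec_le hdist hφ hρ _))
  rw [norm_smul]
  exact mul_le_mul_of_nonneg_right (abs_cdist_le _ _ _) (norm_nonneg _)

theorem integral_crossVec (hdist : Measurable fun q : 𝓨 × 𝓨 => dist q.1 q.2)
    (hφ : MemLp (fun z => feat H z.1) 2 ν) (y₀ : 𝓨) (z : E × 𝓨) :
    ∫ z', crossVec H ν y₀ (z, z') ∂ν = 0 := by
  simp only [crossVec]
  rw [integral_add (integrable_cdist_smul hdist hφ y₀ z.2) (integrable_const _)]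
  simp [regVec]

/-- For each i the off-diagonal summands are orthogonal, so n indices contribute at most n second
moments each, against n⁻³. -/
theorem lintegral_sum_crossVec_le (hZm : ∀ i, Measurable (Z i)) (hZi : iIndepFun Z P)
    (hZl : ∀ i, P.map (Z i) = ν) (hdist : Measurable fun q : 𝓨 × 𝓨 => dist q.1 q.2)
    (hfeat : StronglyMeasurable fun x : E => feat H x)
    (hφ : MemLp (fun z => feat H z.1) 2 ν) {y₀ : 𝓨}
    (hρ : MemLp (fun z : E × 𝓨 => dist y₀ z.2) 2 ν) (n : ℕ) :
    ∫⁻ ω, (n : ℝ≥0∞)⁻¹ ^ 3 * ∑ i ∈ Finset.range n,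
      ‖∑ j ∈ (Finset.range n).erase i, crossVec H ν y₀ (Z i ω, Z j ω)‖ₑ ^ 2 ∂P ≤
      (n : ℝ≥0∞)⁻¹ * ∫⁻ q, ‖crossVec H ν y₀ q‖ₑ ^ 2 ∂(ν.prod ν) := by
  rcases Nat.eq_zero_or_pos n with rfl | hn
  · simp
  have hWm := stronglyMeasurable_crossVec (ν := ν) hdist hfeat y₀
  have hm : ∀ i, Measurable fun ω =>
      ‖∑ j ∈ (Finset.range n).erase i, crossVec H ν y₀ (Z i ω, Z j ω)‖ₑ ^ 2 := fun i =>
    (Finset.stronglyMeasurable_fun_sum _ fun j _ =>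
      hWm.comp_measurable ((hZm i).prodMk (hZm j))).enorm.pow_const 2
  set w := ∫⁻ q, ‖crossVec H ν y₀ q‖ₑ ^ 2 ∂(ν.prod ν)
  have hi : ∀ i ∈ Finset.range n, ∫⁻ ω,
      ‖∑ j ∈ (Finset.range n).erase i, crossVec H ν y₀ (Z i ω, Z j ω)‖ₑ ^ 2 ∂P ≤ n * w :=
    fun i hi => by
    rw [lintegral_enorm_sum_sq hZm hZi hZl hWm (memLp_crossVec hdist hfeat hφ hρ)
      (Eventually.of_forall (integral_crossVec hdist hφ y₀)) (Finset.notMem_erase i _)]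
    gcongr
    exact (Finset.card_le_card (Finset.erase_subset _ _)).trans_eq (Finset.card_range n)
  have hc : (n : ℝ≥0∞)⁻¹ * n = 1 := ENNReal.inv_mul_cancel (by positivity) (by simp)
  have hfin : (n : ℝ≥0∞)⁻¹ ≠ ⊤ := by simp [hn.ne']
  rw [lintegral_const_mul' _ _ (ENNReal.pow_ne_top hfin), lintegral_finsetSum _ fun i _ => hm i]
  calc (n : ℝ≥0∞)⁻¹ ^ 3 * ∑ i ∈ Finset.range n, ∫⁻ ω,
        ‖∑ j ∈ (Finset.range n).erase i, crossVec H ν y₀ (Z i ω, Z j ω)‖ₑ ^ 2 ∂P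
      ≤ (n : ℝ≥0∞)⁻¹ ^ 3 * ∑ i ∈ Finset.range n, n * w := by
        gcongr with i h
        exact hi i h
    _ = ((n : ℝ≥0∞)⁻¹ * n) * ((n : ℝ≥0∞)⁻¹ * n) * ((n : ℝ≥0∞)⁻¹ * w) := by
        rw [Finset.sum_const, Finset.card_range, nsmul_eq_mul]
        ring
    _ = (n : ℝ≥0∞)⁻¹ * w := by rw [hc, one_mul, one_mul]

theorem tendsto_mean_norm_regHat_sub_sq (hZm : ∀ i, Measurable (Z i)) (hZi : iIndepFun Z P)
    (hZl : ∀ i, P.map (Z i) = ν) (hdist : Measurable fun q : 𝓨 × 𝓨 => dist q.1 q.2)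
    (hfeat : StronglyMeasurable fun x : E => feat H x)
    (hφ : MemLp (fun z => feat H z.1) 2 ν) {y₀ : 𝓨}
    (hρ : MemLp (fun z : E × 𝓨 => dist y₀ z.2) 2 ν)
    {r : ℕ → ℝ} (hr : ∀ n, 0 ≤ r n)
    (hr0 : Tendsto (fun n : ℕ => r n * (n : ℝ)⁻¹) atTop (𝓝 0)) :
    Tendsto (fun q : ℕ × Ω => r q.1 * ((q.1 : ℝ)⁻¹ * ∑ i ∈ Finset.range q.1,
      ‖regHat H y₀ q.1 (fun i => Z i q.2) i - regVec H ν y₀ (Z i q.2).2‖ ^ 2)) (inProb P)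
      (𝓝 0) := by
  have hηm := stronglyMeasurable_cfeat (ν := ν) hfeat
  have hWm := stronglyMeasurable_crossVec (ν := ν) hdist hfeat y₀
  have hρm : StronglyMeasurable fun z : E × 𝓨 => dist y₀ z.2 ^ 2 :=
    ((hdist.comp (measurable_const.prodMk measurable_snd)).pow_const 2).stronglyMeasurable
  have hA : Tendsto (fun q : ℕ × Ω => (q.1 : ℝ)⁻¹ * ∑ i ∈ Finset.range q.1,
      dist y₀ (Z i q.2).2 ^ 2) (inProb P) (𝓝 (∫ z, dist y₀ z.2 ^ 2 ∂ν)) :=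
    tendsto_inProb_mean (g := fun z : E × 𝓨 => dist y₀ z.2 ^ 2) hZm hZi hZl hρm hρ.integrable_sq
  have hB : Tendsto (fun q : ℕ × Ω => (q.1 : ℝ)⁻¹ * ∑ i ∈ Finset.range q.1,
      ‖cfeat H ν (Z i q.2)‖ ^ 2) (inProb P) (𝓝 (∫ z, ‖cfeat H ν z‖ ^ 2 ∂ν)) :=
    tendsto_inProb_mean (g := fun z => ‖cfeat H ν z‖ ^ 2) hZm hZi hZl (hηm.norm.pow 2) (memLp_cfeat hφ).norm.integrable_sq
  have hm := tendsto_mul_norm_cfeatMean_sq (r := r) hZm hZi hZl hfeat hφ hr hr0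
  have hn : Tendsto (fun q : ℕ × Ω => r q.1 * (q.1 : ℝ)⁻¹) (inProb P) (𝓝 0) :=
    hr0.comp (tendsto_fst_inProb P)
  have hQ := tendsto_inProb_mul_toReal (X := fun n ω => (n : ℝ≥0∞)⁻¹ ^ 3 * ∑ i ∈ Finset.range n,
      ‖∑ j ∈ (Finset.range n).erase i, crossVec H ν y₀ (Z i ω, Z j ω)‖ₑ ^ 2) (fun n => by
    refine (Measurable.const_mul (Finset.measurable_fun_sum _ fun i _ => ?_) _).aemeasurable
    exact (Finset.stronglyMeasurable_fun_sum _ fun j _ =>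
      hWm.comp_measurable ((hZm i).prodMk (hZm j))).enorm.pow_const 2)
    (lintegral_enorm_sq (memLp_crossVec hdist hfeat hφ hρ) ▸ ENNReal.ofReal_ne_top)
    (lintegral_sum_crossVec_le hZm hZi hZl hdist hfeat hφ hρ) hr hr0
  have h := (((hn.mul (hA.mul hB)).add (hm.mul hA)).add hQ).const_mul 12
  simp only [zero_mul, add_zero, mul_zero] at h
  refine squeeze_zero' (Eventually.of_forall fun q => mul_nonneg (hr q.1) (by positivity)) ?_ h
  filter_upwards [(tendsto_fst_inProb P).eventually (eventually_ge_atTop 2)] with q hq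
  refine (mul_le_mul_of_nonneg_left (mean_norm_regHat_sub_sq_le (H := H) (ν := ν)
    (z := fun i => Z i q.2) (y₀ := y₀) hq) (hr q.1)).trans_eq ?_
  have e : ((q.1 : ℝ≥0∞)⁻¹ ^ 3 * ∑ i ∈ Finset.range q.1,
      ‖∑ j ∈ (Finset.range q.1).erase i, crossVec H ν y₀ (Z i q.2, Z j q.2)‖ₑ ^ 2).toReal =
      ((q.1 : ℝ) ^ 3)⁻¹ * ∑ i ∈ Finset.range q.1,
        ‖∑ j ∈ (Finset.range q.1).erase i, crossVec H ν y₀ (Z i q.2, Z j q.2)‖ ^ 2 := by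
    rw [ENNReal.toReal_mul, ENNReal.toReal_sum fun _ _ => by finiteness]
    simp
  rw [e]
  ring

end Error

/-! ### The sample operators fit the abstract setting. -/

section Approximation

variable {E 𝓨 Ω : Type*} [MeasurableSpace E] [MetricSpace 𝓨] [MeasurableSpace 𝓨]
  [MeasurableSpace Ω]
variable {H : Type*} [NormedAddCommGroup H] [InnerProductSpace ℝ H] [CompleteSpace H]
  [RKHS ℝ H E ℝ]
variable {ν : Measure (E × 𝓨)} [IsProbabilityMeasure ν] {P : Measure Ω} [IsProbabilityMeasure P]
variable {Z : ℕ → Ω → E × 𝓨}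

theorem regularizedApprox (hZm : ∀ i, Measurable (Z i)) (hZi : iIndepFun Z P)
    (hZl : ∀ i, P.map (Z i) = ν) (hdist : Measurable fun q : 𝓨 × 𝓨 => dist q.1 q.2)
    (hd2 : Integrable (fun q : (E × 𝓨) × (E × 𝓨) => dist q.1.2 q.2.2 ^ 2) (ν.prod ν))
    (hfeat : StronglyMeasurable fun x : E => feat H x)
    (hφ : MemLp (fun z => feat H z.1) 2 ν) {y₀ : 𝓨}
    (hρ : MemLp (fun z : E × 𝓨 => dist y₀ z.2) 2 ν) {S : H →L[ℝ] H}
    (hS : wireOp H ν = covOp H ν ∘L S) {C : NNReal} (hζ : ∀ᵐ z ∂ν, ‖resid ν y₀ S z‖ ≤ C)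
    {ε : ℕ → ℝ} (hε : ∀ n, 0 < ε n) (hε0 : Tendsto ε atTop (𝓝 0))
    (hr : Tendsto (fun n : ℕ => (ε n)⁻¹ ^ 2 * (n : ℝ)⁻¹) atTop (𝓝 0)) :
    RegularizedApprox (inProb P) (fun q => ε q.1) (covOp H ν) S
      (fun q => covHat H q.1 fun i => Z i q.2) (fun q => wireHat H q.1 fun i => Z i q.2)
      (fun q => noiseOp ν y₀ S q.1 fun i => Z i q.2)
      (fun q => errorOp H ν y₀ q.1 fun i => Z i q.2) := by
  have hr1 : Tendsto (fun n : ℕ => (ε n)⁻¹ * (n : ℝ)⁻¹) atTop (𝓝 0) := by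
    have h := hε0.mul hr
    rw [zero_mul] at h
    refine h.congr fun n => ?_
    have := (hε n).ne'
    field_simp
  have hε' : Tendsto (fun q : ℕ × Ω => ε q.1) (inProb P) (𝓝 0) := hε0.comp (tendsto_fst_inProb P)
  have hδ := tendsto_mean_norm_regHat_sub_sq hZm hZi hZl hdist hfeat hφ hρ
    (r := fun n => (ε n)⁻¹) (fun n => inv_nonneg.2 (hε n).le) hr1
  refine ⟨fun q => hε q.1, hε', isPositive_covOp hφ, fun q => isPositive_covHat,
    tendsto_covHat hZm hZi hZl hfeat hφ, ?_,
    tendsto_noiseOp hZm hZi hZl hdist hd2 hfeat hφ hρ hS hζ (r := fun n => (ε n)⁻¹)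
      (fun n => inv_nonneg.2 (hε n).le) hr,
    ?_, ?_⟩
  · filter_upwards [(tendsto_fst_inProb P).eventually (eventually_ne_atTop 0)] with q hq
    exact wireHat_eq_add hq S
  · have h := hδ.sqrt
    rw [Real.sqrt_zero] at h
    refine squeeze_zero (fun q => by positivity) (fun q => ?_) h
    rw [Real.sqrt_mul (inv_nonneg.2 (hε q.1).le), Real.sqrt_inv]
    refine mul_le_mul_of_nonneg_left (Real.le_sqrt_of_sq_le ?_) (by positivity)
    have h1 := (enorm_sq_le_hsSq (someBasis H) _).trans
      (hsSq_invSqrtHat_comp_le (H := H) (n := q.1) (z := fun i => Z i q.2) (someBasis H) (hε q.1)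
        fun i => regHat H y₀ q.1 (fun i => Z i q.2) i - regVec H ν y₀ (Z i q.2).2)
    rw [enorm_sq_eq_ofReal, ENNReal.ofReal_le_ofReal_iff (by positivity)] at h1
    exact h1
  · have hδ1 : Tendsto (fun q : ℕ × Ω => (q.1 : ℝ)⁻¹ * ∑ i ∈ Finset.range q.1,
        ‖regHat H y₀ q.1 (fun i => Z i q.2) i - regVec H ν y₀ (Z i q.2).2‖ ^ 2) (inProb P)
        (𝓝 0) := by
      have h := hε'.mul hδ
      rw [zero_mul] at h
      refine h.congr fun q => ?_
      rw [mul_inv_cancel_left₀ (hε q.1).ne']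
    set M : ℝ := ((regBound H ν y₀ : NNReal) : ℝ)
    -- From ‖m̂‖² ≤ 2‖m̂ − m‖² + 2M², where the average of the first squares is eventually below 1.
    refine ⟨ENNReal.ofReal (2 * 1 + 2 * M ^ 2), ENNReal.ofReal_ne_top, ?_⟩
    filter_upwards [hδ1.eventually (gt_mem_nhds one_pos),
      (tendsto_fst_inProb P).eventually (eventually_ne_atTop 0)] with q h1 hq
    rw [wireHat_eq y₀]
    refine (hsSq_invSqrtHat_comp_le (H := H) (n := q.1) (z := fun i => Z i q.2) (someBasis H)
      (hε q.1) _).trans (ENNReal.ofReal_le_ofReal ?_)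
    have hq' : (q.1 : ℝ) ≠ 0 := by exact_mod_cast hq
    have h2 : ∀ i, ‖regHat H y₀ q.1 (fun i => Z i q.2) i‖ ^ 2 ≤
        2 * ‖regHat H y₀ q.1 (fun i => Z i q.2) i - regVec H ν y₀ (Z i q.2).2‖ ^ 2 + 2 * M ^ 2 :=
      fun i => by
      have h3 := norm_regVec_le hdist hφ hρ (Z i q.2).2
      have h4 := norm_le_norm_sub_add (regHat H y₀ q.1 (fun i => Z i q.2) i)
        (regVec H ν y₀ (Z i q.2).2)
      set a := ‖regHat H y₀ q.1 (fun i => Z i q.2) i - regVec H ν y₀ (Z i q.2).2‖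
      have h5 := pow_le_pow_left₀ (norm_nonneg _) (h4.trans (add_le_add_right h3 a)) 2
      nlinarith [sq_nonneg (a - M)]
    calc (q.1 : ℝ)⁻¹ * ∑ i ∈ Finset.range q.1, ‖regHat H y₀ q.1 (fun i => Z i q.2) i‖ ^ 2
        ≤ (q.1 : ℝ)⁻¹ * ∑ i ∈ Finset.range q.1,
          (2 * ‖regHat H y₀ q.1 (fun i => Z i q.2) i - regVec H ν y₀ (Z i q.2).2‖ ^ 2 +
            2 * M ^ 2) := by
          gcongr with i _
          exact h2 i
      _ = 2 * ((q.1 : ℝ)⁻¹ * ∑ i ∈ Finset.range q.1,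
          ‖regHat H y₀ q.1 (fun i => Z i q.2) i - regVec H ν y₀ (Z i q.2).2‖ ^ 2) +
            2 * M ^ 2 := by
          rw [Finset.sum_add_distrib, ← Finset.mul_sum, Finset.sum_const, Finset.card_range,
            nsmul_eq_mul]
          field_simp
      _ ≤ 2 * 1 + 2 * M ^ 2 := by gcongr

end Approximation

/-! ### Existence and uniqueness of the target operator. -/

section Sandwich

variable {H : Type*} [NormedAddCommGroup H] [InnerProductSpace ℝ H] [CompleteSpace H]

theorem IsInverseImage.unique {T : H →L[ℝ] H} {y x x' : H} (h : IsInverseImage T y x)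
    (h' : IsInverseImage T y x') : x = x' := by
  have h1 : x - x' ∈ LinearMap.ker (T : H →ₗ[ℝ] H) := by
    change T (x - x') = 0
    rw [map_sub, h.1, h'.1, sub_self]
  have h2 := Submodule.inner_right_of_mem_orthogonal h1 (Submodule.sub_mem _ h.2 h'.2)
  rwa [inner_self_eq_zero, sub_eq_zero] at h2

theorem exists_isInverseImage (T : H →L[ℝ] H) (x : H) : ∃ u, IsInverseImage T (T x) u := by
  have : CompleteSpace (LinearMap.ker (T : H →ₗ[ℝ] H)) :=
    T.isClosed_ker.completeSpace_coe
  set N := LinearMap.ker (T : H →ₗ[ℝ] H)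
  refine ⟨x - N.starProjection x, ?_, N.sub_starProjection_mem_orthogonal x⟩
  have h : T (N.starProjection x) = 0 := N.starProjection_apply_mem x
  rw [map_sub, h, sub_zero]

theorem map_mem_ker_orthogonal {R : H →L[ℝ] H} (hR : IsSelfAdjoint R) (x : H) :
    R x ∈ (LinearMap.ker (R : H →ₗ[ℝ] H))ᗮ := by
  rw [Submodule.mem_orthogonal]
  intro k hk
  have hk' : R k = 0 := hk
  rw [← inner_map_comm hR, hk', inner_zero_left]

theorem map_eq_zero_of_mem_orthogonal {R : H →L[ℝ] H} (hR : IsSelfAdjoint R) {g : H}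
    (hg : g ∈ (LinearMap.range (R : H →ₗ[ℝ] H))ᗮ) : R g = 0 := by
  rw [← inner_self_eq_zero (𝕜 := ℝ), inner_map_comm hR, real_inner_comm]
  exact Submodule.inner_right_of_mem_orthogonal (LinearMap.mem_range_self _ _) hg

/-- The closed kernel of V − W contains the range of R and its orthogonal complement, so its own
complement is trivial. -/
theorem eq_of_eqOn_range {R V W : H →L[ℝ] H} (h1 : ∀ g ∈ LinearMap.range (R : H →ₗ[ℝ] H), V g = W g)
    (h2 : ∀ g ∈ (LinearMap.range (R : H →ₗ[ℝ] H))ᗮ, V g = W g) : V = W := by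
  set N := LinearMap.ker ((V - W : H →L[ℝ] H) : H →ₗ[ℝ] H) with hN
  have hmem : ∀ g, g ∈ N ↔ V g = W g := fun g => by
    change (V - W) g = 0 ↔ _
    rw [sub_apply, sub_eq_zero]
  have : CompleteSpace N := (V - W).isClosed_ker.completeSpace_coe
  have hbot : Nᗮ = ⊥ := by
    have hle : LinearMap.range (R : H →ₗ[ℝ] H) ≤ N := fun g hg => (hmem g).2 (h1 g hg)
    rw [eq_bot_iff]
    intro g hg
    have hg' : g ∈ N := (hmem g).2 (h2 g (Submodule.orthogonal_le hle hg))
    have := Submodule.inner_right_of_mem_orthogonal hg' hg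
    rwa [inner_self_eq_zero] at this
  have htop := Submodule.orthogonal_eq_bot_iff.1 hbot
  ext g
  exact (hmem g).1 (htop ▸ Submodule.mem_top)

/-- With R = T^{1/2}, LL* = R·(R S S* R)·R. Cancelling the outer factors is legitimate because
values of the self-adjoint R are orthogonal to its kernel. -/
theorem isSandwich_iff {T L S V : H →L[ℝ] H} (hT : T.IsPositive) (hLS : L = T ∘L S) :
    IsSandwich (opSqrt T) (L ∘L ContinuousLinearMap.adjoint L) V ↔
      V = opSqrt T * S * star (opSqrt T * S) := by
  obtain ⟨hRp, hRR⟩ := opSqrt_spec hT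
  set R := opSqrt T
  have hR := hRp.isSelfAdjoint
  set A := R * S * star (R * S) with hA
  have hAx : ∀ g, A g = R (S (ContinuousLinearMap.adjoint S (R g))) := fun g => by
    rw [hA, star_mul, hR.star_eq]; rfl
  have hBu : ∀ u, (L ∘L ContinuousLinearMap.adjoint L) u =
      R (R (S (ContinuousLinearMap.adjoint S (R (R u))))) := fun u => by
    have e1 : ContinuousLinearMap.adjoint L = ContinuousLinearMap.adjoint S ∘L R ∘L R := by
      have : ContinuousLinearMap.adjoint T = T := hT.isSelfAdjoint
      rw [hLS, ContinuousLinearMap.adjoint_comp, this, hRR]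
    rw [e1, hLS, ← hRR]
    rfl
  have hsand : IsSandwich R (L ∘L ContinuousLinearMap.adjoint L) A := by
    refine ⟨?_, fun g hg => ?_⟩
    · rintro g ⟨x, rfl⟩
      obtain ⟨u, hu⟩ := exists_isInverseImage R x
      refine ⟨u, A (R x), hu, ⟨?_, ?_⟩, rfl⟩
      · rw [hBu, hu.1, hAx]
      · rw [hAx]
        exact map_mem_ker_orthogonal hR _
    · rw [hAx, map_eq_zero_of_mem_orthogonal hR hg]
      simp
  refine ⟨fun hV => eq_of_eqOn_range (R := R) (fun g hg => ?_) fun g hg => ?_, fun h => h ▸ hsand⟩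
  · obtain ⟨u, w, hu, hw, hVg⟩ := hV.1 g hg
    obtain ⟨u', w', hu', hw', hAg⟩ := hsand.1 g hg
    obtain rfl := hu.unique hu'
    rw [hVg, hAg, hw.unique hw']
  · rw [hV.2 g hg, hsand.2 g hg]

end Sandwich

theorem targetHat_eq {E 𝓨 H : Type*} [MeasurableSpace E] [MetricSpace 𝓨] [MeasurableSpace 𝓨]
    [NormedAddCommGroup H] [InnerProductSpace ℝ H] [CompleteSpace H] [RKHS ℝ H E ℝ] {n : ℕ}
    {ε : ℝ} (hε : 0 < ε) (z : ℕ → E × 𝓨) :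
    targetHat H n ε z = invSqrtHat H n ε z * wireHat H n z *
      star (invSqrtHat H n ε z * wireHat H n z) := by
  have h : star (invSqrtHat H n ε z) = invSqrtHat H n ε z :=
    (inverse_opSqrt_add (isPositive_covHat (n := n) (z := z)) hε).2.2.2.2.1
  rw [star_mul, h]
  rfl

/-- Squaring the rate gives n⁻¹ε⁻³ → 0, and one more factor ε → 0 gives the form used for the noise.
-/
theorem tendsto_inv_sq_mul_inv {ε : ℕ → ℝ} (hε : ∀ n, 0 < ε n) (hε0 : Tendsto ε atTop (𝓝 0))
    (hεrate : Tendsto (fun n : ℕ => (n : ℝ) ^ (-(1 / 2) : ℝ) / ε n ^ (3 / 2 : ℝ)) atTop (𝓝 0)) :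
    Tendsto (fun n : ℕ => (ε n)⁻¹ ^ 2 * (n : ℝ)⁻¹) atTop (𝓝 0) := by
  have h := (hεrate.pow 2).mul hε0
  rw [mul_zero] at h
  refine h.congr fun n => ?_
  have h1 : ((n : ℝ) ^ (-(1 / 2) : ℝ)) ^ 2 = (n : ℝ)⁻¹ := by
    rw [← Real.rpow_natCast, ← Real.rpow_mul (Nat.cast_nonneg n), ← Real.rpow_neg_one]
    norm_num
  have h2 : (ε n ^ (3 / 2 : ℝ)) ^ 2 = ε n ^ 3 := by
    rw [← Real.rpow_natCast, ← Real.rpow_mul (hε n).le, ← Real.rpow_natCast]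
    norm_num
  rw [div_pow, h1, h2]
  have := (hε n).ne'
  field_simp

end FrechetSDR

end

theorem theorem3 {p d : ℕ}
    {𝓨 : Type*} [MetricSpace 𝓨] [MeasurableSpace 𝓨]
    (hdist : Measurable fun q : 𝓨 × 𝓨 => dist q.1 q.2)
    {H : Type*} [NormedAddCommGroup H] [InnerProductSpace ℝ H] [CompleteSpace H]
    [RKHS ℝ H (EuclideanSpace ℝ (Fin p)) ℝ]
    (hfeat : StronglyMeasurable fun x : EuclideanSpace ℝ (Fin p) => FrechetSDR.feat H x)
    -- the law of `(X, Y)`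
    (ν : Measure (EuclideanSpace ℝ (Fin p) × 𝓨)) [IsProbabilityMeasure ν]
    -- the i.i.d. sample `(X₁, Y₁), (X₂, Y₂), …`
    {Ω : Type*} [MeasurableSpace Ω] (P : Measure Ω) [IsProbabilityMeasure P]
    (Z : ℕ → Ω → EuclideanSpace ℝ (Fin p) × 𝓨)
    (hZmeas : ∀ i, Measurable (Z i)) (hZind : iIndepFun Z P) (hZlaw : ∀ i, P.map (Z i) = ν)
    -- moment assumptions
    (hκ : Integrable (fun z => FrechetSDR.kerVal H z.1 z.1) ν)
    (hd2 : Integrable (fun q => dist q.1.2 q.2.2 ^ 2) (ν.prod ν))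
    -- `Λ = Σ S`
    (hS : FrechetSDR.HasCorrelationOp H ν)
    -- `Y` and `X` are independent given `f(X)`, and density of the central class
    (f : EuclideanSpace ℝ (Fin p) → EuclideanSpace ℝ (Fin d)) (hf : Measurable f)
    (hsuff : FrechetSDR.CondIndepGiven ν
      (MeasurableSpace.comap (fun z : EuclideanSpace ℝ (Fin p) × 𝓨 => f z.1) inferInstance)
      Prod.snd Prod.fst)
    (hdense : FrechetSDR.DenseModConst H
      (MeasurableSpace.comap f inferInstance) (ν.map Prod.fst))
    -- regularization
    (ε : ℕ → ℝ) (hεpos : ∀ n, 0 < ε n) (hε0 : Tendsto ε atTop (𝓝 0))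
    (hεrate : Tendsto (fun n : ℕ => (n : ℝ) ^ (-(1 / 2) : ℝ) / ε n ^ (3 / 2 : ℝ)) atTop (𝓝 0)) :
    -- `V = Σ^{-1/2} Λ Λ* Σ^{-1/2}` is a well-defined bounded operator
    (∃! V : H →L[ℝ] H, FrechetSDR.IsTargetOp H ν V) ∧
    ∀ V : H →L[ℝ] H, FrechetSDR.IsTargetOp H ν V →
      FrechetSDR.TendstoZeroInProb P
        (fun n ω => FrechetSDR.hsNorm (FrechetSDR.targetHat H n (ε n) (fun i => Z i ω) - V)) ∧
      -- `ψ` is the leading eigenfunction (unique up to sign, in the range of `Σ`),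
      -- `f₁ = Σ^{-1/2} ψ`, and `ψhat n` is any leading eigenfunction of the estimator
      ∀ ψ f₁ : H, FrechetSDR.IsLeading V ψ →
        (∀ g, FrechetSDR.IsLeading V g → g = ψ ∨ g = -ψ) →
        ψ ∈ LinearMap.range (FrechetSDR.covOp H ν : H →ₗ[ℝ] H) →
        FrechetSDR.IsInverseImage (FrechetSDR.opSqrt (FrechetSDR.covOp H ν)) ψ f₁ →
        ∀ ψhat : ℕ → Ω → H,
          (∀ n, ∀ᵐ ω ∂P, FrechetSDR.IsLeading
            (FrechetSDR.targetHat H n (ε n) (fun i => Z i ω)) (ψhat n ω)) →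
          TendstoInMeasure P (fun n ω => |⟪ψhat n ω, ψ⟫|) atTop (fun _ => 1) ∧
          FrechetSDR.TendstoZeroInProb P (fun n ω =>
            eLpNorm
              (FrechetSDR.centered (ν.map Prod.fst)
                  (FrechetSDR.invSqrtHat H n (ε n) (fun i => Z i ω)
                    ((if 0 ≤ ⟪ψhat n ω, ψ⟫ then (1 : ℝ) else -1) • ψhat n ω))
                - FrechetSDR.centered (ν.map Prod.fst) f₁)
              2 (ν.map Prod.fst)) := by
  have hφ : MemLp (fun z : EuclideanSpace ℝ (Fin p) × 𝓨 =>
      FrechetSDR.feat H z.1) 2 ν := FrechetSDR.memLp_feat hfeat hκ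
  obtain ⟨y₀, hρ⟩ := FrechetSDR.exists_memLp_dist hdist hd2
  obtain ⟨S, hS, -⟩ := hS
  have hζ : ∀ᵐ z ∂ν, ‖FrechetSDR.resid ν y₀ S z‖ ≤ (3 * FrechetSDR.regBound H ν y₀ : NNReal) := by
    simpa using FrechetSDR.ae_norm_resid_le hdist hd2 hfeat hφ hρ hS hf hsuff hdense
  have happrox := FrechetSDR.regularizedApprox hZmeas hZind hZlaw hdist hd2 hfeat hφ hρ hS hζ hεpos
    hε0 (FrechetSDR.tendsto_inv_sq_mul_inv hεpos hε0 hεrate)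
  have hV : ∀ V : H →L[ℝ] H, FrechetSDR.IsTargetOp H ν V ↔
      V = FrechetSDR.opSqrt (FrechetSDR.covOp H ν) * S *
        star (FrechetSDR.opSqrt (FrechetSDR.covOp H ν) * S) := fun V =>
    FrechetSDR.isSandwich_iff (FrechetSDR.isPositive_covOp hφ) hS
  refine ⟨⟨_, (hV _).2 rfl, fun V h => (hV V).1 h⟩, fun V hVT => ?_⟩
  obtain rfl := (hV V).1 hVT
  refine ⟨?_, fun ψ f₁ hψ huniq hran hf₁ ψhat hψhat => ?_⟩
  · rw [FrechetSDR.tendstoZeroInProb_iff]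
    have h := (ENNReal.continuous_rpow_const (y := 1 / 2)).tendsto 0 |>.comp happrox.tendsto_hsSq
    rw [ENNReal.zero_rpow_of_pos (by norm_num)] at h
    refine h.congr fun q => ?_
    rw [FrechetSDR.targetHat_eq (hεpos q.1), FrechetSDR.hsNorm]
    rfl
  have hlead : ∀ᶠ q in FrechetSDR.inProb P, FrechetSDR.IsLeading
      (FrechetSDR.targetHat H q.1 (ε q.1) (fun i => Z i q.2)) (ψhat q.1 q.2) :=
    FrechetSDR.eventually_inProb_of_ae hψhat
  have hlead' := hlead
  simp_rw [FrechetSDR.targetHat_eq (hεpos _)] at hlead'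
  have hcomp : ∀ q : ℕ × Ω, IsCompactOperator (FrechetSDR.wireHat H q.1 fun i => Z i q.2) :=
    fun q => FrechetSDR.isCompactOperator_wireHat
  constructor
  · exact (FrechetSDR.tendstoInMeasure_iff_inProb (Z := fun n ω => |⟪ψhat n ω, ψ⟫|)).2
      (happrox.tendsto_abs_inner hcomp hψ huniq (g := fun q => ψhat q.1 q.2) hlead')
  · rw [FrechetSDR.tendstoZeroInProb_iff]
    -- Since ψ = Σ^{1/2}f₁, the L₂ distance of the centered functions is ‖Σ^{1/2}K(±ψ̂) − ψ‖.
    have h := (happrox.tendsto_sqrt_K hcomp hψ huniq hran (g := fun q => ψhat q.1 q.2)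
      hlead').sub_const ψ
    rw [sub_self] at h
    have h' := h.enorm
    rw [enorm_zero] at h'
    refine h'.congr fun q => ?_
    rw [FrechetSDR.eLpNorm_centered_sub hfeat hφ, map_sub, hf₁.1]
    rfl
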